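/- Let $m,n\ge 0$ be integers, $A$ an integer $m\times n$ matrix, $b\in\mathbb Z^m$, $w,l,u\in\mathbb Z^n$, and consider the linear program $\max\{wx : x\in P\}$ with $P=\{x\in\mathbb R^n: Ax=b,\ l\le x\le u\}$. A \emph{circuit} of $A$ is a nonzero vector $c\in\mathbb Z^n$ with $Ac=0$ such that no nonzero $d\in\mathbb R^n$ with $Ad=0$ has $\mathrm{supp}(d)\subsetneq\mathrm{supp}(c)$. A \emph{circuit step} leads from $x\in P$ to $y\in P$ where $y-x$ is a positive multiple of a circuit and $x+\alpha(y-x)\notin P$ for all real $\alpha>1$. A \emph{circuit walk} is a sequence of points of $P$ ending at an optimal point, in which each point is obtained from its predecessor by a circuit step that strictly increases $wx$. A vector $c$ is \emph{conformal} to $h$ if $c_ih_i\ge 0$ and $|c_i|\le|h_i|$ for all $i$. Let $\Delta(A)$ be the maximum absolute value of a subdeterminant of $A$ (of order at least one), and $\Delta:=\max\{1,\Delta(A)\}$. \textbf{Theorem.} There is an algorithm that, given $A,b,w,l,u$ and any rational point $x^0\in P$, computes a sequence $x^0,x^1,\dots,x^s$ of points of $P$ as described below. On rational numbers the algorithm uses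 only the operations of linear algebra (addition, subtraction, multiplication, division and comparison), and in addition it calls a linear programming solver at most once, to obtain an optimal solution $\hat x\in\mathbb Q^n$ of the given linear program itself. Whatever optimal solution $\hat x$ the solver returns, the running time, apart from the time spent inside the solver and with each operation charged the bit sizes of its operands and its result, is bounded by a fixed polynomial in the bit size of $A,b,w,l,u,x^0,\hat x$. (In particular it is polynomial in the bit size of $A,b,w,l,u,x^0$ if the solver runs in polynomial time.) The number $s$ of steps is bounded by a fixed polynomial in the bit size of $A,b,w,l,u$. There are indices $0\le r\le q\le s$ such that: 1. $x^0,\dots,x^q$ is a circuit walk (so $wx^0<\dots<wx^q$ and $x^q$ is optimal); 2. for $q\le k<s$, the point $x^{k+1}$ is optimal and is obtained from $x^k$ by a circuit step, and $x^s$ is an optimal vertex of $P$; 3. for $0\le k<r$, there are a positive multiple $c$ of a circuit, conformal to $\hat x-x^k$, and a real $\beta\ge1$ with $x^{k+1}-x^k=\beta c$, and $wx^{k+1}-wx^k\ \ge\ \frac1n\,(w\hat x-wx^k)$; 4. $w\hat x-wx^r<1/\Delta^2$, and for $r\le k<s$ the smallest face of $P$ containing $x^{k+1}$ is a proper subset of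 the smallest face of $P$ containing $x^k$. -/

import Mathlib

namespace CircuitWalk

/-! ### Linear programs, circuits and walks -/

/-- The data of the linear program `max {w x : A x = b, l ≤ x ≤ u}`, all of it integer. -/
structure LP (m n : ℕ) where
  A : Matrix (Fin m) (Fin n) ℤ
  b : Fin m → ℤ
  w : Fin n → ℤ
  l : Fin n → ℤ
  u : Fin n → ℤ

/-- A rational vector read as a real vector. -/
def toReal {n : ℕ} (x : Fin n → ℚ) : Fin n → ℝ := fun j => (x j : ℝ)

/-- `A x` for an integer matrix `A` and a real vector `x`. -/
def mulR {m n : ℕ} (A : Matrix (Fin m) (Fin n) ℤ) (x : Fin n → ℝ) : Fin m → ℝ :=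
  fun i => ∑ j, (A i j : ℝ) * x j

/-- The polytope `P = {x ∈ ℝⁿ : A x = b, l ≤ x ≤ u}`. -/
def LP.feasible {m n : ℕ} (I : LP m n) : Set (Fin n → ℝ) :=
  {x | (∀ i, mulR I.A x i = (I.b i : ℝ)) ∧ ∀ j, (I.l j : ℝ) ≤ x j ∧ x j ≤ (I.u j : ℝ)}

/-- The objective value `w x`. -/
def LP.obj {m n : ℕ} (I : LP m n) (x : Fin n → ℝ) : ℝ := ∑ j, (I.w j : ℝ) * x j

def LP.IsOptimal {m n : ℕ} (I : LP m n) (x : Fin n → ℝ) : Prop :=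
  x ∈ I.feasible ∧ ∀ y ∈ I.feasible, I.obj y ≤ I.obj x

/-- A vertex of `P` is an extreme point of `P`. -/
def LP.IsVertex {m n : ℕ} (I : LP m n) (x : Fin n → ℝ) : Prop :=
  x ∈ Set.extremePoints ℝ I.feasible

/-- A circuit of `A`: a nonzero integer kernel element whose support is minimal among the
supports of the nonzero real kernel elements. -/
def IsCircuit {m n : ℕ} (A : Matrix (Fin m) (Fin n) ℤ) (c : Fin n → ℤ) : Prop :=
  c ≠ 0 ∧ A.mulVec c = 0 ∧
    ∀ d : Fin n → ℝ, d ≠ 0 → mulR A d = 0 → ¬ Function.support d ⊂ Function.support c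

/-- A positive multiple of a circuit. -/
def IsCircuitMultiple {m n : ℕ} (A : Matrix (Fin m) (Fin n) ℤ) (d : Fin n → ℝ) : Prop :=
  ∃ c : Fin n → ℤ, IsCircuit A c ∧ ∃ α : ℝ, 0 < α ∧ ∀ j, d j = α * (c j : ℝ)

/-- `c` is conformal to `h`. -/
def Conformal {n : ℕ} (c h : Fin n → ℝ) : Prop :=
  ∀ j, 0 ≤ c j * h j ∧ |c j| ≤ |h j|

/-- `y` is obtained from `x` by a maximal step inside `P` along a circuit of `A`. -/
def LP.IsCircuitStep {m n : ℕ} (I : LP m n) (x y : Fin n → ℝ) : Prop :=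
  x ∈ I.feasible ∧ y ∈ I.feasible ∧ IsCircuitMultiple I.A (y - x) ∧
    ∀ α : ℝ, 1 < α → x + α • (y - x) ∉ I.feasible

/-- `x 0, …, x s` is a (strictly monotone) circuit walk that ends at an optimal point. -/
def LP.IsCircuitWalk {m n : ℕ} (I : LP m n) (x : ℕ → Fin n → ℝ) (s : ℕ) : Prop :=
  (∀ k ≤ s, x k ∈ I.feasible) ∧ I.IsOptimal (x s) ∧
    ∀ k < s, I.obj (x k) < I.obj (x (k + 1)) ∧ I.IsCircuitStep (x k) (x (k + 1))

/-- The smallest face of `P` that contains the feasible point `x`. -/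
def LP.minFace {m n : ℕ} (I : LP m n) (x : Fin n → ℝ) : Set (Fin n → ℝ) :=
  {y ∈ I.feasible | ∀ j, (x j = (I.l j : ℝ) → y j = (I.l j : ℝ)) ∧
    (x j = (I.u j : ℝ) → y j = (I.u j : ℝ))}

/-- `Δ(A)`: the maximum absolute value of the determinant of a square submatrix of `A` of
order at least one (a repeated row or column gives determinant zero). -/
def maxSubdet {m n : ℕ} (A : Matrix (Fin m) (Fin n) ℤ) : ℕ :=
  (Finset.range m).sup fun k =>
    (Finset.univ : Finset ((Fin (k + 1) → Fin m) × (Fin (k + 1) → Fin n))).sup fun fg =>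
      (A.submatrix fg.1 fg.2).det.natAbs

/-! ### Bit sizes -/

/-- The bit size of a rational number: binary lengths of numerator and denominator. -/
def ratSize (q : ℚ) : ℕ := Nat.size q.num.natAbs + Nat.size q.den + 1

def vecSize {n : ℕ} (x : Fin n → ℚ) : ℕ := ∑ j, ratSize (x j)

/-- The bit size of the data of a linear program. -/
def LP.size {m n : ℕ} (I : LP m n) : ℕ :=
  m + n + (∑ i, ∑ j, ratSize (I.A i j)) + (∑ i, ratSize (I.b i)) + (∑ j, ratSize (I.w j))
    + (∑ j, ratSize (I.l j)) + (∑ j, ratSize (I.u j))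

/-! ### The machine model

A program is a finite text, the same for all inputs, in a small imperative language.  The memory
consists of natural number counters, used as addresses, and of two-dimensional arrays of rational
numbers.  On rational numbers only the operations of linear algebra are available: the four field
operations and comparison.  Every operation is charged the bit size of its operands and of its
result (logarithmic cost).  In addition there is an instruction that delivers an optimal solution
of the linear program that the machine was given as input; its executions are counted. -/

/-- The memory: counters, and rational cells addressed by an array name and two indices. -/
structure Store where
  ctr : ℕ → ℕ
  cell : ℕ → ℕ → ℕ → ℚ

def Store.setCtr (σ : Store) (v a : ℕ) : Store :=
  { σ with ctr := Function.update σ.ctr v a }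

def Store.setCell (σ : Store) (v i j : ℕ) (q : ℚ) : Store :=
  { σ with cell := fun v' i' j' => if v' = v ∧ i' = i ∧ j' = j then q else σ.cell v' i' j' }

/-- Writing a vector into the first column of the array `v`. -/
def Store.setVec (σ : Store) (v : ℕ) {n : ℕ} (x : Fin n → ℚ) : Store :=
  { σ with cell := fun v' i' j' =>
      if h : i' < n then (if v' = v ∧ j' = 0 then x ⟨i', h⟩ else σ.cell v' i' j')
      else σ.cell v' i' j' }

/-- Address expressions. -/
inductive IExpr where
  | const (a : ℕ)
  | ctr (v : ℕ)
  | add (e f : IExpr)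
  | sub (e f : IExpr)

/-- Rational expressions; `cell v i j` reads the entry `(i, j)` of the array `v`. -/
inductive QExpr where
  | const (q : ℚ)
  | cell (v : ℕ) (i j : IExpr)
  | add (e f : QExpr)
  | sub (e f : QExpr)
  | mul (e f : QExpr)
  | div (e f : QExpr)

/-- Tests. -/
inductive BExpr where
  | ltI (e f : IExpr)
  | ltQ (e f : QExpr)
  | not (p : BExpr)
  | and (p q : BExpr)

/-- Programs. -/
inductive Prog where
  | skip
  | setCtr (v : ℕ) (e : IExpr)
  | setCell (v : ℕ) (i j : IExpr) (e : QExpr)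
  | seq (c d : Prog)
  | ite (p : BExpr) (c d : Prog)
  | while (p : BExpr) (c : Prog)
  | solveLP (v : ℕ)

/-- The value; subtraction of addresses is truncated at zero. -/
def IExpr.eval (σ : Store) : IExpr → ℕ
  | const a => a
  | ctr v => σ.ctr v
  | add e f => e.eval σ + f.eval σ
  | sub e f => e.eval σ - f.eval σ

/-- The bit sizes of the values of all subexpressions, plus one for each of them. -/
def IExpr.cost (σ : Store) : IExpr → ℕ
  | const a => Nat.size a + 1
  | ctr v => Nat.size (σ.ctr v) + 1
  | add e f => e.cost σ + f.cost σ + Nat.size (e.eval σ + f.eval σ) + 1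
  | sub e f => e.cost σ + f.cost σ + Nat.size (e.eval σ - f.eval σ) + 1

/-- The value; division by zero returns zero. -/
def QExpr.eval (σ : Store) : QExpr → ℚ
  | const q => q
  | cell v i j => σ.cell v (i.eval σ) (j.eval σ)
  | add e f => e.eval σ + f.eval σ
  | sub e f => e.eval σ - f.eval σ
  | mul e f => e.eval σ * f.eval σ
  | div e f => e.eval σ / f.eval σ

def QExpr.cost (σ : Store) : QExpr → ℕ
  | const q => ratSize q
  | cell v i j => i.cost σ + j.cost σ + ratSize (σ.cell v (i.eval σ) (j.eval σ))
  | add e f => e.cost σ + f.cost σ + ratSize (e.eval σ + f.eval σ)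
  | sub e f => e.cost σ + f.cost σ + ratSize (e.eval σ - f.eval σ)
  | mul e f => e.cost σ + f.cost σ + ratSize (e.eval σ * f.eval σ)
  | div e f => e.cost σ + f.cost σ + ratSize (e.eval σ / f.eval σ)

def BExpr.eval (σ : Store) : BExpr → Bool
  | ltI e f => decide (e.eval σ < f.eval σ)
  | ltQ e f => decide (e.eval σ < f.eval σ)
  | not p => !(p.eval σ)
  | and p q => p.eval σ && q.eval σ

def BExpr.cost (σ : Store) : BExpr → ℕ
  | ltI e f => e.cost σ + f.cost σ + 1
  | ltQ e f => e.cost σ + f.cost σ + 1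
  | not p => p.cost σ + 1
  | and p q => p.cost σ + q.cost σ + 1

/-- `Exec ans c σ τ t k`: the program `c`, started in memory `σ`, halts in memory `τ` after time
`t`, having executed the instruction `solveLP` exactly `k` times.  The vector `ans` is the
solution that this instruction delivers; the time includes the bit size of the delivered vector,
but not the internal work of the solver. -/
inductive Exec {n : ℕ} (ans : Fin n → ℚ) : Prog → Store → Store → ℕ → ℕ → Prop where
  | skip (σ : Store) : Exec ans .skip σ σ 1 0
  | setCtr (v : ℕ) (e : IExpr) (σ : Store) :
      Exec ans (.setCtr v e) σ (σ.setCtr v (e.eval σ)) (e.cost σ + 1) 0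
  | setCell (v : ℕ) (i j : IExpr) (e : QExpr) (σ : Store) :
      Exec ans (.setCell v i j e) σ (σ.setCell v (i.eval σ) (j.eval σ) (e.eval σ))
        (i.cost σ + j.cost σ + e.cost σ + 1) 0
  | seq {c d : Prog} {σ τ υ : Store} {t t' k k' : ℕ} :
      Exec ans c σ τ t k → Exec ans d τ υ t' k' → Exec ans (.seq c d) σ υ (t + t') (k + k')
  | iteTrue {p : BExpr} {c : Prog} (d : Prog) {σ τ : Store} {t k : ℕ} :
      p.eval σ = true → Exec ans c σ τ t k → Exec ans (.ite p c d) σ τ (p.cost σ + t) k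
  | iteFalse {p : BExpr} (c : Prog) {d : Prog} {σ τ : Store} {t k : ℕ} :
      p.eval σ = false → Exec ans d σ τ t k → Exec ans (.ite p c d) σ τ (p.cost σ + t) k
  | whileTrue {p : BExpr} {c : Prog} {σ τ υ : Store} {t t' k k' : ℕ} :
      p.eval σ = true → Exec ans c σ τ t k → Exec ans (.while p c) τ υ t' k' →
      Exec ans (.while p c) σ υ (p.cost σ + t + t') (k + k')
  | whileFalse {p : BExpr} (c : Prog) {σ : Store} :
      p.eval σ = false → Exec ans (.while p c) σ σ (p.cost σ) 0
  | solveLP (v : ℕ) (σ : Store) :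
      Exec ans (.solveLP v) σ (σ.setVec v ans) (n + vecSize ans + 1) 1

/-- The initial memory: counters `0` and `1` hold `m` and `n`; array `0` holds `A`, and the first
columns of the arrays `1, 2, 3, 4, 5` hold `b, w, l, u` and the starting point.  All the rest is
zero. -/
def initStore {m n : ℕ} (I : LP m n) (x₀ : Fin n → ℚ) : Store where
  ctr := fun v => if v = 0 then m else if v = 1 then n else 0
  cell := fun v i j =>
    if v = 0 then (if h : i < m ∧ j < n then (I.A ⟨i, h.1⟩ ⟨j, h.2⟩ : ℚ) else 0)
    else if j = 0 then
      if v = 1 then (if h : i < m then (I.b ⟨i, h⟩ : ℚ) else 0)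
      else if v = 2 then (if h : i < n then (I.w ⟨i, h⟩ : ℚ) else 0)
      else if v = 3 then (if h : i < n then (I.l ⟨i, h⟩ : ℚ) else 0)
      else if v = 4 then (if h : i < n then (I.u ⟨i, h⟩ : ℚ) else 0)
      else if v = 5 then (if h : i < n then x₀ ⟨i, h⟩ else 0)
      else 0
    else 0

/-- The output: counter `2` holds the number of steps of the walk … -/
def Store.outLength (σ : Store) : ℕ := σ.ctr 2

/-- … and row `k` of array `6` holds the point `x k` of the walk. -/
def Store.outPoint (σ : Store) (n k : ℕ) : Fin n → ℚ := fun j => σ.cell 6 k j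

/-! ### The walk that is computed -/

/-- `x 0, …, x s` is a sequence of maximal circuit steps from `x₀` to an optimal vertex, built
from the optimal solution `xhat`:
* its part `x 0, …, x q` is a strictly monotone circuit walk to an optimal point, and the
  remaining steps, if any, lead through optimal points to an optimal vertex;
* each of the first `r` steps goes along a circuit conformal to `xhat - x k` and closes at least
  a `1 / n` fraction of the optimality gap;
* `x r` has gap less than `1 / Δ(A) ^ 2` (less than `1` if `A = 0`), and every later step leads to
  a proper face of the smallest face containing the current point. -/
def LP.IsTwoPhaseWalk {m n : ℕ} (I : LP m n) (x₀ xhat : Fin n → ℝ) (x : ℕ → Fin n → ℝ)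
    (r q s : ℕ) : Prop :=
  r ≤ q ∧ q ≤ s ∧ x 0 = x₀ ∧
  I.IsCircuitWalk x q ∧
  (∀ k, q ≤ k → k < s → I.IsCircuitStep (x k) (x (k + 1)) ∧ I.IsOptimal (x (k + 1))) ∧
  I.IsOptimal (x s) ∧ I.IsVertex (x s) ∧
  (∀ k < r,
    (∃ c : Fin n → ℝ, IsCircuitMultiple I.A c ∧ Conformal c (xhat - x k) ∧
      ∃ β : ℝ, 1 ≤ β ∧ x (k + 1) - x k = β • c) ∧
    (1 / (n : ℝ)) * (I.obj xhat - I.obj (x k)) ≤ I.obj (x (k + 1)) - I.obj (x k)) ∧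
  I.obj xhat - I.obj (x r) < 1 / (max 1 (maxSubdet I.A : ℝ)) ^ 2 ∧
  (∀ k, r ≤ k → k < s → I.minFace (x (k + 1)) ⊂ I.minFace (x k))

end CircuitWalk

namespace CircuitWalk

/-! ### Bit sizes of rational numbers -/

/-! Write x̂ for the solver's solution, B for `detBound A` = ∏ (1 + |Aᵢⱼ|), and size for `I.size`.

Both phases rest on one elimination. For a set S of coordinates it produces the fundamental kernel
vectors of A supported in S. Each nonzero one is a multiple of a circuit (`IsTableau.eq_mul_col`),
together they span all kernel vectors supported in S (`IsTableau.proj_eq_self`), and by Cramer's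
rule their entries are quotients of determinants bounded by B, at every stage of the elimination
(`IsTableau.mul_det_eq`).

Phase one. At the point x put h = x̂ - x and g(v) = ∑ vⱼ / hⱼ, a linear functional with g(h) = |supp
h| ≤ n. Start with y = h. Take a circuit direction d supported in supp y, signed so that wy / g(y)
does not decrease along y + a d, and move y until a coordinate becomes zero. Then y stays nonzero
and in the orthant of h, and its support shrinks (`LP.IsConformalPart.advance`). So within n rounds
some d opposes no coordinate of y. This d satisfies dⱼ / hⱼ ≤ g(d) for all j, hence d / g(d) is
conformal to h, and its objective value is at least wh / g(h) ≥ wh / n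
(`LP.IsConformalPart.isGoodDirection`). A maximal step from x along d is at least as long as d /
g(d), so the optimality gap shrinks by the factor 1 - 1/n. The gap is at most 2^size at the start
and B ≤ 2^size, so n (3 size + 1) steps bring it below 1 / B² (`LP.step_lt_of_gap`). B takes the
place of Δ because it is easy to compute, and B ≥ Δ.

Phase two. Move along circuits supported in the coordinates strictly between their bounds, with
nonzero objective value if there are such circuits. Every step takes a further coordinate to a
bound, so a vertex is reached within n steps. If the objective vanishes on all these kernel vectors
at x, then wx is a fraction with denominator at most B (`LP.exists_denominator_obj`). The same is
true of wx̂, so a gap below 1 / B² must be zero. Therefore all steps before the first optimal point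
improve the objective strictly.

Running time. A move to the first bound adds only 2 size + 2 bits to a common denominator of the
point (`HasDenominator.move`), so all numbers keep polynomially many bits. `Runs` then turns a bound
`K` on the memory contents and a bound `M` on the iterations of each loop into a time bound.

Memory beyond the input and output. Array 7 is x̂, 8 is B, 9 the gap, 10 the moving vector, 11 its
targets, 12 a vector whose support is S, 13 the tableau, 14 a row times the tableau, 15 the pivot
column and finally the direction, 16 the step length, 17 scratch, 18 to 21 hold g(y), wy, g(d), wd.
Counter 3 is a loop flag, 4 to 6 are loop counters, 7 is a column index, 8 and 9 tell whether a
direction or a limiting coordinate was found. -/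

/-- Numerator and denominator of `q` are at most `2 ^ k` in absolute value. -/
def FitsBits (k : ℕ) (q : ℚ) : Prop := q.num.natAbs ≤ 2 ^ k ∧ q.den ≤ 2 ^ k

theorem ratSize_pos (q : ℚ) : 1 ≤ ratSize q := by unfold ratSize; omega

theorem FitsBits.mono {k l : ℕ} {q : ℚ} (h : FitsBits k q) (hkl : k ≤ l) : FitsBits l q :=
  ⟨h.1.trans (Nat.pow_le_pow_right (by norm_num) hkl),
    h.2.trans (Nat.pow_le_pow_right (by norm_num) hkl)⟩

theorem FitsBits.ratSize_le {k : ℕ} {q : ℚ} (h : FitsBits k q) : ratSize q ≤ 2 * k + 3 := by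
  have key : ∀ x : ℕ, x ≤ 2 ^ k → Nat.size x ≤ k + 1 := fun x hx => Nat.size_le.2
    (hx.trans_lt (Nat.pow_lt_pow_right (by norm_num) (Nat.lt_succ_self k)))
  have h1 := key _ h.1
  have h2 := key _ h.2
  unfold ratSize; omega

theorem fitsBits_of_ratSize_le {k : ℕ} {q : ℚ} (h : ratSize q ≤ k) : FitsBits k q := by
  unfold ratSize at h
  constructor
  · exact (Nat.size_le.1 (show Nat.size q.num.natAbs ≤ k by omega)).le
  · exact (Nat.size_le.1 (show Nat.size q.den ≤ k by omega)).le

/-- The reduced numerator and denominator of `q` divide those of any fraction z / D that represents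
it, so any representation yields a bound. -/
theorem fitsBits_of_mul_eq {k : ℕ} {q : ℚ} {z D : ℤ} (hD : D ≠ 0) (h : q * D = z)
    (hz : z.natAbs ≤ 2 ^ k) (hDk : D.natAbs ≤ 2 ^ k) : FitsBits k q := by
  have hD' : (D : ℚ) ≠ 0 := by exact_mod_cast hD
  have hq : q = Rat.divInt z D := by
    rw [Rat.divInt_eq_div, eq_div_iff hD', h]
  constructor
  · rcases eq_or_ne z 0 with rfl | hz0
    · rw [hq]; simp
    · have := Rat.num_dvd z hD
      rw [← hq] at this
      exact (Nat.le_of_dvd (Int.natAbs_pos.2 hz0) (Int.natAbs_dvd_natAbs.2 this)).trans hz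
  · have := Rat.den_dvd z D
    rw [← hq] at this
    have h2 := Int.natAbs_dvd_natAbs.2 this
    rw [Int.natAbs_natCast] at h2
    exact (Nat.le_of_dvd (Int.natAbs_pos.2 hD) h2).trans hDk

theorem fitsBits_int {k : ℕ} {z : ℤ} (hz : z.natAbs ≤ 2 ^ k) : FitsBits k (z : ℚ) :=
  ⟨by simpa using hz, by simpa using Nat.one_le_two_pow⟩

theorem fitsBits_zero (k : ℕ) : FitsBits k 0 := ⟨by simp, by simpa using Nat.one_le_two_pow⟩

theorem fitsBits_one (k : ℕ) : FitsBits k 1 :=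
  ⟨by simpa using Nat.one_le_two_pow, by simpa using Nat.one_le_two_pow⟩

theorem FitsBits.add {k l : ℕ} {a b : ℚ} (ha : FitsBits k a) (hb : FitsBits l b) :
    FitsBits (k + l + 1) (a + b) := by
  refine fitsBits_of_mul_eq (z := a.num * b.den + b.num * a.den) (D := a.den * b.den) ?_ ?_ ?_ ?_
  · exact mul_ne_zero (by exact_mod_cast a.den_nz) (by exact_mod_cast b.den_nz)
  · push_cast
    rw [← Rat.mul_den_eq_num a, ← Rat.mul_den_eq_num b]; ring
  · refine (Int.natAbs_add_le _ _).trans ?_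
    rw [Int.natAbs_mul, Int.natAbs_mul, Int.natAbs_natCast, Int.natAbs_natCast]
    have h1 := Nat.mul_le_mul ha.1 hb.2
    have h2 := Nat.mul_le_mul hb.1 ha.2
    have h3 : 2 ^ (k + l + 1) = 2 ^ k * 2 ^ l + 2 ^ l * 2 ^ k := by ring
    omega
  · rw [Int.natAbs_mul, Int.natAbs_natCast, Int.natAbs_natCast]
    have h1 := Nat.mul_le_mul ha.2 hb.2
    have h3 : 2 ^ (k + l + 1) = 2 ^ k * 2 ^ l + 2 ^ l * 2 ^ k := by ring
    omega

theorem FitsBits.neg {k : ℕ} {a : ℚ} (ha : FitsBits k a) : FitsBits k (-a) := by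
  simpa [FitsBits] using ha

theorem FitsBits.sub {k l : ℕ} {a b : ℚ} (ha : FitsBits k a) (hb : FitsBits l b) :
    FitsBits (k + l + 1) (a - b) := by
  rw [sub_eq_add_neg]; exact ha.add hb.neg

theorem FitsBits.mul {k l : ℕ} {a b : ℚ} (ha : FitsBits k a) (hb : FitsBits l b) :
    FitsBits (k + l) (a * b) := by
  refine fitsBits_of_mul_eq (z := a.num * b.num) (D := a.den * b.den) ?_ ?_ ?_ ?_
  · exact mul_ne_zero (by exact_mod_cast a.den_nz) (by exact_mod_cast b.den_nz)
  · push_cast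
    rw [← Rat.mul_den_eq_num a, ← Rat.mul_den_eq_num b]; ring
  · rw [Int.natAbs_mul, pow_add]; exact Nat.mul_le_mul ha.1 hb.1
  · rw [Int.natAbs_mul, pow_add]; exact Nat.mul_le_mul ha.2 hb.2

theorem FitsBits.inv {k : ℕ} {a : ℚ} (ha : FitsBits k a) : FitsBits k a⁻¹ := by
  rcases eq_or_ne a 0 with rfl | h0
  · simpa using fitsBits_zero k
  refine fitsBits_of_mul_eq (z := a.den) (D := a.num) (Rat.num_ne_zero.2 h0) ?_
    (by simpa using ha.2) ha.1
  rw [← Rat.mul_den_eq_num a]; push_cast; field_simp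

theorem FitsBits.div {k l : ℕ} {a b : ℚ} (ha : FitsBits k a) (hb : FitsBits l b) :
    FitsBits (k + l) (a / b) := by
  rw [div_eq_mul_inv]; exact ha.mul hb.inv

theorem FitsBits.sum_range {k : ℕ} {f : ℕ → ℚ} {N : ℕ} (h : ∀ j < N, FitsBits k (f j)) :
    FitsBits (N * (k + 1)) (∑ j ∈ Finset.range N, f j) := by
  induction N with
  | zero => simpa using fitsBits_zero _
  | succ N ih =>
    rw [Finset.sum_range_succ]
    refine ((ih fun j hj => h j (by omega)).add (h N (by omega))).mono (le_of_eq (by ring))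

/-! ### Bit sizes of the results of single operations -/

theorem size_mul_le (a b : ℕ) : Nat.size (a * b) ≤ Nat.size a + Nat.size b := by
  rw [Nat.size_le, pow_add]
  exact Nat.mul_lt_mul'' (Nat.lt_size_self a) (Nat.lt_size_self b)

theorem size_add_le (a b : ℕ) : Nat.size (a + b) ≤ max (Nat.size a) (Nat.size b) + 1 := by
  rw [Nat.size_le, pow_succ]
  have h1 := (Nat.lt_size_self a).trans_le
    (Nat.pow_le_pow_right (by norm_num : 0 < 2) (le_max_left (Nat.size a) (Nat.size b)))
  have h2 := (Nat.lt_size_self b).trans_le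
    (Nat.pow_le_pow_right (by norm_num : 0 < 2) (le_max_right (Nat.size a) (Nat.size b)))
  omega

theorem size_le_self (a : ℕ) : Nat.size a ≤ a := Nat.size_le.2 Nat.lt_two_pow_self

theorem ratSize_le_of_mul_eq {q : ℚ} {z D : ℤ} (hD : D ≠ 0) (h : q * D = z) :
    ratSize q ≤ Nat.size z.natAbs + Nat.size D.natAbs + 1 := by
  have hD' : (D : ℚ) ≠ 0 := by exact_mod_cast hD
  have hq : q = Rat.divInt z D := by
    rw [Rat.divInt_eq_div, eq_div_iff hD', h]
  have h1 : q.num.natAbs ≤ z.natAbs := by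
    rcases eq_or_ne z 0 with rfl | hz0
    · rw [hq]; simp
    · have := Rat.num_dvd z hD
      rw [← hq] at this
      exact Nat.le_of_dvd (Int.natAbs_pos.2 hz0) (Int.natAbs_dvd_natAbs.2 this)
  have h2 : q.den ≤ D.natAbs := by
    have := Rat.den_dvd z D
    rw [← hq] at this
    have h2 := Int.natAbs_dvd_natAbs.2 this
    rw [Int.natAbs_natCast] at h2
    exact Nat.le_of_dvd (Int.natAbs_pos.2 hD) h2
  have := Nat.size_le_size h1
  have := Nat.size_le_size h2
  unfold ratSize; omega

/-- This and the following estimates serve the cost of expressions, where intermediate sizes matter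
only up to a constant factor. The factor 8 in `QExpr.weight` is twice the 4 lost in a division,
since size and cost are bounded together. -/
theorem ratSize_add_le (a b : ℚ) : ratSize (a + b) ≤ 2 * (ratSize a + ratSize b) := by
  have h := ratSize_le_of_mul_eq (q := a + b) (z := a.num * b.den + b.num * a.den)
    (D := a.den * b.den) (mul_ne_zero (by exact_mod_cast a.den_nz) (by exact_mod_cast b.den_nz))
    (by push_cast
        rw [← Rat.mul_den_eq_num a, ← Rat.mul_den_eq_num b]; ring)
  have h1 := Nat.size_le_size (Int.natAbs_add_le (a.num * b.den) (b.num * a.den))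
  have h2 := size_add_le (a.num * b.den).natAbs (b.num * a.den).natAbs
  rw [Int.natAbs_mul, Int.natAbs_mul, Int.natAbs_natCast, Int.natAbs_natCast] at h1 h2
  rw [Int.natAbs_mul, Int.natAbs_natCast, Int.natAbs_natCast] at h
  have h3 := size_mul_le a.num.natAbs b.den
  have h4 := size_mul_le b.num.natAbs a.den
  have h5 := size_mul_le a.den b.den
  have h6 : max (Nat.size (a.num.natAbs * b.den)) (Nat.size (b.num.natAbs * a.den)) ≤
    a.num.natAbs.size + b.den.size + b.num.natAbs.size + a.den.size := by
    apply max_le <;> omega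
  simp only [ratSize] at h ⊢
  omega

theorem ratSize_neg (a : ℚ) : ratSize (-a) = ratSize a := by simp [ratSize]

theorem ratSize_sub_le (a b : ℚ) : ratSize (a - b) ≤ 2 * (ratSize a + ratSize b) := by
  rw [sub_eq_add_neg]; simpa [ratSize_neg] using ratSize_add_le a (-b)

theorem ratSize_mul_le (a b : ℚ) : ratSize (a * b) ≤ 2 * (ratSize a + ratSize b) := by
  have h := ratSize_le_of_mul_eq (q := a * b) (z := a.num * b.num)
    (D := a.den * b.den) (mul_ne_zero (by exact_mod_cast a.den_nz) (by exact_mod_cast b.den_nz))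
    (by push_cast
        rw [← Rat.mul_den_eq_num a, ← Rat.mul_den_eq_num b]; ring)
  rw [Int.natAbs_mul, Int.natAbs_mul, Int.natAbs_natCast, Int.natAbs_natCast] at h
  have h4 := size_mul_le a.num.natAbs b.num.natAbs
  have h5 := size_mul_le a.den b.den
  simp only [ratSize] at h ⊢
  omega

theorem ratSize_inv_le (a : ℚ) : ratSize a⁻¹ ≤ ratSize a + 1 := by
  rcases eq_or_ne a 0 with rfl | h0
  · simp
  have h := ratSize_le_of_mul_eq (q := a⁻¹) (z := a.den) (D := a.num) (Rat.num_ne_zero.2 h0)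
    (by rw [← Rat.mul_den_eq_num a]; push_cast; field_simp)
  rw [Int.natAbs_natCast] at h
  simp only [ratSize] at h ⊢
  omega

theorem ratSize_div_le (a b : ℚ) : ratSize (a / b) ≤ 4 * (ratSize a + ratSize b) := by
  rw [div_eq_mul_inv]
  have h := ratSize_mul_le a b⁻¹
  have h2 := ratSize_inv_le b
  have := ratSize_pos a
  omega

/-! ### A calculus of total correctness with time bounds -/

@[simp] theorem Store.setCtr_ctr (σ : Store) (v a w : ℕ) :
    (σ.setCtr v a).ctr w = if w = v then a else σ.ctr w := by
  simp [Store.setCtr, Function.update_apply]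

@[simp] theorem Store.setCtr_cell (σ : Store) (v a : ℕ) : (σ.setCtr v a).cell = σ.cell := rfl

@[simp] theorem Store.setCell_ctr (σ : Store) (v i j : ℕ) (q : ℚ) :
    (σ.setCell v i j q).ctr = σ.ctr := rfl

@[simp] theorem Store.setCell_cell (σ : Store) (v i j : ℕ) (q : ℚ) (v' i' j' : ℕ) :
    (σ.setCell v i j q).cell v' i' j' =
      if v' = v ∧ i' = i ∧ j' = j then q else σ.cell v' i' j' := rfl

attribute [simp] IExpr.eval QExpr.eval BExpr.eval

/-- All counters, and the bit sizes of all cells, are at most `K`. -/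
def Store.Bounded (K : ℕ) (σ : Store) : Prop :=
  (∀ v, σ.ctr v ≤ K) ∧ ∀ v i j, ratSize (σ.cell v i j) ≤ K

/-- Every size is positive; this lets additive constants be absorbed into multiples of `K`. -/
theorem Store.Bounded.one_le {K : ℕ} {σ : Store} (h : σ.Bounded K) : 1 ≤ K :=
  (ratSize_pos _).trans (h.2 0 0 0)

theorem Store.Bounded.setCtr {K : ℕ} {σ : Store} (h : σ.Bounded K) {v a : ℕ} (ha : a ≤ K) :
    (σ.setCtr v a).Bounded K := by
  refine ⟨fun w => ?_, h.2⟩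
  rw [Store.setCtr_ctr]
  split_ifs
  exacts [ha, h.1 w]

theorem Store.Bounded.setCell {K : ℕ} {σ : Store} (h : σ.Bounded K) {v i j : ℕ} {q : ℚ}
    (hq : ratSize q ≤ K) : (σ.setCell v i j q).Bounded K := by
  refine ⟨h.1, fun v' i' j' => ?_⟩
  rw [Store.setCell_cell]
  split_ifs
  exacts [hq, h.2 _ _ _]

/-- A factor by which value and cost of an address expression exceed the bound on the memory. -/
def IExpr.weight : IExpr → ℕ
  | const a => 2 * a + 1
  | ctr _ => 3
  | add e f => 2 * e.weight + 2 * f.weight + 1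
  | sub e f => 2 * e.weight + 2 * f.weight + 1

/-- A factor by which size and cost of a rational expression exceed the bound on the memory. -/
def QExpr.weight : QExpr → ℕ
  | const q => 2 * ratSize q
  | cell _ i j => i.weight + j.weight + 2
  | add e f => 8 * (e.weight + f.weight)
  | sub e f => 8 * (e.weight + f.weight)
  | mul e f => 8 * (e.weight + f.weight)
  | div e f => 8 * (e.weight + f.weight)

/-- A factor by which the cost of a test exceeds the bound on the memory. -/
def BExpr.weight : BExpr → ℕ
  | ltI e f => e.weight + f.weight + 1
  | ltQ e f => e.weight + f.weight + 1
  | not p => p.weight + 1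
  | and p q => p.weight + q.weight + 1

/-- Value and cost are treated together because the cost of a sum involves its value. Counters are
bounded by value and not by bit length, which is affordable as they stay polynomially small. -/
theorem IExpr.eval_add_cost_le {K : ℕ} {σ : Store} (h : σ.Bounded K) (e : IExpr) :
    e.eval σ + e.cost σ ≤ e.weight * K := by
  have h1 := h.one_le
  induction e with
  | const a =>
    have := size_le_self a
    simp only [IExpr.eval, IExpr.cost, IExpr.weight]; nlinarith
  | ctr v =>
    have := size_le_self (σ.ctr v)
    have := h.1 v
    simp only [IExpr.eval, IExpr.cost, IExpr.weight]; omega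
  | add e f he hf =>
    have := size_le_self (e.eval σ + f.eval σ)
    simp only [IExpr.eval, IExpr.cost, IExpr.weight]; nlinarith
  | sub e f he hf =>
    have := size_le_self (e.eval σ - f.eval σ)
    have := Nat.sub_le (e.eval σ) (f.eval σ)
    simp only [IExpr.eval, IExpr.cost, IExpr.weight]; nlinarith

theorem QExpr.eval_add_cost_le {K : ℕ} {σ : Store} (h : σ.Bounded K) (e : QExpr) :
    ratSize (e.eval σ) + e.cost σ ≤ e.weight * K := by
  have h1 := h.one_le
  induction e with
  | const q => simp only [QExpr.eval, QExpr.cost, QExpr.weight]; nlinarith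
  | cell v i j =>
    have := i.eval_add_cost_le h
    have := j.eval_add_cost_le h
    have := h.2 v (i.eval σ) (j.eval σ)
    simp only [QExpr.eval, QExpr.cost, QExpr.weight]; nlinarith
  | add e f he hf =>
    have := ratSize_add_le (e.eval σ) (f.eval σ)
    simp only [QExpr.eval, QExpr.cost, QExpr.weight]; nlinarith
  | sub e f he hf =>
    have := ratSize_sub_le (e.eval σ) (f.eval σ)
    simp only [QExpr.eval, QExpr.cost, QExpr.weight]; nlinarith
  | mul e f he hf =>
    have := ratSize_mul_le (e.eval σ) (f.eval σ)
    simp only [QExpr.eval, QExpr.cost, QExpr.weight]; nlinarith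
  | div e f he hf =>
    have := ratSize_div_le (e.eval σ) (f.eval σ)
    simp only [QExpr.eval, QExpr.cost, QExpr.weight]; nlinarith

theorem BExpr.cost_le {K : ℕ} {σ : Store} (h : σ.Bounded K) (p : BExpr) :
    p.cost σ ≤ p.weight * K := by
  have h1 := h.one_le
  induction p with
  | ltI e f =>
    have := e.eval_add_cost_le h
    have := f.eval_add_cost_le h
    simp only [BExpr.cost, BExpr.weight]; nlinarith
  | ltQ e f =>
    have := e.eval_add_cost_le h
    have := f.eval_add_cost_le h
    simp only [BExpr.cost, BExpr.weight]; nlinarith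
  | not p hp => simp only [BExpr.cost, BExpr.weight]; nlinarith
  | and p q hp hq => simp only [BExpr.cost, BExpr.weight]; nlinarith

open Polynomial in
/-- The running time per unit of memory bound, as a polynomial in a bound on the number of
iterations of each loop. -/
noncomputable def Prog.timePoly : Prog → ℕ[X]
  | skip => 1
  | setCtr _ e => C (e.weight + 1)
  | setCell _ i j e => C (i.weight + j.weight + e.weight + 1)
  | seq c d => c.timePoly + d.timePoly
  | ite p c d => C p.weight + c.timePoly + d.timePoly
  | .while p c => (X + 1) * (C p.weight + c.timePoly)
  | solveLP _ => 0

/-- Started in the memory `σ` of size at most `K`, the program `c` halts in a memory that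
satisfies `Q` and again has size at most `K`, without calling the solver; `M` bounds the number of
iterations of each loop. -/
def Runs {n : ℕ} (ans : Fin n → ℚ) (M K : ℕ) (c : Prog) (σ : Store) (Q : Store → Prop) : Prop :=
  σ.Bounded K → ∃ τ t, Exec ans c σ τ t 0 ∧ t ≤ c.timePoly.eval M * K ∧ τ.Bounded K ∧ Q τ

/-! ### Proof rules for programs -/

section Rules

variable {n : ℕ} {ans : Fin n → ℚ} {M K : ℕ} {σ : Store} {Q : Store → Prop}

theorem Runs.mono {c : Prog} {Q' : Store → Prop} (h : Runs ans M K c σ Q)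
    (hQ : ∀ τ, Q τ → Q' τ) : Runs ans M K c σ Q' := fun hσ => by
  obtain ⟨τ, t, h1, h2, h3, h4⟩ := h hσ
  exact ⟨τ, t, h1, h2, h3, hQ _ h4⟩

theorem Runs.skip (h : Q σ) : Runs ans M K .skip σ Q := fun hσ =>
  ⟨σ, 1, .skip σ, by simpa [Prog.timePoly] using hσ.one_le, hσ, h⟩

/-- Besides the postcondition, an assignment leaves one obligation: the value written must respect
`K`. The time is paid by the weight of the program text. -/
theorem Runs.setCtr {v : ℕ} {e : IExpr} (he : e.eval σ ≤ K) (h : Q (σ.setCtr v (e.eval σ))) :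
    Runs ans M K (.setCtr v e) σ Q := fun hσ =>
  ⟨_, _, .setCtr v e σ, by
    have := e.eval_add_cost_le hσ
    have := hσ.one_le
    simp only [Prog.timePoly, Polynomial.eval_C]; nlinarith, hσ.setCtr he, h⟩

theorem Runs.setCell {v : ℕ} {i j : IExpr} {e : QExpr} (he : ratSize (e.eval σ) ≤ K)
    (h : Q (σ.setCell v (i.eval σ) (j.eval σ) (e.eval σ))) :
    Runs ans M K (.setCell v i j e) σ Q := fun hσ =>
  ⟨_, _, .setCell v i j e σ, by
    have := e.eval_add_cost_le hσ
    have := i.eval_add_cost_le hσ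
    have := j.eval_add_cost_le hσ
    have := hσ.one_le
    simp only [Prog.timePoly, Polynomial.eval_C]; nlinarith, hσ.setCell he, h⟩

/-- The postcondition of the first program is the claim about the second, so that a proof follows
the program text forwards. -/
theorem Runs.seq {c d : Prog} (h : Runs ans M K c σ fun τ => Runs ans M K d τ Q) :
    Runs ans M K (.seq c d) σ Q := fun hσ => by
  obtain ⟨τ, t, h1, h2, h3, h4⟩ := h hσ
  obtain ⟨υ, t', h1', h2', h3', h4'⟩ := h4 h3
  refine ⟨υ, t + t', .seq h1 h1', ?_, h3', h4'⟩
  simp only [Prog.timePoly, Polynomial.eval_add]; nlinarith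

theorem Runs.ite {p : BExpr} {c d : Prog} (h1 : p.eval σ = true → Runs ans M K c σ Q)
    (h2 : p.eval σ = false → Runs ans M K d σ Q) : Runs ans M K (.ite p c d) σ Q := fun hσ => by
  have hp := p.cost_le hσ
  cases hpv : p.eval σ with
  | true =>
    obtain ⟨τ, t, e1, e2, e3, e4⟩ := h1 hpv hσ
    refine ⟨τ, _, .iteTrue d hpv e1, ?_, e3, e4⟩
    simp only [Prog.timePoly, Polynomial.eval_add, Polynomial.eval_C]; nlinarith
  | false =>
    obtain ⟨τ, t, e1, e2, e3, e4⟩ := h2 hpv hσ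
    refine ⟨τ, _, .iteFalse c hpv e1, ?_, e3, e4⟩
    simp only [Prog.timePoly, Polynomial.eval_add, Polynomial.eval_C]; nlinarith

/-- The rule for loops: `Inv k` holds with at most `k` iterations to go. -/
theorem Runs.while {p : BExpr} {c : Prog} (Inv : ℕ → Store → Prop)
    (hfalse : ∀ k τ, Inv k τ → p.eval τ = false → Q τ)
    (htrue : ∀ k τ, Inv k τ → p.eval τ = true →
      0 < k ∧ Runs ans M K c τ (Inv (k - 1)))
    {k : ℕ} (hk : k ≤ M) (hσ : Inv k σ) : Runs ans M K (.while p c) σ Q := by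
  -- Induction on the iterations still allowed; the factor k + 1 also pays for the final test that
  -- fails.
  have key : ∀ (k : ℕ) (σ : Store), Inv k σ → σ.Bounded K → ∃ τ t, Exec ans (.while p c) σ τ t 0 ∧
      t ≤ (k + 1) * (p.weight + c.timePoly.eval M) * K ∧ τ.Bounded K ∧ Q τ := by
    intro k
    induction k with
    | zero =>
      intro σ hI hB
      have hp := p.cost_le hB
      cases hpv : p.eval σ with
      | true => exact absurd (htrue _ _ hI hpv).1 (lt_irrefl 0)
      | false =>
        refine ⟨σ, _, .whileFalse c hpv, ?_, hB, hfalse _ _ hI hpv⟩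
        nlinarith [Nat.zero_le (c.timePoly.eval M * K)]
    | succ k ih =>
      intro σ hI hB
      have hp := p.cost_le hB
      cases hpv : p.eval σ with
      | true =>
        obtain ⟨τ, t, e1, e2, e3, e4⟩ := (htrue _ _ hI hpv).2 hB
        obtain ⟨υ, t', e1', e2', e3', e4'⟩ := ih τ e4 e3
        refine ⟨υ, _, .whileTrue hpv e1 e1', ?_, e3', e4'⟩
        nlinarith
      | false =>
        refine ⟨σ, _, .whileFalse c hpv, ?_, hB, hfalse _ _ hI hpv⟩
        have : (k + 1 + 1) * (p.weight + c.timePoly.eval M) * K =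
          p.weight * K + ((k + 1) * p.weight + (k + 1 + 1) * c.timePoly.eval M) * K := by ring
        rw [this]; exact hp.trans (Nat.le_add_right _ _)
  intro hB
  obtain ⟨τ, t, e1, e2, e3, e4⟩ := key k σ hσ hB
  refine ⟨τ, t, e1, e2.trans ?_, e3, e4⟩
  simp only [Prog.timePoly, Polynomial.eval_add, Polynomial.eval_C, Polynomial.eval_mul,
    Polynomial.eval_X, Polynomial.eval_one]
  gcongr

/-- `for c < N do body`; outside of the loop the counter `c` is zero. -/
def forLoop (c : ℕ) (N : IExpr) (body : Prog) : Prog :=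
  .seq (.setCtr c (.const 0)) (.seq
    (.while (.ltI (.ctr c) N) (.seq body (.setCtr c (.add (.ctr c) (.const 1)))))
    (.setCtr c (.const 0)))

theorem Store.setCtr_setCtr (σ : Store) (c a b : ℕ) :
    (σ.setCtr c a).setCtr c b = σ.setCtr c b := by
  simp [Store.setCtr]

theorem Store.setCtr_of_eq {c a : ℕ} (h : σ.ctr c = a) : σ.setCtr c a = σ := by
  subst h; simp [Store.setCtr]

/-- The rule for counting loops over a range given by the counter `b`; the invariant is stated
for the memory with the loop counter reset. -/
theorem Runs.for {c b N : ℕ} {body : Prog} (Inv : ℕ → Store → Prop) (hbc : b ≠ c)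
    (hN : ∀ i τ, Inv i τ → τ.ctr b = N) (hNM : N ≤ M) (hNK : N ≤ K)
    (hc : σ.ctr c = 0) (h0 : Inv 0 σ)
    (hstep : ∀ i < N, ∀ τ, τ.ctr c = 0 → Inv i τ →
      Runs ans M K body (τ.setCtr c i) fun υ => υ.ctr c = i ∧ Inv (i + 1) (υ.setCtr c 0))
    (hQ : ∀ τ, τ.ctr c = 0 → Inv N τ → Q τ) : Runs ans M K (forLoop c (.ctr b) body) σ Q := by
  refine Runs.seq (Runs.setCtr (by simp) (Runs.seq ?_))
  refine Runs.while (fun k τ => ∃ i, i + k = N ∧ τ.ctr c = i ∧ Inv i (τ.setCtr c 0)) ?_ ?_ hNM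
    ⟨0, by simp, by simp, by
      simpa [Store.setCtr_setCtr, Store.setCtr_of_eq hc] using h0⟩
  · rintro k τ ⟨i, hik, hci, hI⟩ hp
    have hNτ := hN i _ hI
    simp only [Store.setCtr_ctr, if_neg hbc] at hNτ
    simp [hci, hNτ] at hp
    obtain rfl : i = N := by omega
    exact Runs.setCtr (by simp) (hQ _ (by simp) hI)
  · rintro k τ ⟨i, hik, hci, hI⟩ hp
    have hNτ := hN i _ hI
    simp only [Store.setCtr_ctr, if_neg hbc] at hNτ
    simp [hci, hNτ] at hp
    have hs := hstep i hp _ (by simp) hI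
    rw [Store.setCtr_setCtr, Store.setCtr_of_eq hci] at hs
    refine ⟨by omega, Runs.seq (hs.mono ?_)⟩
    rintro υ ⟨hυ, hInv⟩
    refine Runs.setCtr (by simp [hυ]; omega) ⟨i + 1, by omega, by simp [hυ], ?_⟩
    simpa [Store.setCtr_setCtr] using hInv

/-- The rule for counting loops whose effect is known exactly. -/
theorem Runs.forState {c b N : ℕ} {body : Prog} (st : ℕ → Store) (hbc : b ≠ c)
    (hN : ∀ i, (st i).ctr b = N) (hNM : N ≤ M) (hNK : N ≤ K)
    (hc : ∀ i, (st i).ctr c = 0) (h0 : st 0 = σ)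
    (hstep : ∀ i < N,
      Runs ans M K body ((st i).setCtr c i) fun υ => υ = (st (i + 1)).setCtr c i)
    (hQ : Q (st N)) : Runs ans M K (forLoop c (.ctr b) body) σ Q := by
  refine Runs.for (fun i τ => τ = st i) hbc ?_ hNM hNK (h0 ▸ hc 0) h0.symm ?_ ?_
  · rintro i _ rfl
    exact hN i
  · rintro i hi _ _ rfl
    refine (hstep i hi).mono ?_
    rintro _ rfl
    exact ⟨by simp, by rw [Store.setCtr_setCtr, Store.setCtr_of_eq (hc _)]⟩
  · rintro _ _ rfl
    exact hQ

end Rules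

/-! ### Determinant bounds -/

/-- Multiply out the right-hand side over all maps from rows to columns: the absolute values of the
Leibniz terms are the terms that belong to permutations. -/
theorem natAbs_det_le {k : ℕ} (B : Matrix (Fin k) (Fin k) ℤ) :
    B.det.natAbs ≤ ∏ i, ∑ j, (B i j).natAbs := by
  rw [← Matrix.det_transpose, Matrix.det_apply, Finset.prod_univ_sum, Fintype.piFinset_univ]
  have h1 : (∑ σ : Equiv.Perm (Fin k), Equiv.Perm.sign σ • ∏ i, B.transpose (σ i) i).natAbs ≤
      ∑ σ : Equiv.Perm (Fin k), ∏ i, (B i (σ i)).natAbs := by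
    refine (Int.natAbs_sum_le _ _).trans (Finset.sum_le_sum fun σ _ => le_of_eq ?_)
    rw [Units.smul_def, smul_eq_mul, Int.natAbs_mul, Int.units_natAbs, one_mul]
    exact map_prod Int.natAbsHom _ _
  refine h1.trans ?_
  have h2 : ∑ σ : Equiv.Perm (Fin k), ∏ i, (B i (σ i)).natAbs =
      ∑ f ∈ Finset.univ.image (fun σ : Equiv.Perm (Fin k) => (σ : Fin k → Fin k)),
        ∏ i, (B i (f i)).natAbs := by
    rw [Finset.sum_image]
    intro σ _ τ _ h
    exact Equiv.coe_fn_injective h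
  rw [h2]
  exact Finset.sum_le_sum_of_subset (Finset.subset_univ _)

/-- The left-hand side consists of some of the nonnegative terms of the expanded product. Row sums
are replaced by such products because factors of at least 1 can be added freely, which covers all
submatrices at once. -/
theorem sum_le_prod_one_add {ι : Type*} (s : Finset ι) (f : ι → ℕ) :
    1 + ∑ i ∈ s, f i ≤ ∏ i ∈ s, (1 + f i) := by
  classical
  induction s using Finset.induction_on with
  | empty => simp
  | insert a s ha ih =>
    rw [Finset.sum_insert ha, Finset.prod_insert ha]
    nlinarith [Nat.zero_le (f a * ∑ i ∈ s, f i)]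

/-- A bound for all the determinants in question: `∏ (1 + |Aᵢⱼ|)`. -/
def detBound {m n : ℕ} (A : Matrix (Fin m) (Fin n) ℤ) : ℕ :=
  ∏ i, ∏ j, (1 + (A i j).natAbs)

theorem detBound_pos {m n : ℕ} (A : Matrix (Fin m) (Fin n) ℤ) : 1 ≤ detBound A :=
  Finset.prod_pos fun _ _ => Finset.prod_pos fun _ _ => Nat.add_pos_left one_pos _

theorem prod_rows_le_detBound {m n : ℕ} (A : Matrix (Fin m) (Fin n) ℤ) (s : Finset (Fin m)) :
    ∏ i ∈ s, ∏ j, (1 + (A i j).natAbs) ≤ detBound A :=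
  Finset.prod_le_prod_of_subset_of_one_le' (Finset.subset_univ _)
    fun _ _ _ => Finset.prod_pos fun _ _ => Nat.add_pos_left one_pos _

/-- A repeated row or column gives determinant zero. Otherwise each row sum is at most the product
over the full row, and the rows not chosen contribute factors of at least 1. -/
theorem maxSubdet_le_detBound {m n : ℕ} (A : Matrix (Fin m) (Fin n) ℤ) :
    maxSubdet A ≤ detBound A := by
  unfold maxSubdet
  refine Finset.sup_le fun k _ => Finset.sup_le fun fg _ => ?_
  obtain ⟨f, g⟩ := fg
  by_cases hf : Function.Injective f
  · by_cases hg : Function.Injective g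
    · refine (natAbs_det_le _).trans ?_
      have h1 : ∀ i, ∑ j, ((A.submatrix f g) i j).natAbs ≤ ∏ j, (1 + (A (f i) j).natAbs) := by
        intro i
        refine le_trans ?_ (le_trans (Nat.le_add_left _ 1) (sum_le_prod_one_add Finset.univ _))
        simp only [Matrix.submatrix_apply]
        rw [← Finset.sum_image (s := Finset.univ) (g := g) (f := fun j => (A (f i) j).natAbs)
          (fun a _ b _ h => hg h)]
        exact Finset.sum_le_sum_of_subset (Finset.subset_univ _)
      refine (Finset.prod_le_prod' fun i _ => h1 i).trans ?_
      rw [← Finset.prod_image (s := Finset.univ) (g := f)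
        (f := fun i => ∏ j, (1 + (A i j).natAbs)) (fun a _ b _ h => hf h)]
      exact prod_rows_le_detBound A _
    · simp only [Function.Injective, not_forall] at hg
      obtain ⟨a, b, hab, hne⟩ := hg
      rw [Matrix.det_zero_of_column_eq hne (fun i => by simp [hab])]; simp
  · simp only [Function.Injective, not_forall] at hf
    obtain ⟨a, b, hab, hne⟩ := hf
    rw [Matrix.det_zero_of_row_eq hne (by ext j; simp [hab])]; simp

theorem one_add_natAbs_le (z : ℤ) : 1 + z.natAbs ≤ 2 ^ ratSize (z : ℚ) := by
  have h1 : z.natAbs < 2 ^ Nat.size z.natAbs := Nat.lt_size_self _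
  have h2 : 2 ^ Nat.size z.natAbs ≤ 2 ^ ratSize (z : ℚ) := by
    apply Nat.pow_le_pow_right (by norm_num)
    simp only [ratSize, Rat.num_intCast]; omega
  omega

theorem detBound_le {m n : ℕ} (I : LP m n) : detBound I.A ≤ 2 ^ I.size := by
  have h : detBound I.A ≤ 2 ^ (∑ i, ∑ j, ratSize (I.A i j)) := by
    unfold detBound
    rw [← Finset.prod_pow_eq_pow_sum]
    refine Finset.prod_le_prod' fun i _ => ?_
    rw [← Finset.prod_pow_eq_pow_sum]
    exact Finset.prod_le_prod' fun j _ => one_add_natAbs_le _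
  refine h.trans (Nat.pow_le_pow_right (by norm_num) ?_)
  unfold LP.size; omega

/-! ### Elimination -/

/-- Row `j` of this matrix is a unit vector, or the row `ρ j` of `A`. -/
def pivotMatrix {m n : ℕ} (A : Matrix (Fin m) (Fin n) ℤ) (ρ : Fin n → Option (Fin m)) :
    Matrix (Fin n) (Fin n) ℤ :=
  Matrix.of fun j => (ρ j).elim (Pi.single j 1) fun i => A i

theorem pivotMatrix_of_none {m n : ℕ} {A : Matrix (Fin m) (Fin n) ℤ} {ρ : Fin n → Option (Fin m)}
    {j : Fin n} (h : ρ j = none) (k : Fin n) :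
    pivotMatrix A ρ j k = if k = j then 1 else 0 := by
  simp [pivotMatrix, h, Pi.single_apply]

theorem pivotMatrix_of_some {m n : ℕ} {A : Matrix (Fin m) (Fin n) ℤ} {ρ : Fin n → Option (Fin m)}
    {j : Fin n} {i : Fin m} (h : ρ j = some i) (k : Fin n) : pivotMatrix A ρ j k = A i k := by
  simp [pivotMatrix, h]

section PivotBounds

variable {m n : ℕ} {A : Matrix (Fin m) (Fin n) ℤ} {ρ : Fin n → Option (Fin m)}

/-- Each row of `A` is the pivot row of at most one column, so the nontrivial factors belong to
distinct rows. -/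
theorem prod_pivot_rows_le (hρ : ∀ j j' i, ρ j = some i → ρ j' = some i → j = j') :
    ∏ j, (ρ j).elim 1 (fun i => ∏ k, (1 + (A i k).natAbs)) ≤ detBound A := by
  classical
  set s : Finset (Fin n) := Finset.univ.filter fun j => (ρ j).isSome with hs
  have h1 : ∏ j, (ρ j).elim 1 (fun i => ∏ k, (1 + (A i k).natAbs)) =
      ∏ j ∈ s, (ρ j).elim 1 (fun i => ∏ k, (1 + (A i k).natAbs)) := by
    symm
    apply Finset.prod_subset (Finset.subset_univ _)
    intro j _ hj
    have : ρ j = none := by simpa [hs] using hj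
    simp [this]
  rw [h1]
  have hmem : ∀ j : s, (ρ j).isSome := fun j => (Finset.mem_filter.1 j.2).2
  have h2 : ∏ j ∈ s, (ρ j).elim 1 (fun i => ∏ k, (1 + (A i k).natAbs)) =
      ∏ j ∈ s.attach, (∏ k, (1 + (A ((ρ j).get (hmem j)) k).natAbs)) := by
    rw [← Finset.prod_attach]
    refine Finset.prod_congr rfl fun j _ => ?_
    obtain ⟨i, hi⟩ := Option.isSome_iff_exists.1 (hmem j)
    simp [hi]
  rw [h2, ← Finset.prod_image (s := s.attach)
    (g := fun j => (ρ j).get (hmem j))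
    (f := fun i => ∏ k, (1 + (A i k).natAbs))]
  · exact prod_rows_le_detBound A _
  · intro a _ b _ h
    apply Subtype.ext
    refine hρ a b _ (Option.some_get (hmem a)).symm ?_
    rw [show (ρ a).get (hmem a) = (ρ b).get (hmem b) from h]
    exact (Option.some_get (hmem b)).symm

theorem row_sum_pivotMatrix_le (j : Fin n) :
    ∑ k, (pivotMatrix A ρ j k).natAbs ≤ (ρ j).elim 1 (fun i => ∏ k, (1 + (A i k).natAbs)) := by
  cases h : ρ j with
  | none =>
    simp only [pivotMatrix_of_none h, Option.elim_none]
    rw [Finset.sum_eq_single j] <;> simp +contextual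
  | some i =>
    simp only [pivotMatrix_of_some h, Option.elim_some]
    exact le_trans (Nat.le_add_left _ 1) (sum_le_prod_one_add Finset.univ _)

theorem det_pivotMatrix_le (hρ : ∀ j j' i, ρ j = some i → ρ j' = some i → j = j') :
    (pivotMatrix A ρ).det.natAbs ≤ detBound A :=
  (natAbs_det_le _).trans ((Finset.prod_le_prod' fun j _ => row_sum_pivotMatrix_le j).trans
    (prod_pivot_rows_le hρ))

/-- An entry of the adjugate is the determinant after one row is replaced by a unit vector, whose
row sum 1 does not exceed the factor of the replaced row. -/
theorem adjugate_pivotMatrix_le (hρ : ∀ j j' i, ρ j = some i → ρ j' = some i → j = j')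
    (j k : Fin n) : ((pivotMatrix A ρ).adjugate j k).natAbs ≤ detBound A := by
  rw [Matrix.adjugate_apply]
  refine (natAbs_det_le _).trans ((Finset.prod_le_prod' fun i _ => ?_).trans
    (prod_pivot_rows_le hρ))
  rcases eq_or_ne i k with rfl | hik
  · have h1 : ∑ l, (((pivotMatrix A ρ).updateRow i (Pi.single j 1)) i l).natAbs = 1 := by
      simp only [Matrix.updateRow_self]
      rw [Finset.sum_eq_single j] <;> simp +contextual
    rw [h1]
    cases ρ i with
    | none => simp
    | some i' =>
      exact Nat.succ_le_of_lt (Finset.prod_pos fun _ _ => Nat.add_pos_left one_pos _)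
  · simp only [Matrix.updateRow_ne hik]
    exact row_sum_pivotMatrix_le i

end PivotBounds

/-- The state of the elimination after the rows `i < t` of `A`: the columns of `V` are the
fundamental kernel vectors, with support in `S`, of the rows that were processed. -/
structure IsTableau {m n : ℕ} (A : Matrix (Fin m) (Fin n) ℤ) (S : Set (Fin n)) (t : ℕ)
    (ρ : Fin n → Option (Fin m)) (V : Matrix (Fin n) (Fin n) ℚ) : Prop where
  inj : ∀ j j' i, ρ j = some i → ρ j' = some i → j = j'
  lt : ∀ j i, ρ j = some i → (i : ℕ) < t
  mem : ∀ j i, ρ j = some i → j ∈ S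
  det_ne : (pivotMatrix A ρ).det ≠ 0
  mul_self : ∀ j k, ρ j = none → ρ k = none → k ∈ S → V j k = if j = k then 1 else 0
  mul_row : ∀ j k i, ρ j = some i → ∑ l, (A i l : ℚ) * V l k = 0
  col_eq_zero : ∀ k, ¬ (ρ k = none ∧ k ∈ S) → ∀ j, V j k = 0
  ker : ∀ i : Fin m, (i : ℕ) < t → ∀ k, ∑ l, (A i l : ℚ) * V l k = 0

namespace IsTableau

variable {m n : ℕ} {A : Matrix (Fin m) (Fin n) ℤ} {S : Set (Fin n)} {t : ℕ}
  {ρ : Fin n → Option (Fin m)} {V : Matrix (Fin n) (Fin n) ℚ}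

/-- The hypotheses say that the pivot matrix annihilates `v`. The field is general because the lemma
is applied to rational columns and to real kernel vectors. -/
theorem eq_zero_of_forall {F : Type*} [Field F] [CharZero F] (h : (pivotMatrix A ρ).det ≠ 0)
    {v : Fin n → F} (h1 : ∀ j, ρ j = none → v j = 0)
    (h2 : ∀ j i, ρ j = some i → ∑ l, (A i l : F) * v l = 0) : v = 0 := by
  have hdet : ((pivotMatrix A ρ).map (Int.castRingHom F)).det ≠ 0 := by
    rw [← RingHom.mapMatrix_apply, ← RingHom.map_det]
    simpa using h
  refine Matrix.eq_zero_of_mulVec_eq_zero hdet ?_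
  ext j
  simp only [Matrix.mulVec, dotProduct, Matrix.map_apply, Pi.zero_apply]
  cases hj : ρ j with
  | none =>
    simp [pivotMatrix_of_none hj, h1 j hj]
  | some i =>
    simpa [pivotMatrix_of_some hj] using h2 j i hj

theorem initial (A : Matrix (Fin m) (Fin n) ℤ) (S : Set (Fin n)) [DecidablePred (· ∈ S)] :
    IsTableau A S 0 (fun _ => none) fun j k => if j = k ∧ k ∈ S then 1 else 0 where
  inj := by simp
  lt := by simp
  mem := by simp
  det_ne := by
    have : pivotMatrix A (fun _ => none) = 1 := by
      ext j k
      rw [pivotMatrix_of_none rfl, Matrix.one_apply]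
      simp [eq_comm]
    simp [this]
  mul_self := fun j k _ _ hk => by simp [hk]
  mul_row := by simp
  col_eq_zero := fun k hk j => by simp at hk; simp [hk]
  ker := by simp

/-- One step of the elimination; if the row is zero on all columns then, as `0 / 0 = 0`, nothing
changes. -/
theorem step (h : IsTableau A S t ρ V) {i : Fin m} (hi : (i : ℕ) = t) {R : Fin n → ℚ}
    (hR : ∀ k, R k = ∑ l, (A i l : ℚ) * V l k) {k₀ : Fin n} (hk₀ : ∀ k, R k ≠ 0 → R k₀ ≠ 0) :
    ∃ ρ', IsTableau A S (t + 1) ρ' fun j k => V j k - V j k₀ * (R k / R k₀) := by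
  classical
  have hrow : ∀ (i' : Fin m) k, ∑ l, (A i' l : ℚ) * (V l k - V l k₀ * (R k / R k₀)) =
      (∑ l, (A i' l : ℚ) * V l k) - (∑ l, (A i' l : ℚ) * V l k₀) * (R k / R k₀) := by
    intro i' k
    rw [Finset.sum_mul, ← Finset.sum_sub_distrib]
    exact Finset.sum_congr rfl fun l _ => by ring
  by_cases h0 : R k₀ = 0
  · have hR0 : ∀ k, R k = 0 := fun k => by
      by_contra hk
      exact hk₀ k hk h0
    refine ⟨ρ, ?_⟩
    simp only [h0, div_zero, mul_zero, sub_zero]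
    refine ⟨h.inj, fun j i hj => (h.lt j i hj).trans (Nat.lt_succ_self _), h.mem, h.det_ne,
      h.mul_self, h.mul_row, h.col_eq_zero, fun i' hi' k => ?_⟩
    rcases Nat.lt_succ_iff_lt_or_eq.1 hi' with hlt | heq
    · exact h.ker i' hlt k
    · obtain rfl : i' = i := Fin.ext (heq.trans hi.symm)
      rw [← hR, hR0]
  have hfree : ρ k₀ = none ∧ k₀ ∈ S := by
    by_contra hcon
    refine h0 ?_
    rw [hR]
    simp [h.col_eq_zero k₀ hcon]
  have hone : V k₀ k₀ = 1 := by rw [h.mul_self _ _ hfree.1 hfree.1 hfree.2, if_pos rfl]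
  have hker' : ∀ i' : Fin m, (i' : ℕ) < t + 1 → ∀ k,
      ∑ l, (A i' l : ℚ) * (V l k - V l k₀ * (R k / R k₀)) = 0 := by
    intro i' hi' k
    rw [hrow]
    rcases Nat.lt_succ_iff_lt_or_eq.1 hi' with hlt | heq
    · rw [h.ker i' hlt, h.ker i' hlt]; simp
    · obtain rfl : i' = i := Fin.ext (heq.trans hi.symm)
      rw [← hR, ← hR, mul_div_cancel₀ _ h0, sub_self]
  have hρ : ∀ j, Function.update ρ k₀ (some i) j = if j = k₀ then some i else ρ j :=
    fun j => Function.update_apply _ _ _ _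
  have hlt' : ∀ j i', Function.update ρ k₀ (some i) j = some i' → (i' : ℕ) < t + 1 := by
    intro j i' hj
    rw [hρ] at hj
    split_ifs at hj with hjk
    · simp only [Option.some.injEq] at hj
      subst hj; omega
    · exact (h.lt j i' hj).trans (Nat.lt_succ_self _)
  refine ⟨Function.update ρ k₀ (some i), ?_, hlt', ?_, ?_, ?_,
    fun j k i' hj => hker' i' (hlt' j i' hj) k, ?_, hker'⟩
  · intro j j' i' hj hj'
    rw [hρ] at hj hj'
    split_ifs at hj hj' with h1 h2 h2
    · rw [h1, h2]
    · simp only [Option.some.injEq] at hj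
      have := h.lt j' i' hj'
      subst hj; omega
    · simp only [Option.some.injEq] at hj'
      have := h.lt j i' hj
      subst hj'; omega
    · exact h.inj j j' i' hj hj'
  · intro j i' hj
    rw [hρ] at hj
    split_ifs at hj with h1
    · rw [h1]; exact hfree.2
    · exact h.mem j i' hj
  -- Let v be a null vector of the new pivot matrix. It agrees with v k₀ times column k₀ of V on the
  -- old nonpivots, and the old pivot rows annihilate both, so it equals this multiple. The new row
  -- i then gives v k₀ * R k₀ = 0.
  · intro hdet
    have hdetQ : ((pivotMatrix A (Function.update ρ k₀ (some i))).map
        (Int.castRingHom ℚ)).det = 0 := by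
      rw [← RingHom.mapMatrix_apply, ← RingHom.map_det, hdet]; simp
    obtain ⟨v, hv0, hv⟩ := Matrix.exists_mulVec_eq_zero_iff.2 hdetQ
    have hv' : ∀ j, ∑ l, (pivotMatrix A (Function.update ρ k₀ (some i)) j l : ℚ) * v l = 0 :=
      fun j => by simpa [Matrix.mulVec, dotProduct] using congrFun hv j
    have hvi : ∑ l, (A i l : ℚ) * v l = 0 := by
      have := hv' k₀
      simpa only [pivotMatrix_of_some (A := A) (show Function.update ρ k₀ (some i) k₀ = some i by
        simp)] using this
    have hsub : (fun j => v j - v k₀ * V j k₀) = 0 := by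
      refine eq_zero_of_forall h.det_ne ?_ ?_
      · intro j hj
        rw [h.mul_self _ _ hj hfree.1 hfree.2]
        by_cases hjk : j = k₀
        · simp [hjk]
        · have hj' : Function.update ρ k₀ (some i) j = none := by rw [hρ, if_neg hjk, hj]
          have := hv' j
          simp only [pivotMatrix_of_none (A := A) hj'] at this
          simpa [hjk] using this
      · intro j i' hj
        have hjk : j ≠ k₀ := by rintro rfl; rw [hfree.1] at hj; cases hj
        have hj' : Function.update ρ k₀ (some i) j = some i' := by rw [hρ, if_neg hjk, hj]
        have h1 := hv' j
        simp only [pivotMatrix_of_some (A := A) hj'] at h1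
        have h2 := h.mul_row j k₀ i' hj
        calc ∑ l, (A i' l : ℚ) * (v l - v k₀ * V l k₀)
            = (∑ l, (A i' l : ℚ) * v l) - v k₀ * ∑ l, (A i' l : ℚ) * V l k₀ := by
              rw [Finset.mul_sum, ← Finset.sum_sub_distrib]
              exact Finset.sum_congr rfl fun l _ => by ring
          _ = 0 := by rw [h1, h2]; ring
    have hvV : ∀ j, v j = v k₀ * V j k₀ := fun j => sub_eq_zero.1 (congrFun hsub j)
    have hz : v k₀ * R k₀ = 0 := by
      rw [hR, Finset.mul_sum, ← hvi]
      refine Finset.sum_congr rfl fun l _ => ?_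
      rw [hvV l]; ring
    have hz' : v k₀ = 0 := (mul_eq_zero.1 hz).resolve_right h0
    exact hv0 (funext fun j => by rw [hvV, hz']; simp)
  · intro j k hj hk hkS
    rw [hρ] at hj hk
    split_ifs at hj hk with h1 h2
    rw [h.mul_self _ _ hj hk hkS, h.mul_self _ _ hj hfree.1 hfree.2, if_neg h1]
    simp
  -- The pivot column is subtracted from itself and becomes zero.
  · intro k hk j
    by_cases hkk : k = k₀
    · rw [hkk, div_self h0]; ring
    · have h1 : ¬ (ρ k = none ∧ k ∈ S) := by
        rwa [hρ, if_neg hkk] at hk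
      have h2 : R k = 0 := by rw [hR]; simp [h.col_eq_zero k h1]
      rw [h.col_eq_zero k h1, h2]; simp

/-- Without columns there is no index to pivot on, and `step` cannot be used. -/
theorem skip_row (h : IsTableau A S t ρ V) (hn : n = 0) : IsTableau A S (t + 1) ρ V := by
  subst hn
  exact ⟨h.inj, fun j => j.elim0, h.mem, h.det_ne, h.mul_self, h.mul_row, h.col_eq_zero,
    fun _ _ k => k.elim0⟩

/-- Used in `LP.exists_denominator_obj`, where a tableau is a tool for an argument about
determinants and is not computed. -/
theorem exists_tableau (A : Matrix (Fin m) (Fin n) ℤ) (S : Set (Fin n)) (t : ℕ) (ht : t ≤ m) :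
    ∃ ρ V, IsTableau A S t ρ V := by
  classical
  induction t with
  | zero => exact ⟨_, _, initial A S⟩
  | succ t ih =>
    obtain ⟨ρ, V, h⟩ := ih (by omega)
    rcases Nat.eq_zero_or_pos n with hn | hn
    · exact ⟨ρ, V, h.skip_row hn⟩
    · by_cases hR : ∃ k, ∑ l, (A ⟨t, ht⟩ l : ℚ) * V l k ≠ 0
      · obtain ⟨k₀, hk₀⟩ := hR
        obtain ⟨ρ', h'⟩ := h.step (i := ⟨t, ht⟩) rfl (fun k => rfl) (k₀ := k₀) fun _ _ => hk₀
        exact ⟨ρ', _, h'⟩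
      · push Not at hR
        obtain ⟨ρ', h'⟩ := h.step (i := ⟨t, ht⟩) rfl (fun k => rfl) (k₀ := ⟨0, hn⟩)
          fun k hk => absurd (hR k) hk
        exact ⟨ρ', _, h'⟩

-- Cramer's rule: the pivot matrix maps a nonzero column k of `V` to the k-th unit vector. Hence the
-- entries depend on determinants only and not on the course of the elimination, which is why they
-- do not grow.
open Classical in
theorem mul_det_eq (h : IsTableau A S t ρ V) (j k : Fin n) :
    V j k * ((pivotMatrix A ρ).det : ℤ) =
      ((if ρ k = none ∧ k ∈ S then (pivotMatrix A ρ).adjugate j k else 0 : ℤ) : ℚ) := by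
  classical
  by_cases hk : ρ k = none ∧ k ∈ S
  · rw [if_pos hk]
    set E := (pivotMatrix A ρ).map (Int.castRingHom ℚ) with hE
    have hcol : E.mulVec (fun j => V j k) = Pi.single k 1 := by
      ext j
      simp only [Matrix.mulVec, dotProduct, hE, Matrix.map_apply]
      cases hj : ρ j with
      | none =>
        simp [pivotMatrix_of_none hj, h.mul_self j k hj hk.1 hk.2, Pi.single_apply]
      | some i =>
        have hjk : j ≠ k := by rintro rfl; rw [hk.1] at hj; cases hj
        simpa [pivotMatrix_of_some hj, hjk] using h.mul_row j k i hj
    have h1 : E.adjugate.mulVec (E.mulVec fun j => V j k) = E.det • fun j => V j k := by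
      rw [Matrix.mulVec_mulVec, Matrix.adjugate_mul, Matrix.smul_mulVec, Matrix.one_mulVec]
    rw [hcol] at h1
    have h2 := congrFun h1 j
    have h3 : E.det = ((pivotMatrix A ρ).det : ℤ) := by
      rw [hE, ← RingHom.mapMatrix_apply, ← RingHom.map_det]; rfl
    have h4 : E.adjugate j k = ((pivotMatrix A ρ).adjugate j k : ℤ) := by
      rw [hE, ← RingHom.mapMatrix_apply, ← RingHom.map_adjugate]; rfl
    rw [Matrix.mulVec_single_one] at h2
    simp only [Matrix.col_apply, Pi.smul_apply, smul_eq_mul] at h2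
    rw [← h4, h2, ← h3, mul_comm]
  · rw [if_neg hk, h.col_eq_zero k hk]; simp

/-- All entries have a common denominator of absolute value at most `detBound A`. -/
theorem exists_denominator (h : IsTableau A S t ρ V) : ∃ D : ℤ, D ≠ 0 ∧ D.natAbs ≤ detBound A ∧
    ∀ j k, ∃ z : ℤ, V j k * D = z ∧ z.natAbs ≤ detBound A := by
  classical
  refine ⟨_, h.det_ne, det_pivotMatrix_le h.inj, fun j k => ⟨_, h.mul_det_eq j k, ?_⟩⟩
  split_ifs
  · exact adjugate_pivotMatrix_le h.inj j k
  · simp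

/-- At the end, `V` projects onto the kernel vectors with support in `S`. -/
theorem proj_eq_self {F : Type*} [Field F] [CharZero F] (h : IsTableau A S m ρ V) {z : Fin n → F}
    (hz : ∀ i, ∑ l, (A i l : F) * z l = 0) (hS : ∀ j, z j ≠ 0 → j ∈ S) (j : Fin n) :
    z j = ∑ k, (V j k : F) * z k := by
  have hker : ∀ i k, ∑ l, (A i l : F) * (V l k : F) = 0 := fun i k => by
    have := congrArg (Rat.cast : ℚ → F) (h.ker i i.2 k)
    push_cast at this
    exact this
  -- The difference vanishes on the nonpivots, where V is the identity or z is zero, and the pivot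
  -- rows annihilate it.
  have : (fun j => z j - ∑ k, (V j k : F) * z k) = 0 := by
    refine eq_zero_of_forall h.det_ne ?_ ?_
    · intro j hj
      rw [sub_eq_zero]
      rw [Finset.sum_eq_single j]
      · by_cases hjS : j ∈ S
        · rw [h.mul_self j j hj hj hjS]; simp
        · have : z j = 0 := by
            by_contra hne
            exact hjS (hS j hne)
          simp [this]
      · intro k _ hkj
        by_cases hk : ρ k = none ∧ k ∈ S
        · rw [h.mul_self j k hj hk.1 hk.2, if_neg (Ne.symm hkj)]; simp
        · rw [h.col_eq_zero k hk]; simp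
      · simp
    · intro j i _
      have : ∑ l, (A i l : F) * ∑ k, (V l k : F) * z k = 0 := by
        simp only [Finset.mul_sum]
        rw [Finset.sum_comm]
        refine Finset.sum_eq_zero fun k _ => ?_
        rw [← zero_mul (z k), ← hker i k, Finset.sum_mul]
        exact Finset.sum_congr rfl fun l _ => by ring
      simp only [mul_sub, Finset.sum_sub_distrib, hz i, this, sub_zero]
  exact sub_eq_zero.1 (congrFun this j)

/-- A single diagonal entry tells whether a column is nonzero; this is what the program tests. -/
theorem diag_eq (h : IsTableau A S t ρ V) (k : Fin n) :
    V k k = 1 ∨ V k k = 0 ∧ ∀ j, V j k = 0 := by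
  by_cases hk : ρ k = none ∧ k ∈ S
  · left; rw [h.mul_self k k hk.1 hk.1 hk.2, if_pos rfl]
  · exact Or.inr ⟨h.col_eq_zero k hk k, h.col_eq_zero k hk⟩

theorem mem_of_ne_zero (h : IsTableau A S t ρ V) {j k : Fin n} (hjk : V j k ≠ 0) : j ∈ S := by
  have hk : ρ k = none ∧ k ∈ S := by
    by_contra hcon
    exact hjk (h.col_eq_zero k hcon j)
  cases hj : ρ j with
  | none =>
    rw [h.mul_self j k hj hk.1 hk.2] at hjk
    have : j = k := by simpa using hjk
    rw [this]; exact hk.2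
  | some i => exact h.mem j i hj

/-- At the end, kernel vectors with support in that of a column are multiples of the column. -/
theorem eq_mul_col {F : Type*} [Field F] [CharZero F] (h : IsTableau A S m ρ V) {k : Fin n}
    {z : Fin n → F}
    (hz : ∀ i, ∑ l, (A i l : F) * z l = 0) (hsupp : ∀ j, z j ≠ 0 → V j k ≠ 0) (j : Fin n) :
    z j = z k * (V j k : F) := by
  rw [h.proj_eq_self hz (fun j hj => h.mem_of_ne_zero (hsupp j hj)) j, Finset.sum_eq_single k]
  · ring
  -- At another free index l the column k vanishes, hence so does z by the hypothesis on supports;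
  -- at an index that is not free the column l is zero.
  · intro l _ hlk
    by_cases hl : ρ l = none ∧ l ∈ S
    · have : z l = 0 := by
        by_contra hne
        refine hsupp l hne ?_
        by_cases hk : ρ k = none ∧ k ∈ S
        · rw [h.mul_self l k hl.1 hk.1 hk.2, if_neg hlk]
        · exact h.col_eq_zero k hk l
      simp [this]
    · rw [h.col_eq_zero l hl]; simp
  · simp

end IsTableau

/-! ### Linear programs over the rationals -/

section LinearProgram

variable {m n : ℕ}

/-- The objective value of a rational vector. -/
def LP.objQ (I : LP m n) (x : Fin n → ℚ) : ℚ := ∑ j, (I.w j : ℚ) * x j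

theorem LP.obj_toReal (I : LP m n) (x : Fin n → ℚ) : I.obj (toReal x) = (I.objQ x : ℝ) := by
  simp [LP.obj, LP.objQ, toReal]

theorem LP.obj_add (I : LP m n) (x y : Fin n → ℝ) : I.obj (x + y) = I.obj x + I.obj y := by
  simp [LP.obj, mul_add, Finset.sum_add_distrib]

theorem LP.obj_sub (I : LP m n) (x y : Fin n → ℝ) : I.obj (x - y) = I.obj x - I.obj y := by
  simp [LP.obj, mul_sub, Finset.sum_sub_distrib]

theorem LP.obj_smul (I : LP m n) (a : ℝ) (x : Fin n → ℝ) : I.obj (a • x) = a * I.obj x := by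
  simp only [LP.obj, Finset.mul_sum, Pi.smul_apply, smul_eq_mul]
  exact Finset.sum_congr rfl fun j _ => by ring

theorem LP.objQ_add_smul (I : LP m n) (x d : Fin n → ℚ) (a : ℚ) :
    I.objQ (fun j => x j + a * d j) = I.objQ x + a * I.objQ d := by
  simp only [LP.objQ, Finset.mul_sum, ← Finset.sum_add_distrib]
  exact Finset.sum_congr rfl fun j _ => by ring

theorem LP.objQ_sub (I : LP m n) (x y : Fin n → ℚ) :
    I.objQ (fun j => x j - y j) = I.objQ x - I.objQ y := by
  simp [LP.objQ, mul_sub, Finset.sum_sub_distrib]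

theorem mulR_add (A : Matrix (Fin m) (Fin n) ℤ) (x y : Fin n → ℝ) :
    mulR A (x + y) = mulR A x + mulR A y := by
  ext i; simp [mulR, mul_add, Finset.sum_add_distrib]

theorem mulR_sub (A : Matrix (Fin m) (Fin n) ℤ) (x y : Fin n → ℝ) :
    mulR A (x - y) = mulR A x - mulR A y := by
  ext i; simp [mulR, mul_sub, Finset.sum_sub_distrib]

theorem mulR_smul (A : Matrix (Fin m) (Fin n) ℤ) (a : ℝ) (x : Fin n → ℝ) :
    mulR A (a • x) = a • mulR A x := by
  ext i
  simp only [mulR, Finset.mul_sum, Pi.smul_apply, smul_eq_mul]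
  exact Finset.sum_congr rfl fun j _ => by ring

/-- The rational kernel of `A`. -/
def InKer (A : Matrix (Fin m) (Fin n) ℤ) (d : Fin n → ℚ) : Prop :=
  ∀ i, ∑ l, (A i l : ℚ) * d l = 0

theorem inKer_iff {A : Matrix (Fin m) (Fin n) ℤ} {d : Fin n → ℚ} :
    InKer A d ↔ mulR A (toReal d) = 0 := by
  rw [funext_iff]
  refine forall_congr' fun i => ?_
  simp only [mulR, toReal, Pi.zero_apply]
  exact_mod_cast Iff.rfl

theorem InKer.add_smul {A : Matrix (Fin m) (Fin n) ℤ} {x d : Fin n → ℚ} (hx : InKer A x)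
    (hd : InKer A d) (a : ℚ) : InKer A fun j => x j + a * d j := by
  intro i
  have h : ∑ l, (A i l : ℚ) * (x l + a * d l) =
      (∑ l, (A i l : ℚ) * x l) + a * ∑ l, (A i l : ℚ) * d l := by
    rw [Finset.mul_sum, ← Finset.sum_add_distrib]
    exact Finset.sum_congr rfl fun j _ => by ring
  rw [h, hx i, hd i]; simp

/-! ### Directions -/

theorem IsCircuitMultiple.mulR_eq_zero {A : Matrix (Fin m) (Fin n) ℤ} {d : Fin n → ℝ}
    (h : IsCircuitMultiple A d) : mulR A d = 0 := by
  obtain ⟨c, hc, α, _, hd⟩ := h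
  ext i
  have h1 := congrFun hc.2.1 i
  simp only [Matrix.mulVec, dotProduct, Pi.zero_apply] at h1
  have h2 : ∑ l, (A i l : ℝ) * (c l : ℝ) = 0 := by exact_mod_cast h1
  simp only [mulR, Pi.zero_apply, hd]
  rw [← mul_zero α, ← h2, Finset.mul_sum]
  exact Finset.sum_congr rfl fun j _ => by ring

theorem IsCircuitMultiple.ne_zero {A : Matrix (Fin m) (Fin n) ℤ} {d : Fin n → ℝ}
    (h : IsCircuitMultiple A d) : ∃ j, d j ≠ 0 := by
  obtain ⟨c, hc, α, hα, hd⟩ := h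
  obtain ⟨j, hj⟩ := Function.ne_iff.1 hc.1
  exact ⟨j, by rw [hd]; exact mul_ne_zero hα.ne' (by exact_mod_cast hj)⟩

theorem IsCircuitMultiple.smul {A : Matrix (Fin m) (Fin n) ℤ} {d : Fin n → ℝ}
    (h : IsCircuitMultiple A d) {a : ℝ} (ha : 0 < a) : IsCircuitMultiple A (a • d) := by
  obtain ⟨c, hc, α, hα, hd⟩ := h
  exact ⟨c, hc, a * α, mul_pos ha hα, fun j => by simp [hd, mul_assoc]⟩

theorem IsCircuit.neg {A : Matrix (Fin m) (Fin n) ℤ} {c : Fin n → ℤ} (h : IsCircuit A c) :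
    IsCircuit A (-c) := by
  refine ⟨neg_ne_zero.2 h.1, by rw [Matrix.mulVec_neg, h.2.1, neg_zero], fun d h0 h1 => ?_⟩
  rw [Function.support_neg]
  exact h.2.2 d h0 h1

theorem IsCircuitMultiple.neg {A : Matrix (Fin m) (Fin n) ℤ} {d : Fin n → ℝ}
    (h : IsCircuitMultiple A d) : IsCircuitMultiple A (-d) := by
  obtain ⟨c, hc, α, hα, hd⟩ := h
  exact ⟨-c, hc.neg, α, hα, fun j => by simp [hd]⟩

/-- `d` has a common denominator and numerators of absolute value at most `B`. -/
def HasDenominator (B : ℕ) (d : Fin n → ℚ) : Prop :=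
  ∃ D : ℤ, D ≠ 0 ∧ D.natAbs ≤ B ∧ ∀ j, ∃ z : ℤ, d j * D = z ∧ z.natAbs ≤ B

/-- `d` is a multiple of a circuit with support in `S`, and its objective value is nonzero if
possible. -/
structure LP.IsDirection (I : LP m n) (S : Set (Fin n)) (d : Fin n → ℚ) : Prop where
  circuit : IsCircuitMultiple I.A (toReal d)
  supp : ∀ j, d j ≠ 0 → j ∈ S
  obj : I.objQ d = 0 → ∀ z : Fin n → ℝ, mulR I.A z = 0 → (∀ j, z j ≠ 0 → j ∈ S) → I.obj z = 0
  den : HasDenominator (detBound I.A) d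

theorem LP.IsDirection.inKer {I : LP m n} {S : Set (Fin n)} {d : Fin n → ℚ}
    (h : I.IsDirection S d) : InKer I.A d := inKer_iff.2 h.circuit.mulR_eq_zero

theorem LP.IsDirection.ne_zero {I : LP m n} {S : Set (Fin n)} {d : Fin n → ℚ}
    (h : I.IsDirection S d) : ∃ j, d j ≠ 0 := by
  obtain ⟨j, hj⟩ := h.circuit.ne_zero
  exact ⟨j, by simpa [toReal] using hj⟩

theorem toReal_neg (d : Fin n → ℚ) : toReal (fun j => -d j) = -toReal d := by
  ext j; simp [toReal]

theorem LP.objQ_neg (I : LP m n) (d : Fin n → ℚ) : I.objQ (fun j => -d j) = -I.objQ d := by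
  simp [LP.objQ]

theorem LP.IsDirection.neg {I : LP m n} {S : Set (Fin n)} {d : Fin n → ℚ}
    (h : I.IsDirection S d) : I.IsDirection S fun j => -d j where
  circuit := by rw [toReal_neg]; exact h.circuit.neg
  supp := fun j hj => h.supp j (by simpa using hj)
  obj := fun h0 => h.obj (by rw [I.objQ_neg] at h0; simpa using h0)
  den := by
    obtain ⟨D, h0, h1, h2⟩ := h.den
    refine ⟨D, h0, h1, fun j => ?_⟩
    obtain ⟨z, hz, hz'⟩ := h2 j
    exact ⟨-z, by push_cast; rw [← hz]; ring, by simpa using hz'⟩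

/-- The diagonal entries are 0 or 1, so here all columns vanish, while z is fixed by the projection
`V`. -/
theorem IsTableau.eq_zero {A : Matrix (Fin m) (Fin n) ℤ} {S : Set (Fin n)}
    {ρ : Fin n → Option (Fin m)} {V : Matrix (Fin n) (Fin n) ℚ} (h : IsTableau A S m ρ V)
    (hV : ∀ k, ¬ 0 < V k k) {z : Fin n → ℝ} (hz : mulR A z = 0) (hS : ∀ j, z j ≠ 0 → j ∈ S) :
    z = 0 := by
  ext j
  rw [h.proj_eq_self (fun i => congrFun hz i) hS j]
  refine Finset.sum_eq_zero fun k _ => ?_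
  rcases h.diag_eq k with hk | hk
  · exact absurd (by rw [hk]; norm_num) (hV k)
  · rw [hk.2]; simp

/-- Support-minimality comes from `eq_mul_col`. The hypothesis `hobj` is the selection rule: a
column with objective value zero is chosen only if no column has a nonzero one. -/
theorem IsTableau.isDirection {I : LP m n} {S : Set (Fin n)} {ρ : Fin n → Option (Fin m)}
    {V : Matrix (Fin n) (Fin n) ℚ} (h : IsTableau I.A S m ρ V) {k : Fin n} (hk : 0 < V k k)
    (hobj : I.objQ (fun j => V j k) = 0 → ∀ k', 0 < V k' k' → I.objQ (fun j => V j k') = 0) :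
    I.IsDirection S fun j => V j k := by
  obtain ⟨D, hD0, hDB, hD⟩ := h.exists_denominator
  have hDR : (D : ℝ) ≠ 0 := by exact_mod_cast hD0
  have hDQ : (D : ℚ) ≠ 0 := by exact_mod_cast hD0
  refine ⟨?_, fun j hj => h.mem_of_ne_zero hj, ?_, ⟨D, hD0, hDB, fun j => hD j k⟩⟩
  · choose z hz _ using fun j => hD j k
    have hzR : ∀ j, (V j k : ℝ) * D = z j := fun j => by exact_mod_cast hz j
    have hsupp : ∀ j, z j * D ≠ 0 ↔ V j k ≠ 0 := by
      intro j
      have : ((z j * D : ℤ) : ℚ) ≠ 0 ↔ V j k ≠ 0 := by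
        push_cast; rw [← hz j]; simp [hDQ]
      exact_mod_cast this
    -- The integer vector is the column times D² and not D: the sign of D is unknown and the
    -- multiplier must be positive.
    refine ⟨fun j => z j * D, ⟨?_, ?_, ?_⟩, 1 / (D : ℝ) ^ 2, by positivity, ?_⟩
    · intro h0
      exact (hsupp k).2 hk.ne' (congrFun h0 k)
    · ext i
      have h1 : ∑ l, (I.A i l : ℚ) * V l k = 0 := h.ker i i.2 k
      have h2 : ((∑ l, I.A i l * (z l * D) : ℤ) : ℚ) = 0 := by
        push_cast
        rw [← zero_mul ((D : ℚ) * D), ← h1, Finset.sum_mul]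
        refine Finset.sum_congr rfl fun l _ => ?_
        rw [← hz l]; ring
      exact_mod_cast h2
    -- A kernel vector with smaller support would be a nonzero multiple of the column, and so would
    -- have the same support.
    · intro d hd0 hd hss
      have hsub : ∀ j, d j ≠ 0 → V j k ≠ 0 := fun j hj => (hsupp j).1 (hss.1 hj)
      have hmul := h.eq_mul_col (fun i => congrFun hd i) hsub
      have hdk : d k ≠ 0 := by
        intro h0
        exact hd0 (funext fun j => by rw [hmul j, h0]; simp)
      refine hss.2 fun j hj => ?_
      have hVj := (hsupp j).1 hj
      rw [Function.mem_support, hmul j]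
      exact mul_ne_zero hdk (by exact_mod_cast hVj)
    · intro j
      simp only [toReal]
      push_cast
      rw [← hzR j]; field_simp
  -- z is a combination of the columns, and all of them have objective value zero.
  · intro h0 z hz hS
    have hcol : ∀ k', I.objQ (fun j => V j k') = 0 := fun k' => by
      rcases h.diag_eq k' with h1 | h1
      · exact hobj h0 k' (by rw [h1]; norm_num)
      · simp [LP.objQ, h1.2]
    have hcolR : ∀ k', ∑ j, (I.w j : ℝ) * (V j k' : ℝ) = 0 := fun k' => by
      have := hcol k'
      simp only [LP.objQ] at this
      exact_mod_cast this
    have hp := h.proj_eq_self (F := ℝ) (fun i => congrFun hz i) hS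
    calc I.obj z = ∑ j, (I.w j : ℝ) * ∑ k', (V j k' : ℝ) * z k' :=
          Finset.sum_congr rfl fun j _ => by rw [← hp j]
      _ = ∑ k', (∑ j, (I.w j : ℝ) * (V j k' : ℝ)) * z k' := by
          simp only [Finset.mul_sum, Finset.sum_mul]
          rw [Finset.sum_comm]
          exact Finset.sum_congr rfl fun _ _ => Finset.sum_congr rfl fun _ _ => by ring
      _ = 0 := by simp [hcolR]

/-! ### Optimality and vertices -/

/-- The coordinates in which `x` is strictly between its bounds. -/
def LP.free (I : LP m n) (x : Fin n → ℝ) : Set (Fin n) := {j | x j ≠ I.l j ∧ x j ≠ I.u j}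

/-- The objective function is constant on the smallest face containing `x`. -/
def LP.ObjVanishes (I : LP m n) (x : Fin n → ℝ) : Prop :=
  ∀ z : Fin n → ℝ, mulR I.A z = 0 → (∀ j, z j ≠ 0 → j ∈ I.free x) → I.obj z = 0

/-- Let p = V x be the projection of x to the kernel vectors supported in its free coordinates. The
objective does not see p, and x - p solves a linear system with the pivot matrix and an integral
right-hand side, so by Cramer's rule the determinant is a common denominator of x - p. -/
theorem LP.exists_denominator_obj {I : LP m n} {x : Fin n → ℝ} (hx : x ∈ I.feasible)
    (hv : I.ObjVanishes x) :
    ∃ D : ℕ, 1 ≤ D ∧ D ≤ detBound I.A ∧ ∃ a : ℤ, (D : ℝ) * I.obj x = a := by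
  classical
  obtain ⟨ρ, V, h⟩ := IsTableau.exists_tableau I.A (I.free x) m le_rfl
  set E := pivotMatrix I.A ρ with hE
  set p : Fin n → ℝ := fun j => ∑ k, (V j k : ℝ) * x k with hp
  have hker : mulR I.A p = 0 := by
    ext i
    have hk : ∀ k, ∑ l, (I.A i l : ℝ) * (V l k : ℝ) = 0 := fun k => by
      exact_mod_cast h.ker i i.2 k
    simp only [mulR, hp, Finset.mul_sum, Pi.zero_apply]
    rw [Finset.sum_comm]
    refine Finset.sum_eq_zero fun k _ => ?_
    rw [← zero_mul (x k), ← hk k, Finset.sum_mul]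
    exact Finset.sum_congr rfl fun l _ => by ring
  have hpS : ∀ j, p j ≠ 0 → j ∈ I.free x := by
    intro j hj
    by_contra hcon
    refine hj (Finset.sum_eq_zero fun k _ => ?_)
    have : V j k = 0 := by
      by_contra hne
      exact hcon (h.mem_of_ne_zero hne)
    simp [this]
  -- A pivot row yields an entry of b. A unit row reads off x j - p j, which is 0 at a free
  -- coordinate and an integral bound elsewhere.
  have hintegral : ∀ j, ∃ a : ℤ, ∑ l, (E j l : ℝ) * (x l - p l) = a := by
    intro j
    cases hj : ρ j with
    | some i =>
      refine ⟨I.b i, ?_⟩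
      have h1 := hx.1 i
      have h2 := congrFun hker i
      simp only [mulR, Pi.zero_apply] at h1 h2
      simp only [hE, pivotMatrix_of_some hj, mul_sub, Finset.sum_sub_distrib, h1, h2, sub_zero]
    | none =>
      have h1 : ∑ l, (E j l : ℝ) * (x l - p l) = x j - p j := by
        simp [hE, pivotMatrix_of_none hj]
      rw [h1]
      by_cases hjS : j ∈ I.free x
      · have h2 : p j = x j := by
          simp only [hp]
          rw [Finset.sum_eq_single j]
          · rw [h.mul_self j j hj hj hjS]; simp
          · intro k _ hkj
            by_cases hk : ρ k = none ∧ k ∈ I.free x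
            · rw [h.mul_self j k hj hk.1 hk.2, if_neg (Ne.symm hkj)]; simp
            · rw [h.col_eq_zero k hk]; simp
          · simp
        exact ⟨0, by simp [h2]⟩
      · have h2 : p j = 0 := by
          by_contra hne
          exact hjS (hpS j hne)
        rw [h2, sub_zero]
        simp only [LP.free, Set.mem_ofPred_eq, not_and_or, not_not] at hjS
        rcases hjS with h3 | h3
        · exact ⟨_, h3⟩
        · exact ⟨_, h3⟩
  choose g hg using hintegral
  have hdet : ∀ j, (E.det : ℝ) * (x j - p j) = ((E.adjugate.mulVec g j : ℤ) : ℝ) := by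
    intro j
    have h1 : (E.map (Int.castRingHom ℝ)).mulVec (x - p) = fun j => (g j : ℝ) := by
      ext j
      simpa [Matrix.mulVec, dotProduct] using hg j
    have h2 : (E.map (Int.castRingHom ℝ)).adjugate.mulVec
        ((E.map (Int.castRingHom ℝ)).mulVec (x - p)) =
        (E.map (Int.castRingHom ℝ)).det • (x - p) := by
      rw [Matrix.mulVec_mulVec, Matrix.adjugate_mul, Matrix.smul_mulVec, Matrix.one_mulVec]
    rw [h1, ← RingHom.mapMatrix_apply, ← RingHom.map_det, ← RingHom.map_adjugate] at h2
    have h3 := congrFun h2 j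
    simp only [Matrix.mulVec, dotProduct, RingHom.mapMatrix_apply, Matrix.map_apply,
      Pi.smul_apply, Pi.sub_apply, smul_eq_mul, eq_intCast] at h3
    rw [← h3]
    simp [Matrix.mulVec, dotProduct]
  have hobj : I.obj x = ∑ j, (I.w j : ℝ) * (x j - p j) := by
    have := hv p hker hpS
    rw [← sub_zero (I.obj x), ← this, ← I.obj_sub]; rfl
  -- The sign of the determinant goes into the numerator.
  refine ⟨E.det.natAbs, Int.natAbs_pos.2 h.det_ne, det_pivotMatrix_le h.inj,
    E.det.sign * ∑ j, I.w j * E.adjugate.mulVec g j, ?_⟩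
  have habs : ((E.det.natAbs : ℕ) : ℝ) = (E.det.sign : ℝ) * (E.det : ℝ) := by
    rw [← Int.cast_mul, Int.sign_mul_self_eq_abs, Int.abs_eq_natAbs]; simp
  rw [habs, hobj]
  push_cast
  rw [mul_assoc]
  congr 1
  rw [Finset.mul_sum]
  refine Finset.sum_congr rfl fun j _ => ?_
  have := hdet j
  push_cast at this
  rw [← this]; ring

/-- From x one can move a little in direction z and in direction -z, and neither may increase the
objective. -/
theorem LP.IsOptimal.objVanishes {I : LP m n} {x : Fin n → ℝ} (hx : I.IsOptimal x) :
    I.ObjVanishes x := by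
  intro z hz hS
  have hev : ∀ᶠ ε in nhds (0 : ℝ), ∀ j, (I.l j : ℝ) ≤ x j + ε * z j ∧ x j + ε * z j ≤ I.u j := by
    rw [Filter.eventually_all]
    intro j
    by_cases hj : z j = 0
    · simpa [hj] using hx.1.2 j
    · have hf := hS j hj
      have hb := hx.1.2 j
      have h1 : (I.l j : ℝ) < x j := lt_of_le_of_ne hb.1 (Ne.symm hf.1)
      have h2 : x j < (I.u j : ℝ) := lt_of_le_of_ne hb.2 hf.2
      have hc : Filter.Tendsto (fun ε : ℝ => x j + ε * z j) (nhds 0) (nhds (x j)) := by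
        have : Continuous fun ε : ℝ => x j + ε * z j := by fun_prop
        simpa using this.tendsto 0
      filter_upwards [hc.eventually (eventually_gt_nhds h1),
        hc.eventually (eventually_lt_nhds h2)] with ε e1 e2
      exact ⟨e1.le, e2.le⟩
  obtain ⟨δ, hδ, hball⟩ := Metric.eventually_nhds_iff.1 hev
  have hfeas : ∀ ε : ℝ, |ε| < δ → x + ε • z ∈ I.feasible := by
    intro ε hε
    refine ⟨fun i => ?_, fun j => ?_⟩
    · rw [mulR_add, mulR_smul, hz]
      simpa using hx.1.1 i
    · simpa using hball (y := ε) (by simpa using hε) j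
  have key : ∀ ε : ℝ, |ε| < δ → ε * I.obj z ≤ 0 := by
    intro ε hε
    have := hx.2 _ (hfeas ε hε)
    rw [I.obj_add, I.obj_smul] at this
    linarith
  have h1 := key (δ / 2) (by rw [abs_of_pos (by positivity)]; linarith)
  have h2 := key (-(δ / 2)) (by rw [abs_neg, abs_of_pos (by positivity)]; linarith)
  nlinarith

/-- Both objective values are fractions with denominators at most `detBound I.A`, so a positive gap
would be at least the inverse square of this bound. -/
theorem LP.isOptimal_of_gap_lt {I : LP m n} {x xhat : Fin n → ℝ} (hx : x ∈ I.feasible)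
    (hv : I.ObjVanishes x) (hhat : I.IsOptimal xhat)
    (hgap : (I.obj xhat - I.obj x) * (detBound I.A : ℝ) ^ 2 < 1) : I.IsOptimal x := by
  refine ⟨hx, fun y hy => (hhat.2 y hy).trans ?_⟩
  obtain ⟨D, hD1, hDB, a, ha⟩ := I.exists_denominator_obj hx hv
  obtain ⟨D', hD1', hDB', a', ha'⟩ := I.exists_denominator_obj hhat.1 hhat.objVanishes
  by_contra hlt
  push Not at hlt
  have hintegral : ((D * D' : ℕ) : ℝ) * (I.obj xhat - I.obj x) = ((D * a' - D' * a : ℤ) : ℝ) := by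
    push_cast; rw [← ha, ← ha']; ring
  have hDR : (1 : ℝ) ≤ ((D * D' : ℕ) : ℝ) := by exact_mod_cast Nat.mul_le_mul hD1 hD1'
  have hpos : (0 : ℝ) < ((D * a' - D' * a : ℤ) : ℝ) := by
    rw [← hintegral]; exact mul_pos (by linarith) (by linarith)
  have hone : (1 : ℝ) ≤ ((D * a' - D' * a : ℤ) : ℝ) := by
    have : (0 : ℤ) < D * a' - D' * a := by exact_mod_cast hpos
    exact_mod_cast this
  have hB : ((D * D' : ℕ) : ℝ) ≤ (detBound I.A : ℝ) ^ 2 := by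
    rw [sq]; exact_mod_cast Nat.mul_le_mul hDB hDB'
  have : ((D * D' : ℕ) : ℝ) * (I.obj xhat - I.obj x) ≤
      (I.obj xhat - I.obj x) * (detBound I.A : ℝ) ^ 2 := by
    rw [mul_comm]; exact mul_le_mul_of_nonneg_left hB (by linarith)
  linarith

/-- The endpoints of a segment through x share with x every coordinate that is at a bound, so their
difference is a kernel vector supported in the free coordinates. -/
theorem LP.isVertex_of_ker {I : LP m n} {x : Fin n → ℝ} (hx : x ∈ I.feasible)
    (hker : ∀ z : Fin n → ℝ, mulR I.A z = 0 → (∀ j, z j ≠ 0 → j ∈ I.free x) → z = 0) :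
    I.IsVertex x := by
  rw [LP.IsVertex, mem_extremePoints]
  refine ⟨hx, fun x₁ h₁ x₂ h₂ hseg => ?_⟩
  obtain ⟨a, b, ha, hb, hab, rfl⟩ := hseg
  have hz : x₁ - x₂ = 0 := by
    refine hker _ ?_ ?_
    · ext i
      rw [mulR_sub]
      simp [h₁.1 i, h₂.1 i]
    · intro j hj
      have hj' : x₁ j ≠ x₂ j := fun h => hj (by simp [h])
      have b₁ := h₁.2 j
      have b₂ := h₂.2 j
      refine ⟨fun hl => hj' ?_, fun hu => hj' ?_⟩
      · simp only [Pi.add_apply, Pi.smul_apply, smul_eq_mul] at hl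
        have e1 : x₁ j = I.l j := by
          refine le_antisymm ?_ b₁.1
          by_contra hlt
          push Not at hlt
          have := mul_lt_mul_of_pos_left hlt ha
          have := mul_le_mul_of_nonneg_left b₂.1 hb.le
          have : (a + b) * (I.l j : ℝ) < I.l j := by linarith
          rw [hab] at this; linarith
        have e2 : x₂ j = I.l j := by
          refine le_antisymm ?_ b₂.1
          by_contra hlt
          push Not at hlt
          have := mul_lt_mul_of_pos_left hlt hb
          have := mul_le_mul_of_nonneg_left b₁.1 ha.le
          have : (a + b) * (I.l j : ℝ) < I.l j := by linarith
          rw [hab] at this; linarith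
        rw [e1, e2]
      · simp only [Pi.add_apply, Pi.smul_apply, smul_eq_mul] at hu
        have e1 : x₁ j = I.u j := by
          refine le_antisymm b₁.2 ?_
          by_contra hlt
          push Not at hlt
          have := mul_lt_mul_of_pos_left hlt ha
          have := mul_le_mul_of_nonneg_left b₂.2 hb.le
          have : (I.u j : ℝ) < (a + b) * (I.u j : ℝ) := by linarith
          rw [hab] at this; linarith
        have e2 : x₂ j = I.u j := by
          refine le_antisymm b₂.2 ?_
          by_contra hlt
          push Not at hlt
          have := mul_lt_mul_of_pos_left hlt hb
          have := mul_le_mul_of_nonneg_left b₁.2 ha.le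
          have : (I.u j : ℝ) < (a + b) * (I.u j : ℝ) := by linarith
          rw [hab] at this; linarith
        rw [e1, e2]
  have h12 : x₁ = x₂ := sub_eq_zero.1 hz
  subst h12
  have : a • x₁ + b • x₁ = x₁ := by rw [← add_smul, hab, one_smul]
  rw [this]; exact ⟨rfl, rfl⟩

end LinearProgram

section Steps

variable {m n : ℕ}

/-! ### Maximal steps -/

/-- Moving from `z` in direction `d`, the step length `a` is the first one at which a coordinate
reaches its target. -/
structure IsFirstHit (z t d : Fin n → ℚ) (a : ℚ) : Prop where
  hit : ∃ i, 0 < (t i - z i) * d i ∧ a = (t i - z i) / d i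
  le : ∀ j, 0 < (t j - z j) * d j → a ≤ (t j - z j) / d j

theorem IsFirstHit.pos {z t d : Fin n → ℚ} {a : ℚ} (h : IsFirstHit z t d a) : 0 < a := by
  obtain ⟨i, hi, rfl⟩ := h.hit
  rcases pos_and_pos_or_neg_and_neg_of_mul_pos hi with h | h
  · exact div_pos h.1 h.2
  · exact div_pos_of_neg_of_neg h.1 h.2

/-- The bound that limits a step in direction `d`. -/
def LP.target (I : LP m n) (d : Fin n → ℚ) (j : Fin n) : ℚ := if 0 < d j then I.u j else I.l j

theorem LP.toReal_mem_feasible {I : LP m n} {x : Fin n → ℚ} : toReal x ∈ I.feasible ↔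
    (∀ i, ∑ l, (I.A i l : ℚ) * x l = I.b i) ∧ ∀ j, (I.l j : ℚ) ≤ x j ∧ x j ≤ I.u j := by
  simp only [LP.feasible, mulR, toReal, Set.mem_ofPred_eq]
  refine and_congr (forall_congr' fun i => ?_) (forall_congr' fun j => ?_)
  · exact_mod_cast Iff.rfl
  · exact_mod_cast Iff.rfl

theorem toReal_add_smul (x d : Fin n → ℚ) (a : ℚ) :
    toReal (fun j => x j + a * d j) = toReal x + (a : ℝ) • toReal d := by
  ext j; simp [toReal]

/-- By `hin` every moving coordinate has room towards its bound. Stopping at the first bound reached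
keeps all coordinates in range, and the coordinate that reaches it forbids a longer step. -/
theorem LP.isCircuitStep_of_isFirstHit {I : LP m n} {x d : Fin n → ℚ} {a : ℚ}
    (hx : toReal x ∈ I.feasible) (hd : IsCircuitMultiple I.A (toReal d))
    (hin : ∀ j, d j ≠ 0 → 0 < (I.target d j - x j) * d j) (ha : IsFirstHit x (I.target d) d a) :
    I.IsCircuitStep (toReal x) (toReal fun j => x j + a * d j) := by
  have hapos := ha.pos
  have hxQ := LP.toReal_mem_feasible.1 hx
  have hker : InKer I.A d := inKer_iff.2 hd.mulR_eq_zero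
  have hsub : toReal (fun j => x j + a * d j) - toReal x = (a : ℝ) • toReal d := by
    rw [toReal_add_smul]; simp
  refine ⟨hx, LP.toReal_mem_feasible.2 ⟨fun i => ?_, fun j => ?_⟩, ?_, ?_⟩
  · have h : ∑ l, (I.A i l : ℚ) * (x l + a * d l) =
        (∑ l, (I.A i l : ℚ) * x l) + a * ∑ l, (I.A i l : ℚ) * d l := by
      rw [Finset.mul_sum, ← Finset.sum_add_distrib]
      exact Finset.sum_congr rfl fun j _ => by ring
    rw [h, hker i, hxQ.1 i]; simp
  · have hb := hxQ.2 j
    rcases lt_trichotomy (d j) 0 with hneg | hzero | hpos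
    · have h1 := hin j hneg.ne
      have h2 := ha.le j h1
      rw [LP.target, if_neg hneg.le.not_gt, le_div_iff_of_neg hneg] at h2
      have := mul_neg_of_pos_of_neg hapos hneg
      constructor <;> linarith
    · simpa [hzero] using hb
    · have h1 := hin j hpos.ne'
      have h2 := ha.le j h1
      rw [LP.target, if_pos hpos, le_div_iff₀ hpos] at h2
      have := mul_pos hapos hpos
      constructor <;> linarith
  · rw [hsub]; exact hd.smul (by exact_mod_cast hapos)
  · intro α hα hmem
    rw [hsub] at hmem
    obtain ⟨i, hi, hai⟩ := ha.hit
    have hdi : d i ≠ 0 := fun h => by simp [h] at hi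
    have hb := hmem.2 i
    have hmul : a * d i = I.target d i - x i := by rw [hai]; field_simp
    have hmulR : (a : ℝ) * (d i : ℝ) = ((I.target d i : ℚ) : ℝ) - x i := by exact_mod_cast hmul
    simp only [Pi.add_apply, Pi.smul_apply, smul_eq_mul, toReal, hmulR] at hb
    rcases lt_or_gt_of_ne hdi with hneg | hpos
    · rw [LP.target, if_neg hneg.le.not_gt] at hmul hb
      have h1 : (a : ℝ) * d i < 0 := by exact_mod_cast mul_neg_of_pos_of_neg hapos hneg
      rw [hmulR, LP.target, if_neg hneg.le.not_gt] at h1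
      push_cast at h1 hb
      nlinarith
    · rw [LP.target, if_pos hpos] at hmul hb
      have h1 : (0 : ℝ) < (a : ℝ) * d i := by exact_mod_cast mul_pos hapos hpos
      rw [hmulR, LP.target, if_pos hpos] at h1
      push_cast at h1 hb
      nlinarith

theorem LP.target_sub_mul_pos_of_free {I : LP m n} {x d : Fin n → ℚ} (hx : toReal x ∈ I.feasible)
    (hd : ∀ j, d j ≠ 0 → j ∈ I.free (toReal x)) (j : Fin n) (hj : d j ≠ 0) :
    0 < (I.target d j - x j) * d j := by
  have hb := (LP.toReal_mem_feasible.1 hx).2 j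
  have hf := hd j hj
  have h1 : x j ≠ I.l j := fun h => hf.1 (by simp [toReal, h])
  have h2 : x j ≠ I.u j := fun h => hf.2 (by simp [toReal, h])
  rcases lt_or_gt_of_ne hj with hneg | hpos
  · rw [LP.target, if_neg hneg.le.not_gt]
    exact mul_pos_of_neg_of_neg (sub_neg.2 (lt_of_le_of_ne hb.1 (Ne.symm h1))) hneg
  · rw [LP.target, if_pos hpos]
    exact mul_pos (sub_pos.2 (lt_of_le_of_ne hb.2 h2)) hpos

/-- Coordinates at a bound do not move, and the hit coordinate stops at a bound. -/
theorem LP.free_ssubset {I : LP m n} {x d : Fin n → ℚ} {a : ℚ}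
    (hd : ∀ j, d j ≠ 0 → j ∈ I.free (toReal x)) (ha : IsFirstHit x (I.target d) d a) :
    I.free (toReal fun j => x j + a * d j) ⊂ I.free (toReal x) := by
  constructor
  · intro j hj
    by_contra hcon
    have h0 : d j = 0 := by
      by_contra hne
      exact hcon (hd j hne)
    refine hcon ?_
    simpa [LP.free, toReal, h0] using hj
  · intro hsub
    obtain ⟨i, hi, hai⟩ := ha.hit
    have hdi : d i ≠ 0 := fun h => by simp [h] at hi
    have hmul : x i + a * d i = I.target d i := by rw [hai]; field_simp; ring
    have h1 := hsub (hd i hdi)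
    simp only [LP.free, toReal, Set.mem_ofPred_eq, hmul, LP.target] at h1
    split_ifs at h1 <;> simp at h1

theorem LP.minFace_ssubset {I : LP m n} {x d : Fin n → ℚ} {a : ℚ} (hx : toReal x ∈ I.feasible)
    (hd : ∀ j, d j ≠ 0 → j ∈ I.free (toReal x)) (ha : IsFirstHit x (I.target d) d a) :
    I.minFace (toReal fun j => x j + a * d j) ⊂ I.minFace (toReal x) := by
  have hfix : ∀ j, j ∉ I.free (toReal x) → d j = 0 := fun j hj => by
    by_contra hne
    exact hj (hd j hne)
  constructor
  · intro y hy
    refine ⟨hy.1, fun j => ⟨fun h => (hy.2 j).1 ?_, fun h => (hy.2 j).2 ?_⟩⟩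
    · have := hfix j fun hf => hf.1 h
      simpa [toReal, this] using h
    · have := hfix j fun hf => hf.2 h
      simpa [toReal, this] using h
  · intro hsub
    obtain ⟨i, hi, hai⟩ := ha.hit
    have hdi : d i ≠ 0 := fun h => by simp [h] at hi
    have hmul : x i + a * d i = I.target d i := by rw [hai]; field_simp; ring
    have h1 := hsub (show toReal x ∈ I.minFace (toReal x) from ⟨hx, fun j => ⟨id, id⟩⟩)
    have hf := hd i hdi
    by_cases hp : 0 < d i
    · refine hf.2 ((h1.2 i).2 ?_)
      simp [toReal, hmul, LP.target, hp]
    · refine hf.1 ((h1.2 i).1 ?_)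
      simp [toReal, hmul, LP.target, hp]

/-! ### Conformal circuits -/

/-- `∑ vⱼ / hⱼ`. -/
def ratioSum (h v : Fin n → ℚ) : ℚ := ∑ j, v j / h j

theorem ratioSum_add_smul (h x d : Fin n → ℚ) (a : ℚ) :
    ratioSum h (fun j => x j + a * d j) = ratioSum h x + a * ratioSum h d := by
  simp only [ratioSum, Finset.mul_sum, ← Finset.sum_add_distrib]
  exact Finset.sum_congr rfl fun j _ => by ring

/-- A nonzero kernel vector in the orthant of `h` whose objective value, relative to `ratioSum h`,
is at least that of `h`. -/
structure LP.IsConformalPart (I : LP m n) (h y : Fin n → ℚ) : Prop where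
  inKer : InKer I.A y
  sign : ∀ j, 0 ≤ y j * h j
  zero : ∀ j, h j = 0 → y j = 0
  ne : ∃ j, y j ≠ 0
  ratio : I.objQ h * ratioSum h y ≤ I.objQ y * ratioSum h h

theorem div_nonneg_of_mul_nonneg {a b : ℚ} (h : 0 ≤ a * b) : 0 ≤ a / b := by
  rcases eq_or_ne b 0 with rfl | hb
  · simp
  · have : a / b = a * b / b ^ 2 := by field_simp
    rw [this]; positivity

theorem ratioSum_nonneg {h y : Fin n → ℚ} (sign : ∀ j, 0 ≤ y j * h j) : 0 ≤ ratioSum h y :=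
  Finset.sum_nonneg fun j _ => div_nonneg_of_mul_nonneg (sign j)

theorem ratioSum_pos {h y : Fin n → ℚ} (sign : ∀ j, 0 ≤ y j * h j)
    (zero : ∀ j, h j = 0 → y j = 0) (ne : ∃ j, y j ≠ 0) : 0 < ratioSum h y := by
  obtain ⟨j, hj⟩ := ne
  refine Finset.sum_pos' (fun j _ => div_nonneg_of_mul_nonneg (sign j)) ⟨j, Finset.mem_univ _, ?_⟩
  exact lt_of_le_of_ne (div_nonneg_of_mul_nonneg (sign j))
    (div_ne_zero hj fun h0 => hj (zero j h0)).symm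

theorem ratioSum_self_le (h : Fin n → ℚ) : ratioSum h h ≤ n := by
  have : ∑ j : Fin n, h j / h j ≤ ∑ _j : Fin n, (1 : ℚ) :=
    Finset.sum_le_sum fun j _ => div_self_le_one _
  simpa [ratioSum] using this

theorem LP.IsConformalPart.self {I : LP m n} {h : Fin n → ℚ} (hk : InKer I.A h)
    (hne : ∃ j, h j ≠ 0) : I.IsConformalPart h h :=
  ⟨hk, fun _ => mul_self_nonneg _, fun _ => id, hne, le_rfl⟩

/-- The sign of the direction is such that moving along it does not decrease the relative
objective value. -/
def LP.Improves (I : LP m n) (h y d : Fin n → ℚ) : Prop :=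
  0 < I.objQ d * ratioSum h y - I.objQ y * ratioSum h d ∨
    (I.objQ d * ratioSum h y - I.objQ y * ratioSum h d = 0 ∧ 0 ≤ ratioSum h d)

/-- Up to the first zero no sign changes, and the hit coordinate leaves the support. With g =
`ratioSum h`, the quotient wy / g(y) changes along d with the sign of wd g(y) - wy g(d), which
`Improves` makes nonnegative. -/
theorem LP.IsConformalPart.advance {I : LP m n} {h y d : Fin n → ℚ} {a : ℚ}
    (hy : I.IsConformalPart h y) (hd : I.IsDirection {j | y j ≠ 0} d) (himp : I.Improves h y d)
    (ha : IsFirstHit y 0 d a) : I.IsConformalPart h (fun j => y j + a * d j) ∧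
      {j | y j + a * d j ≠ 0} ⊂ {j | y j ≠ 0} := by
  have hapos := ha.pos
  have hgy : 0 < ratioSum h y := ratioSum_pos hy.sign hy.zero hy.ne
  have hsupp : ∀ j, y j = 0 → d j = 0 := fun j hj => by
    by_contra hne
    exact hd.supp j hne hj
  have hyy : ∀ j, 0 ≤ (y j + a * d j) * y j := by
    intro j
    rcases le_or_gt 0 (d j * y j) with hs | hs
    · nlinarith [mul_nonneg hapos.le hs, mul_self_nonneg (y j)]
    · have h1 := ha.le j (by simp only [Pi.zero_apply]; linarith)
      simp only [Pi.zero_apply, zero_sub] at h1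
      rcases lt_trichotomy (d j) 0 with hn | hz | hp
      · rw [le_div_iff_of_neg hn] at h1
        have : 0 < y j := by nlinarith
        nlinarith
      · simp [hz] at hs
      · rw [le_div_iff₀ hp] at h1
        have : y j < 0 := by nlinarith
        nlinarith
  have hsign : ∀ j, 0 ≤ (y j + a * d j) * h j := by
    intro j
    rcases eq_or_ne (y j) 0 with h0 | h0
    · simp [h0, hsupp j h0]
    · have h1 := hyy j
      have h2 := hy.sign j
      rcases lt_or_gt_of_ne h0 with hn | hp
      · exact mul_nonneg_of_nonpos_of_nonpos (by nlinarith) (by nlinarith)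
      · exact mul_nonneg (by nlinarith) (by nlinarith)
  have hg' := ratioSum_nonneg hsign
  refine ⟨⟨hy.inKer.add_smul hd.inKer a, hsign, ?_, ?_, ?_⟩, ?_, ?_⟩
  · intro j hj
    have := hy.zero j hj
    simp [this, hsupp j this]
  -- If y + a d were zero, d would be a negative multiple of y. Then the determinant in `Improves`
  -- would vanish and `ratioSum h d` would be negative; the tie rule is there to exclude this.
  · by_contra hcon
    push Not at hcon
    have e1 : ratioSum h y + a * ratioSum h d = 0 := by
      rw [← ratioSum_add_smul]; simp [ratioSum, hcon]
    have e2 : I.objQ y + a * I.objQ d = 0 := by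
      rw [← I.objQ_add_smul]; simp [LP.objQ, hcon]
    have e1' : ratioSum h y = -(a * ratioSum h d) := by linarith
    have e2' : I.objQ y = -(a * I.objQ d) := by linarith
    rcases himp with h1 | ⟨-, h1⟩
    · rw [e1', e2'] at h1
      ring_nf at h1
      exact lt_irrefl _ h1
    · nlinarith [mul_nonneg hapos.le h1]
  · rw [ratioSum_add_smul] at hg'
    rw [ratioSum_add_smul, I.objQ_add_smul]
    have hV : 0 ≤ I.objQ d * ratioSum h y - I.objQ y * ratioSum h d := by
      rcases himp with h1 | h1
      · exact h1.le
      · exact h1.1.ge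
    have hgh := ratioSum_nonneg (h := h) (y := h) fun j => mul_self_nonneg _
    -- The quotients for h, y and y + a d are compared after cross-multiplication, and the positive
    -- number g(y) is cancelled at the end.
    have e1 : I.objQ y * (ratioSum h y + a * ratioSum h d) ≤
        (I.objQ y + a * I.objQ d) * ratioSum h y := by
      nlinarith [mul_nonneg hapos.le hV]
    have e2 := mul_le_mul_of_nonneg_right e1 hgh
    have e3 := mul_le_mul_of_nonneg_right hy.ratio hg'
    refine le_of_mul_le_mul_right (a := ratioSum h y) ?_ hgy
    nlinarith
  · intro j hj h0
    exact hj (by simp [h0, hsupp j h0])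
  · intro hsub
    obtain ⟨i, hi, hai⟩ := ha.hit
    have hdi : d i ≠ 0 := fun h => by simp [h] at hi
    have := hsub (hd.supp i hdi)
    refine this ?_
    rw [hai]; simp only [Pi.zero_apply]; field_simp; ring

/-- A direction in the orthant of `h`, and a scaling that makes it conformal, with a
sufficiently large objective value. -/
structure LP.IsGoodDirection (I : LP m n) (h d : Fin n → ℚ) (g : ℚ) : Prop where
  pos : 0 < g
  sign : ∀ j, 0 ≤ d j * h j
  abs_le : ∀ j, |d j| ≤ g * |h j|
  obj : I.objQ h * g ≤ n * I.objQ d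

/-- By `hun` no coordinate of d opposes y, so d lies in the orthant of h and all terms of g(d) are
nonnegative. Each of them is thus at most g(d), which makes d / g(d) conformal. Its objective value
is at least wy / g(y) ≥ wh / g(h). -/
theorem LP.IsConformalPart.isGoodDirection {I : LP m n} {h y d : Fin n → ℚ}
    (hy : I.IsConformalPart h y) (hd : I.IsDirection {j | y j ≠ 0} d) (himp : I.Improves h y d)
    (hun : ∀ j, ¬ 0 < ((0 : Fin n → ℚ) j - y j) * d j) (hh : 0 < I.objQ h) :
    I.IsGoodDirection h d (ratioSum h d) := by
  have hgy : 0 < ratioSum h y := ratioSum_pos hy.sign hy.zero hy.ne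
  have hsign : ∀ j, 0 ≤ d j * h j := by
    intro j
    rcases eq_or_ne (d j) 0 with h0 | h0
    · simp [h0]
    · have h1 := hun j
      have h2 := hy.sign j
      have h3 : y j ≠ 0 := hd.supp j h0
      simp only [Pi.zero_apply, zero_sub, not_lt] at h1
      rcases lt_or_gt_of_ne h3 with hn | hp
      · exact mul_nonneg_of_nonpos_of_nonpos (by nlinarith) (by nlinarith)
      · exact mul_nonneg (by nlinarith) (by nlinarith)
  have hzero : ∀ j, h j = 0 → d j = 0 := fun j hj => by
    by_contra hne
    exact hd.supp j hne (hy.zero j hj)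
  have hgd : 0 < ratioSum h d := ratioSum_pos hsign hzero hd.ne_zero
  refine ⟨hgd, hsign, fun j => ?_, ?_⟩
  · rcases eq_or_ne (h j) 0 with h0 | h0
    · simp [hzero j h0, h0]
    · have h1 : d j / h j ≤ ratioSum h d :=
        Finset.single_le_sum (f := fun j => d j / h j)
          (fun j _ => div_nonneg_of_mul_nonneg (hsign j)) (Finset.mem_univ j)
      have h2 := div_nonneg_of_mul_nonneg (hsign j)
      rw [← div_le_iff₀ (abs_pos.2 h0), ← abs_div, abs_of_nonneg h2]
      exact h1
  · have hV : 0 ≤ I.objQ d * ratioSum h y - I.objQ y * ratioSum h d := by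
      rcases himp with h1 | h1
      · exact h1.le
      · exact h1.1.ge
    have hhne : ∃ j, h j ≠ 0 := by
      obtain ⟨j, hj⟩ := hy.ne
      exact ⟨j, fun h0 => hj (hy.zero j h0)⟩
    have hgh : 0 < ratioSum h h := ratioSum_pos (fun j => mul_self_nonneg _) (fun _ => id) hhne
    have e1 : I.objQ h * ratioSum h d ≤ I.objQ d * ratioSum h h := by
      refine le_of_mul_le_mul_right (a := ratioSum h y) ?_ hgy
      nlinarith [mul_le_mul_of_nonneg_right hy.ratio hgd.le, mul_nonneg hV hgh.le]
    -- The sign is needed to replace g(h) by its upper bound n.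
    have hdpos : 0 < I.objQ d := by
      by_contra hcon
      push Not at hcon
      nlinarith [mul_pos hh hgd, mul_nonneg_of_nonpos_of_nonpos hcon (neg_nonpos.2 hgh.le)]
    have := ratioSum_self_le h
    nlinarith

/-- Where d moves, x̂ lies strictly on that side of x, and x̂ respects the bound. -/
theorem LP.IsGoodDirection.target_sub_mul_pos {I : LP m n} {x xhat d : Fin n → ℚ} {g : ℚ}
    (hd : I.IsGoodDirection (fun j => xhat j - x j) d g) (hhat : toReal xhat ∈ I.feasible)
    (j : Fin n) (hj : d j ≠ 0) : 0 < (I.target d j - x j) * d j := by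
  have hb := (LP.toReal_mem_feasible.1 hhat).2 j
  have h1 := hd.abs_le j
  have h2 := hd.sign j
  have hne : xhat j - x j ≠ 0 := fun h0 => by
    rw [h0] at h1; simp at h1; exact hj h1
  rcases lt_or_gt_of_ne hj with hneg | hpos
  · rw [LP.target, if_neg hneg.le.not_gt]
    have : xhat j - x j < 0 := lt_of_le_of_ne (by nlinarith) hne
    exact mul_pos_of_neg_of_neg (by linarith) hneg
  · rw [LP.target, if_pos hpos]
    have : 0 < xhat j - x j := lt_of_le_of_ne (by nlinarith) hne.symm
    exact mul_pos (by linarith) hpos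

/-- At the coordinate that limits the step the bound lies at or beyond x̂, while d / g leads at most
to x̂. -/
theorem LP.IsGoodDirection.one_le {I : LP m n} {x xhat d : Fin n → ℚ} {g a : ℚ}
    (hd : I.IsGoodDirection (fun j => xhat j - x j) d g) (hhat : toReal xhat ∈ I.feasible)
    (ha : IsFirstHit x (I.target d) d a) : 1 ≤ a * g := by
  obtain ⟨i, hi, hai⟩ := ha.hit
  have hdi : d i ≠ 0 := fun h => by simp [h] at hi
  have hb := (LP.toReal_mem_feasible.1 hhat).2 i
  have h1 := hd.abs_le i
  have h2 := hd.sign i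
  have hg := hd.pos
  have hmul : a * d i = I.target d i - x i := by rw [hai]; field_simp
  rcases lt_or_gt_of_ne hdi with hneg | hpos
  · rw [LP.target, if_neg hneg.le.not_gt] at hmul
    have h3 : xhat i - x i ≤ 0 := by nlinarith
    rw [abs_of_neg hneg, abs_of_nonpos h3] at h1
    have h4 : -d i ≤ (a * g) * (-d i) := by nlinarith
    nlinarith
  · rw [LP.target, if_pos hpos] at hmul
    have h3 : 0 ≤ xhat i - x i := by nlinarith
    rw [abs_of_pos hpos, abs_of_nonneg h3] at h1
    have h4 : d i ≤ (a * g) * d i := by nlinarith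
    nlinarith

/-- The gain is (a g) times the objective value of d / g, with a g ≥ 1 and the latter at least 1/n
of the gap. -/
theorem LP.IsGoodDirection.progress {I : LP m n} {x xhat d : Fin n → ℚ} {g a : ℚ}
    (hd : I.IsGoodDirection (fun j => xhat j - x j) d g) (hhat : toReal xhat ∈ I.feasible)
    (hn : 0 < n) (hgap : 0 < I.objQ xhat - I.objQ x)
    (ha : IsFirstHit x (I.target d) d a) :
    (I.objQ xhat - I.objQ x) / n ≤ a * I.objQ d := by
  have h1 := hd.obj
  have h2 := hd.one_le hhat ha
  have hg := hd.pos
  have hapos := ha.pos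
  rw [I.objQ_sub] at h1
  have hn' : (0 : ℚ) < n := by exact_mod_cast hn
  rw [div_le_iff₀ hn']
  nlinarith [mul_le_mul_of_nonneg_left h1 hapos.le, mul_le_mul_of_nonneg_right h2 hgap.le]

/-- The conformal vector is d / g, and β = a g. -/
theorem LP.IsGoodDirection.exists_conformal {I : LP m n} {x xhat d : Fin n → ℚ} {g a : ℚ}
    (hd : I.IsGoodDirection (fun j => xhat j - x j) d g) (hhat : toReal xhat ∈ I.feasible)
    (hc : IsCircuitMultiple I.A (toReal d)) (ha : IsFirstHit x (I.target d) d a) :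
    ∃ c : Fin n → ℝ, IsCircuitMultiple I.A c ∧ Conformal c (toReal xhat - toReal x) ∧
      ∃ β : ℝ, 1 ≤ β ∧ toReal (fun j => x j + a * d j) - toReal x = β • c := by
  have hg : (0 : ℝ) < g := by exact_mod_cast hd.pos
  refine ⟨(g : ℝ)⁻¹ • toReal d, hc.smul (inv_pos.2 hg), fun j => ?_, (a : ℝ) * g, ?_, ?_⟩
  · have h1 : (0 : ℝ) ≤ (d j : ℝ) * (xhat j - x j) := by exact_mod_cast hd.sign j
    have h2 : |(d j : ℝ)| ≤ g * |(xhat j : ℝ) - x j| := by exact_mod_cast hd.abs_le j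
    simp only [Pi.smul_apply, Pi.sub_apply, smul_eq_mul, toReal]
    constructor
    · rw [mul_assoc]; exact mul_nonneg (inv_nonneg.2 hg.le) h1
    · rw [abs_mul, abs_of_pos (inv_pos.2 hg), inv_mul_le_iff₀ hg]; exact h2
  · exact_mod_cast hd.one_le hhat ha
  · rw [toReal_add_smul, smul_smul, mul_assoc, mul_inv_cancel₀ hg.ne']; simp

/-! ### Common denominators -/

theorem HasDenominator.mono {B B' : ℕ} {x : Fin n → ℚ} (h : HasDenominator B x) (hB : B ≤ B') :
    HasDenominator B' x := by
  obtain ⟨D, h0, h1, h2⟩ := h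
  refine ⟨D, h0, h1.trans hB, fun j => ?_⟩
  obtain ⟨z, hz, hz'⟩ := h2 j
  exact ⟨z, hz, hz'.trans hB⟩

theorem HasDenominator.fitsBits {k : ℕ} {x : Fin n → ℚ} (h : HasDenominator (2 ^ k) x)
    (j : Fin n) : FitsBits k (x j) := by
  obtain ⟨D, h0, h1, h2⟩ := h
  obtain ⟨z, hz, hz'⟩ := h2 j
  exact fitsBits_of_mul_eq h0 hz hz' h1

theorem HasDenominator.sub {k l : ℕ} {x y : Fin n → ℚ} (hx : HasDenominator (2 ^ k) x)
    (hy : HasDenominator (2 ^ l) y) :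
    HasDenominator (2 ^ (k + l + 1)) fun j => x j - y j := by
  obtain ⟨D, h0, h1, h2⟩ := hx
  obtain ⟨D', h0', h1', h2'⟩ := hy
  have hp : 2 ^ (k + l + 1) = 2 ^ k * 2 ^ l + 2 ^ k * 2 ^ l := by ring
  refine ⟨D * D', mul_ne_zero h0 h0', ?_, fun j => ?_⟩
  · rw [Int.natAbs_mul]
    have := Nat.mul_le_mul h1 h1'
    omega
  · obtain ⟨z, hz, hzb⟩ := h2 j
    obtain ⟨z', hz', hzb'⟩ := h2' j
    refine ⟨z * D' - z' * D, by push_cast; rw [← hz, ← hz']; ring, ?_⟩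
    refine (Int.natAbs_sub_le _ _).trans ?_
    rw [Int.natAbs_mul, Int.natAbs_mul]
    have := Nat.mul_le_mul hzb h1'
    have := Nat.mul_le_mul h1 hzb'
    rw [mul_comm] at this
    omega

/-- With a = (tᵢ - zᵢ) / dᵢ at the hit i, the denominator of d cancels in a d: the denominator of z
times the numerator of dᵢ is a common denominator of the new point. The bits added depend on d and t
only, so they grow linearly along a sequence of moves. -/
theorem HasDenominator.move {k L : ℕ} {z t d : Fin n → ℚ} {a : ℚ}
    (hz : HasDenominator (2 ^ k) z) (hd : HasDenominator (2 ^ L) d)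
    (ht : ∀ j, ∃ v : ℤ, t j = v ∧ v.natAbs ≤ 2 ^ L) (ha : IsFirstHit z t d a) :
    HasDenominator (2 ^ (k + 2 * L + 2)) fun j => z j + a * d j := by
  obtain ⟨i, hi, hai⟩ := ha.hit
  have hdi : d i ≠ 0 := fun h => by simp [h] at hi
  obtain ⟨D, h0, h1, h2⟩ := hz
  obtain ⟨D', h0', h1', h2'⟩ := hd
  obtain ⟨v, hv, hvb⟩ := ht i
  obtain ⟨Zi, hZi, hZib⟩ := h2 i
  obtain ⟨Ci, hCi, hCib⟩ := h2' i
  have hDQ : (D' : ℚ) ≠ 0 := by exact_mod_cast h0'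
  have hCi0 : Ci ≠ 0 := by
    have : (Ci : ℚ) ≠ 0 := by rw [← hCi]; exact mul_ne_zero hdi hDQ
    exact_mod_cast this
  have hL : 1 ≤ 2 ^ L := Nat.one_le_two_pow
  have hp : 2 ^ (k + 2 * L + 2) = 4 * (2 ^ k * 2 ^ L * 2 ^ L) := by ring
  have hp1 : 2 ^ k * 2 ^ L ≤ 2 ^ k * 2 ^ L * 2 ^ L := Nat.le_mul_of_pos_right _ (by positivity)
  refine ⟨D * Ci, mul_ne_zero h0 hCi0, ?_, fun j => ?_⟩
  · rw [Int.natAbs_mul]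
    have := Nat.mul_le_mul h1 hCib
    omega
  · obtain ⟨Zj, hZj, hZjb⟩ := h2 j
    obtain ⟨Cj, hCj, hCjb⟩ := h2' j
    refine ⟨Zj * Ci + (v * D - Zi) * Cj, ?_, ?_⟩
    · push_cast
      rw [← hZj, ← hCi, ← hCj, ← hZi, ← hv, hai]
      field_simp
    · refine (Int.natAbs_add_le _ _).trans ?_
      rw [Int.natAbs_mul, Int.natAbs_mul]
      have e1 := Nat.mul_le_mul hZjb hCib
      have e2 := Int.natAbs_sub_le (v * D) Zi
      rw [Int.natAbs_mul] at e2
      have e3 := Nat.mul_le_mul hvb h1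
      have e5 : 2 ^ k ≤ 2 ^ L * 2 ^ k := Nat.le_mul_of_pos_left _ (by positivity)
      have e4 : (v * D - Zi).natAbs ≤ 2 * (2 ^ L * 2 ^ k) := by omega
      have e6 := Nat.mul_le_mul e4 hCjb
      have e7 : 2 * (2 ^ L * 2 ^ k) * 2 ^ L = 2 * (2 ^ k * 2 ^ L * 2 ^ L) := by ring
      omega

/-- The product of the denominators serves for all entries; the factor 2 covers a numerator times
the cofactor of its denominator. -/
theorem hasDenominator_of_vecSize (x : Fin n → ℚ) : HasDenominator (2 ^ (2 * vecSize x)) x := by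
  have hden : ∏ j, (x j).den ≤ 2 ^ vecSize x := by
    unfold vecSize
    rw [← Finset.prod_pow_eq_pow_sum]
    exact Finset.prod_le_prod' fun j _ => (fitsBits_of_ratSize_le le_rfl).2
  have hpow : 2 ^ (2 * vecSize x) = 2 ^ vecSize x * 2 ^ vecSize x := by ring
  have hone : 1 ≤ 2 ^ vecSize x := Nat.one_le_two_pow
  refine ⟨((∏ j, (x j).den : ℕ) : ℤ), ?_, ?_, fun j => ?_⟩
  · exact_mod_cast Finset.prod_ne_zero_iff.2 fun j _ => (x j).den_nz
  · rw [Int.natAbs_natCast, hpow]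
    nlinarith
  · obtain ⟨e, he⟩ := Finset.dvd_prod_of_mem (fun j => (x j).den) (Finset.mem_univ j)
    have he0 : e ≤ ∏ j, (x j).den := by
      rw [he]; exact Nat.le_mul_of_pos_left _ (x j).den_pos
    refine ⟨(x j).num * e, ?_, ?_⟩
    · rw [he]
      push_cast
      rw [← mul_assoc, Rat.mul_den_eq_num]
    · rw [Int.natAbs_mul, Int.natAbs_natCast, hpow]
      refine Nat.mul_le_mul ?_ (he0.trans hden)
      refine (fitsBits_of_ratSize_le le_rfl).1.trans (Nat.pow_le_pow_right (by norm_num) ?_)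
      exact Finset.single_le_sum (f := fun j => ratSize (x j)) (fun _ _ => Nat.zero_le _)
        (Finset.mem_univ j)

end Steps

/-! ### Filling arrays -/

/-- Entries `i < N` of the first column of the array `v` are replaced. -/
def Store.fillCol (σ : Store) (v N : ℕ) (f : ℕ → ℚ) : Store :=
  { σ with cell := fun w i j => if w = v ∧ i < N ∧ j = 0 then f i else σ.cell w i j }

/-- Entries `j < N` of the row `r` of the array `v` are replaced. -/
def Store.fillRow (σ : Store) (v r N : ℕ) (f : ℕ → ℚ) : Store :=
  { σ with cell := fun w i j => if w = v ∧ i = r ∧ j < N then f j else σ.cell w i j }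

@[simp] theorem Store.fillCol_ctr (σ : Store) (v N : ℕ) (f : ℕ → ℚ) :
    (σ.fillCol v N f).ctr = σ.ctr := rfl

@[simp] theorem Store.fillCol_cell (σ : Store) (v N : ℕ) (f : ℕ → ℚ) (v' i j : ℕ) :
    (σ.fillCol v N f).cell v' i j =
      if v' = v ∧ i < N ∧ j = 0 then f i else σ.cell v' i j := rfl

@[simp] theorem Store.fillRow_ctr (σ : Store) (v r N : ℕ) (f : ℕ → ℚ) :
    (σ.fillRow v r N f).ctr = σ.ctr := rfl

@[simp] theorem Store.fillRow_cell (σ : Store) (v r N : ℕ) (f : ℕ → ℚ) (v' i j : ℕ) :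
    (σ.fillRow v r N f).cell v' i j =
      if v' = v ∧ i = r ∧ j < N then f j else σ.cell v' i j := rfl

theorem Store.ext' {σ τ : Store} (h1 : ∀ v, σ.ctr v = τ.ctr v)
    (h2 : ∀ v i j, σ.cell v i j = τ.cell v i j) : σ = τ := by
  cases σ; cases τ
  simp only [Store.mk.injEq]
  exact ⟨funext h1, funext fun v => funext fun i => funext fun j => h2 v i j⟩

theorem Store.fillCol_zero (σ : Store) (v : ℕ) (f : ℕ → ℚ) : σ.fillCol v 0 f = σ :=
  Store.ext' (by simp) (by simp)

theorem Store.fillRow_zero (σ : Store) (v r : ℕ) (f : ℕ → ℚ) : σ.fillRow v r 0 f = σ :=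
  Store.ext' (by simp) (by simp)

theorem Store.setCell_self (σ : Store) (v i j : ℕ) : σ.setCell v i j (σ.cell v i j) = σ := by
  refine Store.ext' (by simp) fun v' i' j' => ?_
  rw [Store.setCell_cell]
  split_ifs with h
  · obtain ⟨rfl, rfl, rfl⟩ := h; rfl
  · rfl

theorem Store.setCell_setCell (σ : Store) (v i j : ℕ) (p q : ℚ) :
    (σ.setCell v i j p).setCell v i j q = σ.setCell v i j q := by
  refine Store.ext' (by simp) fun v' i' j' => ?_
  simp only [Store.setCell_cell]
  split_ifs <;> rfl

theorem Store.fillCol_setCell (σ : Store) (v i : ℕ) (f : ℕ → ℚ) (c a : ℕ) :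
    ((σ.fillCol v i f).setCtr c a).setCell v i 0 (f i) = (σ.fillCol v (i + 1) f).setCtr c a := by
  refine Store.ext' (by simp) fun v' i' j' => ?_
  simp only [Store.setCell_cell, Store.setCtr_cell, Store.fillCol_cell]
  split_ifs with h1 h2 h3 h4 <;> first | rfl | (exfalso; omega) | (rw [h1.2.1])

theorem Store.fillRow_setCell (σ : Store) (v r j : ℕ) (f : ℕ → ℚ) (c a : ℕ) :
    ((σ.fillRow v r j f).setCtr c a).setCell v r j (f j) =
      (σ.fillRow v r (j + 1) f).setCtr c a := by
  refine Store.ext' (by simp) fun v' i' j' => ?_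
  simp only [Store.setCell_cell, Store.setCtr_cell, Store.fillRow_cell]
  split_ifs with h1 h2 h3 h4 <;> first | rfl | (exfalso; omega) | (rw [h1.2.2])

/-! ### Loops that fill arrays and add up numbers -/

section FillRules

variable {n : ℕ} {ans : Fin n → ℚ} {M K : ℕ} {σ : Store} {Q : Store → Prop}

/-- When entry i is computed, the entries below i are the new ones and those from i on are still the
old ones. Hence a loop may read, at its current index, the array it overwrites. -/
theorem Runs.fillCol' {c b N v : ℕ} {body : Prog} (f : ℕ → ℚ) (hbc : b ≠ c) (hN : σ.ctr b = N)
    (hNM : N ≤ M) (hNK : N ≤ K) (hc : σ.ctr c = 0)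
    (hbody : ∀ i < N, Runs ans M K body ((σ.fillCol v i f).setCtr c i) fun τ =>
      τ = ((σ.fillCol v i f).setCtr c i).setCell v i 0 (f i))
    (hQ : Q (σ.fillCol v N f)) : Runs ans M K (forLoop c (.ctr b) body) σ Q := by
  refine Runs.forState (fun i => σ.fillCol v i f) hbc (fun _ => hN) hNM hNK (fun _ => hc)
    (σ.fillCol_zero v f) (fun i hi => (hbody i hi).mono ?_) hQ
  rintro _ rfl
  exact σ.fillCol_setCell v i f c i

/-- A loop that fills the first column of an array. -/
theorem Runs.fillCol {c b N v : ℕ} {e : QExpr} (f : ℕ → ℚ) (hbc : b ≠ c) (hN : σ.ctr b = N)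
    (hNM : N ≤ M) (hNK : N ≤ K) (hc : σ.ctr c = 0)
    (he : ∀ i < N, e.eval ((σ.fillCol v i f).setCtr c i) = f i)
    (hf : ∀ i < N, ratSize (f i) ≤ K) (hQ : Q (σ.fillCol v N f)) :
    Runs ans M K (forLoop c (.ctr b) (.setCell v (.ctr c) (.const 0) e)) σ Q := by
  refine Runs.fillCol' f hbc hN hNM hNK hc (fun i hi => Runs.setCell ?_ ?_) hQ
  · rw [he i hi]; exact hf i hi
  · rw [he i hi]; simp

/-- A loop that fills a row of an array. -/
theorem Runs.fillRow {c b N v r : ℕ} {ie : IExpr} {e : QExpr} (f : ℕ → ℚ) (hbc : b ≠ c)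
    (hN : σ.ctr b = N) (hNM : N ≤ M) (hNK : N ≤ K) (hc : σ.ctr c = 0)
    (hi : ∀ i < N, ie.eval ((σ.fillRow v r i f).setCtr c i) = r)
    (he : ∀ i < N, e.eval ((σ.fillRow v r i f).setCtr c i) = f i)
    (hf : ∀ i < N, ratSize (f i) ≤ K) (hQ : Q (σ.fillRow v r N f)) :
    Runs ans M K (forLoop c (.ctr b) (.setCell v ie (.ctr c) e)) σ Q := by
  refine Runs.forState (fun i => σ.fillRow v r i f) hbc (fun _ => hN) hNM hNK (fun _ => hc)
    (σ.fillRow_zero v r f) (fun i hiN => Runs.setCell ?_ ?_) hQ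
  · rw [he i hiN]; exact hf i hiN
  · rw [he i hiN, hi i hiN]
    simpa using σ.fillRow_setCell v r i f c i

/-- A loop that adds up numbers in a cell. -/
theorem Runs.addUp {c b N v r : ℕ} {ie : IExpr} {e : QExpr} (f : ℕ → ℚ) (hbc : b ≠ c)
    (hN : σ.ctr b = N) (hNM : N ≤ M) (hNK : N ≤ K) (hc : σ.ctr c = 0)
    (hzero : σ.cell v r 0 = 0)
    (hi : ∀ i < N, ∀ s, ie.eval ((σ.setCell v r 0 s).setCtr c i) = r)
    (he : ∀ i < N, ∀ s, e.eval ((σ.setCell v r 0 s).setCtr c i) = f i)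
    (hf : ∀ i < N, ratSize (∑ j ∈ Finset.range (i + 1), f j) ≤ K)
    (hQ : Q (σ.setCell v r 0 (∑ j ∈ Finset.range N, f j))) :
    Runs ans M K (forLoop c (.ctr b)
      (.setCell v ie (.const 0) (.add (.cell v ie (.const 0)) e))) σ Q := by
  refine Runs.forState (fun i => σ.setCell v r 0 (∑ j ∈ Finset.range i, f j)) hbc (fun _ => hN)
    hNM hNK (fun _ => hc) ?_ (fun i hiN => ?_) hQ
  · have := σ.setCell_self v r 0
    rw [hzero] at this
    simpa using this
  · have hval : (QExpr.add (.cell v ie (.const 0)) e).eval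
        ((σ.setCell v r 0 (∑ j ∈ Finset.range i, f j)).setCtr c i) =
        ∑ j ∈ Finset.range (i + 1), f j := by
      rw [QExpr.eval, he i hiN, QExpr.eval, hi i hiN, Finset.sum_range_succ]; simp
    refine Runs.setCell ?_ ?_
    · rw [hval]; exact hf i hiN
    · rw [hval, hi i hiN]
      refine Store.ext' (by simp) fun v' i' j' => ?_
      simp only [Store.setCell_cell, Store.setCtr_cell, IExpr.eval]
      split_ifs <;> rfl

end FillRules

/-! ### Frame conditions -/

/-- The memories agree except for the arrays in `V` and the counters in `C`. -/
def Store.Agree (V C : List ℕ) (σ τ : Store) : Prop :=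
  (∀ v, v ∉ V → ∀ i j, τ.cell v i j = σ.cell v i j) ∧ ∀ c, c ∉ C → τ.ctr c = σ.ctr c

theorem Store.Agree.refl (V C : List ℕ) (σ : Store) : σ.Agree V C σ :=
  ⟨fun _ _ _ _ => rfl, fun _ _ => rfl⟩

theorem Store.Agree.trans {V C : List ℕ} {σ τ υ : Store} (h : σ.Agree V C τ)
    (h' : τ.Agree V C υ) : σ.Agree V C υ :=
  ⟨fun v hv i j => (h'.1 v hv i j).trans (h.1 v hv i j),
    fun c hc => (h'.2 c hc).trans (h.2 c hc)⟩

theorem Store.Agree.mono {V C V' C' : List ℕ} {σ τ : Store} (h : σ.Agree V C τ) (hV : V ⊆ V')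
    (hC : C ⊆ C') : σ.Agree V' C' τ :=
  ⟨fun v hv => h.1 v fun h' => hv (hV h'), fun c hc => h.2 c fun hmem => hc (hC hmem)⟩

/-! ### Computing a direction -/

/-- Entry `i` of the vector stored in the array `v`, where `i` is the value of the counter `c`. -/
abbrev vecAt (v c : ℕ) : QExpr := .cell v (.ctr c) (.const 0)

/-- The number stored in the array `v`. -/
abbrev scalar (v : ℕ) : QExpr := .cell v (.const 0) (.const 0)

/-- The test `e ≠ 0`. -/
abbrev neZero (e : QExpr) : BExpr := .ltQ (.const 0) (.mul e e)

theorem neZero_eval (σ : Store) (e : QExpr) : (neZero e).eval σ = decide (e.eval σ ≠ 0) := by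
  simp only [BExpr.eval, QExpr.eval, mul_self_pos]

/-- Array 13 becomes the diagonal matrix of the support of array 12. -/
def initTableau : Prog :=
  forLoop 5 (.ctr 1) (forLoop 6 (.ctr 1)
    (.ite (.and (.not (.ltI (.ctr 5) (.ctr 6))) (.and (.not (.ltI (.ctr 6) (.ctr 5)))
        (neZero (vecAt 12 5))))
      (.setCell 13 (.ctr 5) (.ctr 6) (.const 1))
      (.setCell 13 (.ctr 5) (.ctr 6) (.const 0))))

/-- Array 14 becomes the row of the matrix `A` given by counter 4, times array 13. -/
def rowTimesTableau : Prog :=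
  forLoop 6 (.ctr 1) (.seq (.setCell 14 (.ctr 6) (.const 0) (.const 0))
    (forLoop 5 (.ctr 1) (.setCell 14 (.ctr 6) (.const 0) (.add (.cell 14 (.ctr 6) (.const 0))
      (.mul (.cell 0 (.ctr 4) (.ctr 5)) (.cell 13 (.ctr 5) (.ctr 6)))))))

/-- Counter 7 becomes an index of a nonzero entry of array 14, if there is one. -/
def findPivot : Prog :=
  .seq (.setCtr 7 (.const 0))
    (forLoop 6 (.ctr 1) (.ite (neZero (vecAt 14 6)) (.setCtr 7 (.ctr 6)) .skip))

/-- Array 15 becomes the column of array 13 given by counter 7. -/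
def copyColumn : Prog :=
  forLoop 5 (.ctr 1) (.setCell 15 (.ctr 5) (.const 0) (.cell 13 (.ctr 5) (.ctr 7)))

/-- Array 13 is changed by the elimination step with pivot column given by counter 7. -/
def eliminate : Prog :=
  forLoop 5 (.ctr 1) (forLoop 6 (.ctr 1) (.setCell 13 (.ctr 5) (.ctr 6)
    (.sub (.cell 13 (.ctr 5) (.ctr 6))
      (.mul (vecAt 15 5) (.div (vecAt 14 6) (vecAt 14 7))))))

/-- Counter 7 becomes the index of a nonzero column of array 13, with nonzero objective value if
possible; counter 8 tells whether there is one. -/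
def selectColumn : Prog :=
  .seq (.setCtr 7 (.const 0)) (.seq (.setCtr 8 (.const 0))
    (forLoop 6 (.ctr 1) (.ite (.ltQ (.const 0) (.cell 13 (.ctr 6) (.ctr 6)))
      (.seq (.setCell 17 (.const 0) (.const 0) (.const 0)) (.seq
        (forLoop 5 (.ctr 1) (.setCell 17 (.const 0) (.const 0) (.add (.cell 17 (.const 0) (.const 0))
          (.mul (vecAt 2 5) (.cell 13 (.ctr 5) (.ctr 6))))))
        (.ite (.not (.and (.not (.ltI (.ctr 8) (.const 1))) (.not (neZero (scalar 17)))))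
          (.seq (.setCtr 7 (.ctr 6)) (.setCtr 8 (.const 1))) .skip))) .skip)))

/-- Array 15 becomes a direction with support in that of array 12. -/
def findDirection : Prog :=
  .seq initTableau (.seq
    (forLoop 4 (.ctr 0) (.seq rowTimesTableau (.seq findPivot (.seq copyColumn eliminate))))
    (.seq selectColumn copyColumn))

/-- The memory holds the data of the linear program, and the loop counters are zero. -/
structure LP.Loaded {m n : ℕ} (I : LP m n) (σ : Store) : Prop where
  ctr0 : σ.ctr 0 = m
  ctr1 : σ.ctr 1 = n
  ctr4 : σ.ctr 4 = 0
  ctr5 : σ.ctr 5 = 0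
  ctr6 : σ.ctr 6 = 0
  A : ∀ (i : Fin m) (j : Fin n), σ.cell 0 i j = I.A i j
  w : ∀ j : Fin n, σ.cell 2 j 0 = I.w j
  l : ∀ j : Fin n, σ.cell 3 j 0 = I.l j
  u : ∀ j : Fin n, σ.cell 4 j 0 = I.u j

/-- The default arguments check by evaluation that no input array or loop counter is among those
that may change. -/
theorem LP.Loaded.of_agree {m n : ℕ} {I : LP m n} {σ τ : Store} {V C : List ℕ}
    (h : I.Loaded σ) (ha : σ.Agree V C τ) (hV : ∀ v ∈ [0, 2, 3, 4], v ∉ V := by decide)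
    (hC : ∀ c ∈ [0, 1, 4, 5, 6], c ∉ C := by decide) : I.Loaded τ where
  ctr0 := (ha.2 _ (hC 0 (by simp))).trans h.ctr0
  ctr1 := (ha.2 _ (hC 1 (by simp))).trans h.ctr1
  ctr4 := (ha.2 _ (hC 4 (by simp))).trans h.ctr4
  ctr5 := (ha.2 _ (hC 5 (by simp))).trans h.ctr5
  ctr6 := (ha.2 _ (hC 6 (by simp))).trans h.ctr6
  A := fun i j => (ha.1 _ (hV 0 (by simp)) _ _).trans (h.A i j)
  w := fun j => (ha.1 _ (hV 2 (by simp)) _ _).trans (h.w j)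
  l := fun j => (ha.1 _ (hV 3 (by simp)) _ _).trans (h.l j)
  u := fun j => (ha.1 _ (hV 4 (by simp)) _ _).trans (h.u j)

/-- The parameters are large enough: `X` bounds the bits of the vectors that occur. -/
structure LP.Params {m n : ℕ} (I : LP m n) (X M K : ℕ) : Prop where
  sizeX : I.size ≤ X
  mM : m ≤ M
  nM : n ≤ M
  MK : M + 1 ≤ K
  bits : 2 * ((n + 1) * (8 * X + 8)) + 3 ≤ K

/-! ### Correctness of the elimination programs -/

section Direction

variable {m n : ℕ} {I : LP m n} {ans : Fin n → ℚ} {X M K : ℕ} {σ : Store}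

theorem LP.Params.ratSize_le (P : I.Params X M K) {k : ℕ} {q : ℚ} (h : FitsBits k q)
    (hk : k ≤ 8 * X + 8) : ratSize q ≤ K := by
  have := h.ratSize_le
  have := P.bits
  nlinarith [Nat.zero_le (n * (8 * X + 8))]

/-- A sum of N numbers of k bits has at most N (k + 1) bits; `Params.bits` is made for this. -/
theorem LP.Params.ratSize_sum_le (P : I.Params X M K) {k N : ℕ} {f : ℕ → ℚ}
    (h : ∀ j < N, FitsBits k (f j)) (hN : N ≤ n) (hk : k ≤ 8 * X + 7) :
    ratSize (∑ j ∈ Finset.range N, f j) ≤ K := by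
  have h1 := (FitsBits.sum_range h).ratSize_le
  have := P.bits
  have h2 : N * (k + 1) ≤ n * (8 * X + 8) := Nat.mul_le_mul hN (by omega)
  nlinarith

theorem LP.Params.nK (P : I.Params X M K) : n ≤ K := by have := P.nM; have := P.MK; omega

theorem LP.Params.mK (P : I.Params X M K) : m ≤ K := by have := P.mM; have := P.MK; omega

theorem LP.ratSize_A_le (I : LP m n) (i : Fin m) (j : Fin n) : ratSize (I.A i j) ≤ I.size := by
  have h1 : ratSize (I.A i j) ≤ ∑ j, ratSize (I.A i j) :=
    Finset.single_le_sum (f := fun j => ratSize (I.A i j)) (fun _ _ => Nat.zero_le _)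
      (Finset.mem_univ j)
  have h2 : ∑ j, ratSize (I.A i j) ≤ ∑ i, ∑ j, ratSize (I.A i j) :=
    Finset.single_le_sum (f := fun i => ∑ j, ratSize (I.A i j)) (fun _ _ => Nat.zero_le _)
      (Finset.mem_univ i)
  unfold LP.size; omega

theorem LP.fitsBits_A (I : LP m n) (hX : I.size ≤ X) (i : Fin m) (j : Fin n) :
    FitsBits X (I.A i j : ℚ) :=
  fitsBits_of_ratSize_le ((I.ratSize_A_le i j).trans hX)

theorem LP.ratSize_b_le (I : LP m n) (i : Fin m) : ratSize (I.b i) ≤ I.size := by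
  have h1 : ratSize (I.b i) ≤ ∑ i, ratSize (I.b i) :=
    Finset.single_le_sum (f := fun i => ratSize (I.b i)) (fun _ _ => Nat.zero_le _)
      (Finset.mem_univ i)
  unfold LP.size; omega

theorem LP.ratSize_w_le (I : LP m n) (j : Fin n) : ratSize (I.w j) ≤ I.size := by
  have h1 : ratSize (I.w j) ≤ ∑ j, ratSize (I.w j) :=
    Finset.single_le_sum (f := fun j => ratSize (I.w j)) (fun _ _ => Nat.zero_le _)
      (Finset.mem_univ j)
  unfold LP.size; omega

theorem LP.ratSize_l_le (I : LP m n) (j : Fin n) : ratSize (I.l j) ≤ I.size := by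
  have h1 : ratSize (I.l j) ≤ ∑ j, ratSize (I.l j) :=
    Finset.single_le_sum (f := fun j => ratSize (I.l j)) (fun _ _ => Nat.zero_le _)
      (Finset.mem_univ j)
  unfold LP.size; omega

theorem LP.ratSize_u_le (I : LP m n) (j : Fin n) : ratSize (I.u j) ≤ I.size := by
  have h1 : ratSize (I.u j) ≤ ∑ j, ratSize (I.u j) :=
    Finset.single_le_sum (f := fun j => ratSize (I.u j)) (fun _ _ => Nat.zero_le _)
      (Finset.mem_univ j)
  unfold LP.size; omega

/-- The bound is the same at every stage `t`, because it comes from determinants and not from the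
operations performed. -/
theorem IsTableau.fitsBits {S : Set (Fin n)} {t : ℕ} {ρ : Fin n → Option (Fin m)}
    {V : Matrix (Fin n) (Fin n) ℚ} (h : IsTableau I.A S t ρ V) (hX : I.size ≤ X) (j k : Fin n) :
    FitsBits X (V j k) := by
  obtain ⟨D, h0, h1, h2⟩ := h.exists_denominator
  obtain ⟨z, hz, hzb⟩ := h2 j k
  have := detBound_le I
  exact (fitsBits_of_mul_eq h0 hz (hzb.trans this) (h1.trans this)).mono hX

theorem runs_initTableau (P : I.Params X M K) (hσ : I.Loaded σ) {Q : Store → Prop}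
    (hQ : ∀ τ, σ.Agree [13] [] τ → (∀ j k : Fin n, τ.cell 13 j k =
      if j = k ∧ k ∈ {j : Fin n | σ.cell 12 j 0 ≠ 0} then 1 else 0) → Q τ) :
    Runs ans M K initTableau σ Q := by
  have hK1 : ratSize 1 ≤ K := P.ratSize_le (fitsBits_one 0) (by omega)
  have hK0 : ratSize 0 ≤ K := P.ratSize_le (fitsBits_zero 0) (by omega)
  refine Runs.for (fun i τ => σ.Agree [13] [] τ ∧ ∀ j k : ℕ, j < i → k < n →
    τ.cell 13 j k = if j = k ∧ σ.cell 12 j 0 ≠ 0 then 1 else 0) (by decide)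
    (fun i τ h => (h.1.2 1 (by decide)).trans hσ.ctr1) P.nM P.nK hσ.ctr5
    ⟨.refl _ _ _, fun j k hj => absurd hj (Nat.not_lt_zero _)⟩ ?_ ?_
  · rintro i hi τ hτ5 ⟨hA, hV⟩
    refine Runs.forState (fun k => (τ.fillRow 13 i k fun k =>
      if i = k ∧ σ.cell 12 i 0 ≠ 0 then 1 else 0).setCtr 5 i) (by decide)
      (fun k => by simp [hA.2, hσ.ctr1]) P.nM P.nK (fun k => by simp [hA.2, hσ.ctr6])
      (by rw [Store.fillRow_zero]) ?_ ?_
    · intro k hk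
      have hcell : σ.cell 12 i 0 = τ.cell 12 i 0 := (hA.1 12 (by decide) _ _).symm
      have hst : ∀ q : ℚ, q = (if i = k ∧ σ.cell 12 i 0 ≠ 0 then 1 else 0) →
          (((τ.fillRow 13 i k fun k => if i = k ∧ σ.cell 12 i 0 ≠ 0 then 1 else 0).setCtr
            5 i).setCtr 6 k).setCell 13 i k q =
          ((τ.fillRow 13 i (k + 1) fun k => if i = k ∧ σ.cell 12 i 0 ≠ 0 then 1 else 0).setCtr
            5 i).setCtr 6 k := by
        rintro q rfl
        rw [← Store.fillRow_setCell τ 13 i k (fun k => if i = k ∧ σ.cell 12 i 0 ≠ 0 then 1 else 0)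
          5 i]
        rfl
      refine Runs.ite (fun hp => Runs.setCell (by simpa using hK1) ?_)
        (fun hp => Runs.setCell (by simpa using hK0) ?_)
      · simp at hp
        simpa using hst 1 (by rw [if_pos ⟨by omega, by rw [hcell]; exact hp.2.2⟩])
      · simp at hp
        refine (by simpa using hst 0 (by
          rw [if_neg]
          rintro ⟨rfl, h2⟩
          rw [hcell] at h2
          exact h2 (hp le_rfl le_rfl)))
    · refine ⟨by simp, ⟨fun v hv a b => ?_, fun c hc => ?_⟩, fun j k hj hk => ?_⟩
      · have : v ≠ 13 := by simpa using hv
        simp [this, hA.1 v hv]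
      · by_cases h5 : c = 5
        · simp [h5, hσ.ctr5]
        · simp [h5, hA.2 c hc]
      · simp only [Store.setCtr_cell, Store.fillRow_cell]
        by_cases hji : j = i
        · simp [hji, hk]
        · simp [hji, hV j k (by omega) hk]
  · rintro τ _ ⟨hA, hV⟩
    refine hQ τ hA fun j k => ?_
    rw [hV j k j.2 k.2]
    by_cases hjk : j = k
    · subst hjk; simp
    · have : (j : ℕ) ≠ k := fun h => hjk (Fin.ext h)
      simp [hjk, this]

end Direction

section Direction

variable {m n : ℕ} {I : LP m n} {ans : Fin n → ℚ} {X M K : ℕ} {σ : Store}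

theorem IsTableau.congr {A : Matrix (Fin m) (Fin n) ℤ} {S : Set (Fin n)} {t : ℕ}
    {ρ : Fin n → Option (Fin m)} {V V' : Matrix (Fin n) (Fin n) ℚ} (h : IsTableau A S t ρ V)
    (hV : ∀ j k, V' j k = V j k) : IsTableau A S t ρ V' := by
  rwa [show V' = V from Matrix.ext hV]

theorem runs_rowTimesTableau (P : I.Params X M K) (h1 : σ.ctr 1 = n) (h5 : σ.ctr 5 = 0)
    (h6 : σ.ctr 6 = 0)
    (hA : ∀ j < n, FitsBits X (σ.cell 0 (σ.ctr 4) j))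
    (hV : ∀ j < n, ∀ k < n, FitsBits X (σ.cell 13 j k)) {Q : Store → Prop}
    (hQ : Q (σ.fillCol 14 n fun k =>
      ∑ j ∈ Finset.range n, σ.cell 0 (σ.ctr 4) j * σ.cell 13 j k)) :
    Runs ans M K rowTimesTableau σ Q := by
  set R : ℕ → ℚ := fun k => ∑ j ∈ Finset.range n, σ.cell 0 (σ.ctr 4) j * σ.cell 13 j k with hR
  refine Runs.fillCol' R (by decide) h1 P.nM P.nK h6 (fun k hk => ?_) hQ
  refine Runs.seq (Runs.setCell (by simpa using P.ratSize_le (fitsBits_zero 0) (by omega)) ?_)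
  refine Runs.addUp (r := k) (fun j => σ.cell 0 (σ.ctr 4) j * σ.cell 13 j k) (by decide)
    (by simpa using h1) P.nM P.nK (by simpa using h5) (by simp) (by simp) (by simp) ?_ ?_
  · intro i hi
    exact P.ratSize_sum_le (k := X + X) (fun j hj => (hA j (by omega)).mul (hV j (by omega) k hk))
      (by omega) (by omega)
  · simp [Store.setCell_setCell, hR]

/-- The last nonzero entry wins. If all entries vanish the index remains 0, which `IsTableau.step`
admits; for n = 0 there is no valid index. -/
theorem runs_findPivot (P : I.Params X M K) (h1 : σ.ctr 1 = n) (h6 : σ.ctr 6 = 0)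
    {Q : Store → Prop}
    (hQ : ∀ k₀, (k₀ < n ∨ n = 0) → (∀ k < n, σ.cell 14 k 0 ≠ 0 → σ.cell 14 k₀ 0 ≠ 0) →
      Q (σ.setCtr 7 k₀)) : Runs ans M K findPivot σ Q := by
  refine Runs.seq (Runs.setCtr (by simp) ?_)
  refine Runs.for (fun i τ => ∃ k₀, (k₀ < n ∨ n = 0) ∧
    (∀ k < i, σ.cell 14 k 0 ≠ 0 → σ.cell 14 k₀ 0 ≠ 0) ∧ τ = σ.setCtr 7 k₀) (by decide) ?_ P.nM P.nK
    (by simpa using h6) ⟨0, by omega, by simp, rfl⟩ ?_ ?_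
  · rintro i _ ⟨k₀, -, -, rfl⟩
    simpa using h1
  · rintro i hi _ - ⟨k₀, hk₀, hk, rfl⟩
    refine Runs.ite (fun hp => Runs.setCtr (by simp; have := P.nK; omega) ?_)
      (fun hp => Runs.skip ?_)
    · rw [neZero_eval] at hp
      simp at hp
      refine ⟨by simp, i, Or.inl hi, fun k _ _ => hp, ?_⟩
      refine Store.ext' (fun c => ?_) (by simp)
      by_cases h7 : c = 7 <;> by_cases h6' : c = 6 <;> simp [h7, h6', h6]
    · rw [neZero_eval] at hp
      simp at hp
      refine ⟨by simp, k₀, hk₀, fun k hk' hne => ?_, ?_⟩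
      · rcases Nat.lt_succ_iff_lt_or_eq.1 hk' with h | rfl
        · exact hk k h hne
        · exact absurd hp hne
      · rw [Store.setCtr_setCtr]
        exact Store.setCtr_of_eq (by simpa using h6)
  · rintro _ - ⟨k₀, hk₀, hk, rfl⟩
    exact hQ k₀ hk₀ hk

theorem runs_copyColumn (P : I.Params X M K) (h1 : σ.ctr 1 = n) (h5 : σ.ctr 5 = 0)
    (hV : ∀ j < n, FitsBits X (σ.cell 13 j (σ.ctr 7))) {Q : Store → Prop}
    (hQ : Q (σ.fillCol 15 n fun j => σ.cell 13 j (σ.ctr 7))) :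
    Runs ans M K copyColumn σ Q :=
  Runs.fillCol _ (by decide) h1 P.nM P.nK h5 (by simp)
    (fun i hi => P.ratSize_le (hV i hi) (by omega)) hQ

/-- The multipliers come from arrays 14 and 15, which stay fixed, because the pivot column of array
13 is itself overwritten. -/
theorem runs_eliminate (P : I.Params X M K) (h1 : σ.ctr 1 = n) (h5 : σ.ctr 5 = 0)
    (h6 : σ.ctr 6 = 0)
    (hV : ∀ j < n, ∀ k < n, FitsBits X (σ.cell 13 j k -
      σ.cell 15 j 0 * (σ.cell 14 k 0 / σ.cell 14 (σ.ctr 7) 0))) {Q : Store → Prop}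
    (hQ : ∀ τ, σ.Agree [13] [] τ → (∀ j < n, ∀ k < n, τ.cell 13 j k = σ.cell 13 j k -
      σ.cell 15 j 0 * (σ.cell 14 k 0 / σ.cell 14 (σ.ctr 7) 0)) → Q τ) :
    Runs ans M K eliminate σ Q := by
  refine Runs.for (fun i τ => σ.Agree [13] [] τ ∧
    (∀ j < i, ∀ k < n, τ.cell 13 j k = σ.cell 13 j k -
      σ.cell 15 j 0 * (σ.cell 14 k 0 / σ.cell 14 (σ.ctr 7) 0)) ∧
    ∀ j, i ≤ j → ∀ k, τ.cell 13 j k = σ.cell 13 j k) (by decide)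
    (fun i τ h => (h.1.2 1 (by decide)).trans h1) P.nM P.nK h5
    ⟨.refl _ _ _, by simp, by simp⟩ ?_ ?_
  · rintro i hi τ hτ5 ⟨hA, hV1, hV2⟩
    refine Runs.fillRow (r := i) (fun k => σ.cell 13 i k -
      σ.cell 15 i 0 * (σ.cell 14 k 0 / σ.cell 14 (σ.ctr 7) 0)) (by decide)
      (by simp [hA.2, h1]) P.nM P.nK (by simp [hA.2, h6]) (by simp) ?_
      (fun k hk => P.ratSize_le (hV i hi k hk) (by omega)) ?_
    · intro k hk
      simp [hA.1 14, hA.1 15, hA.2 7, hV2 i le_rfl]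
    · refine ⟨by simp, ⟨fun v hv a b => ?_, fun c hc => ?_⟩, fun j hj k hk => ?_,
        fun j hj k => ?_⟩
      · have : v ≠ 13 := by simpa using hv
        simp [this, hA.1 v hv]
      · by_cases h5' : c = 5
        · simp [h5', h5]
        · simp [h5', hA.2 c hc]
      · by_cases hji : j = i
        · simp [hji, hk]
        · simp [hji, hV1 j (by omega) k hk]
      · have : j ≠ i := by omega
        simp [this, hV2 j (by omega) k]
  · rintro τ _ ⟨hA, hV1, -⟩
    exact hQ τ hA hV1

/-- A nonzero column replaces the current choice if there is none yet or if its own objective value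
is nonzero. So a choice with objective value zero survives only if all nonzero columns have
objective value zero. -/
theorem runs_selectColumn (P : I.Params X M K) (hσ : I.Loaded σ)
    (hV : ∀ j < n, ∀ k < n, FitsBits X (σ.cell 13 j k)) {Q : Store → Prop}
    (hQ : ∀ τ, σ.Agree [17] [7, 8] τ →
      (τ.ctr 8 = 0 ∧ τ.ctr 7 = 0 ∧ ∀ k < n, ¬ 0 < σ.cell 13 k k) ∨
      (τ.ctr 8 = 1 ∧ τ.ctr 7 < n ∧ 0 < σ.cell 13 (τ.ctr 7) (τ.ctr 7) ∧
        (I.objQ (fun j => σ.cell 13 j (τ.ctr 7)) = 0 → ∀ k < n, 0 < σ.cell 13 k k →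
          I.objQ (fun j => σ.cell 13 j k) = 0)) → Q τ) :
    Runs ans M K selectColumn σ Q := by
  have hw : ∀ j < n, FitsBits X (σ.cell 2 j 0) := fun j hj => by
    rw [hσ.w ⟨j, hj⟩]
    exact fitsBits_of_ratSize_le ((I.ratSize_w_le _).trans P.sizeX)
  have hobj : ∀ k, ∑ j ∈ Finset.range n, σ.cell 2 j 0 * σ.cell 13 j k =
      I.objQ (fun j => σ.cell 13 j k) := fun k => by
    rw [Finset.sum_range]
    exact Finset.sum_congr rfl fun j _ => by rw [hσ.w j]
  refine Runs.seq (Runs.setCtr (by simp) (Runs.seq (Runs.setCtr (by simp) ?_)))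
  refine Runs.for (fun i τ => σ.Agree [17] [7, 8] τ ∧
    ((τ.ctr 8 = 0 ∧ τ.ctr 7 = 0 ∧ ∀ k < i, ¬ 0 < σ.cell 13 k k) ∨
      (τ.ctr 8 = 1 ∧ τ.ctr 7 < n ∧ 0 < σ.cell 13 (τ.ctr 7) (τ.ctr 7) ∧
        (I.objQ (fun j => σ.cell 13 j (τ.ctr 7)) = 0 → ∀ k < i, 0 < σ.cell 13 k k →
          I.objQ (fun j => σ.cell 13 j k) = 0)))) (by decide)
    (fun i τ h => (h.1.2 1 (by decide)).trans hσ.ctr1) P.nM P.nK (by simpa using hσ.ctr6)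
    ⟨⟨by simp, fun c hc => by simp at hc; simp [hc]⟩, by simp⟩ ?_ ?_
  · rintro i hi τ hτ6 ⟨hA, hI⟩
    have hA13 : ∀ j k, τ.cell 13 j k = σ.cell 13 j k := hA.1 13 (by decide)
    refine Runs.ite (fun hp => ?_) (fun hp => Runs.skip ?_)
    · refine Runs.seq (Runs.setCell (by simpa using P.ratSize_le (fitsBits_zero 0) (by omega))
        (Runs.seq ?_))
      refine Runs.addUp (r := 0) (fun j => σ.cell 2 j 0 * σ.cell 13 j i) (by decide)
        (by simp [hA.2, hσ.ctr1]) P.nM P.nK (by simp [hA.2, hσ.ctr5]) (by simp) (by simp)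
        (by simp [hA.1 2, hA13]) ?_ ?_
      · intro k hk
        exact P.ratSize_sum_le (k := X + X)
          (fun j hj => (hw j (by omega)).mul (hV j (by omega) i hi)) (by omega) (by omega)
      · simp at hp
        rw [hA13] at hp
        refine Runs.ite (fun hq => Runs.seq (Runs.setCtr (by simp; have := P.nK; omega)
          (Runs.setCtr (by simp; have := P.MK; omega) ?_))) (fun hq => Runs.skip ?_)
        · refine ⟨by simp, ⟨fun v hv a b => ?_, fun c hc => ?_⟩, Or.inr ?_⟩
          · have : v ≠ 17 := by simpa using hv
            simp [this, hA.1 v hv]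
          · simp at hc
            by_cases h6 : c = 6
            · simp [h6, hσ.ctr6]
            · simp [h6, hc, hA.2]
          · simp at hq
            simp only [Store.setCtr_ctr, Store.setCell_ctr]
            simp only [IExpr.eval, Store.setCtr_ctr, Store.setCell_ctr]
            refine ⟨by simp, by simpa using hi, by simpa using hp, ?_⟩
            simp only [show (7 : ℕ) ≠ 6 by decide, show (7 : ℕ) ≠ 8 by decide, if_false, if_true]
            -- If a column had been chosen before, the present one replaced it because of a nonzero
            -- objective value, against h0.
            intro h0 k hk hkk
            rw [hobj] at hq
            rcases Nat.lt_succ_iff_lt_or_eq.1 hk with hlt | rfl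
            · rcases hI with hI | hI
              · exact absurd hkk (hI.2.2 k hlt)
              · exact absurd h0 (hq.resolve_left (by omega))
            · exact h0
        · simp at hq
          rw [hobj] at hq
          refine ⟨by simp, ⟨fun v hv a b => ?_, fun c hc => ?_⟩, Or.inr ?_⟩
          · have : v ≠ 17 := by simpa using hv
            simp [this, hA.1 v hv]
          · by_cases h6 : c = 6
            · simp [h6, hσ.ctr6]
            · simp [h6, hA.2 c hc]
          · rcases hI with hI | hI
            · omega
            · refine ⟨by simpa using hI.1, by simpa using hI.2.1, by simpa using hI.2.2.1, ?_⟩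
              simp only [Store.setCtr_ctr, Store.setCell_ctr, show (7 : ℕ) ≠ 6 by decide, if_false]
              intro h0 k hk hkk
              rcases Nat.lt_succ_iff_lt_or_eq.1 hk with hlt | rfl
              · exact hI.2.2.2 h0 k hlt hkk
              · exact hq.2
    · simp at hp
      rw [hA13] at hp
      rw [Store.setCtr_setCtr, Store.setCtr_of_eq hτ6]
      refine ⟨by simp, hA, hI.imp (fun h => ⟨h.1, h.2.1, fun k hk => ?_⟩)
        (fun h => ⟨h.1, h.2.1, h.2.2.1, fun h0 k hk hkk => ?_⟩)⟩
      · rcases Nat.lt_succ_iff_lt_or_eq.1 hk with hlt | rfl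
        · exact h.2.2 k hlt
        · exact hp.not_gt
      · rcases Nat.lt_succ_iff_lt_or_eq.1 hk with hlt | rfl
        · exact h.2.2.2 h0 k hlt hkk
        · exact absurd hkk hp.not_gt
  · rintro τ _ ⟨hA, hI⟩
    exact hQ τ hA hI

/-- The two outcomes are `IsTableau.eq_zero` and `IsTableau.isDirection` for the finished tableau of
the support of array 12. -/
theorem runs_findDirection (P : I.Params X M K) (hσ : I.Loaded σ) {Q : Store → Prop}
    (hQ : ∀ τ, σ.Agree [13, 14, 15, 17] [7, 8] τ →
      (τ.ctr 8 = 0 ∧ ∀ z : Fin n → ℝ, mulR I.A z = 0 →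
        (∀ j, z j ≠ 0 → j ∈ {j : Fin n | σ.cell 12 j 0 ≠ 0}) → z = 0) ∨
      (τ.ctr 8 = 1 ∧ I.IsDirection {j : Fin n | σ.cell 12 j 0 ≠ 0} fun j => τ.cell 15 j 0) →
      Q τ) :
    Runs ans M K findDirection σ Q := by
  refine Runs.seq (runs_initTableau P hσ fun σ₁ hA₁ hV₁ => Runs.seq ?_)
  have hσ₁ : I.Loaded σ₁ := hσ.of_agree hA₁
  refine Runs.for (fun i τ => σ.Agree [13, 14, 15, 17] [7, 8] τ ∧ ∃ ρ, IsTableau I.A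
    {j : Fin n | σ.cell 12 j 0 ≠ 0} i ρ fun j k => τ.cell 13 j k) (by decide)
    (fun i τ h => (h.1.2 0 (by decide)).trans hσ.ctr0) P.mM P.mK hσ₁.ctr4 ?_ ?_ ?_
  · refine ⟨hA₁.mono (by decide) (by decide), fun _ => none, ?_⟩
    exact (IsTableau.initial I.A {j : Fin n | σ.cell 12 j 0 ≠ 0}).congr fun j k => by
      convert hV₁ j k using 1
  · rintro i hi τ hτ4 ⟨hA, ρ, hT⟩
    have hτ : I.Loaded τ := hσ.of_agree hA
    have hfit : ∀ j < n, ∀ k < n, FitsBits X (τ.cell 13 j k) := fun j hj k hk =>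
      hT.fitsBits P.sizeX ⟨j, hj⟩ ⟨k, hk⟩
    refine Runs.seq (runs_rowTimesTableau (σ := τ.setCtr 4 i) P (by simpa using hτ.ctr1) (by simpa using hτ.ctr5)
      (by simpa using hτ.ctr6) ?_ hfit (Runs.seq ?_))
    · intro j hj
      simp only [Store.setCtr_ctr, if_true, Store.setCtr_cell]
      rw [hτ.A ⟨i, hi⟩ ⟨j, hj⟩]
      exact I.fitsBits_A P.sizeX _ _
    set R : ℕ → ℚ := fun k => ∑ j ∈ Finset.range n, τ.cell 0 i j * τ.cell 13 j k with hR
    have hRF : ∀ k : Fin n, R k = ∑ l, (I.A ⟨i, hi⟩ l : ℚ) * τ.cell 13 l k := fun k => by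
      rw [hR]
      simp only
      rw [Finset.sum_range]
      exact Finset.sum_congr rfl fun l _ => by rw [← hτ.A ⟨i, hi⟩ l]
    simp only [Store.setCtr_ctr, if_true, Store.setCtr_cell]
    refine runs_findPivot P (by simpa using hτ.ctr1) (by simpa using hτ.ctr6) fun k₀ hk₀ hne => ?_
    have hne' : ∀ k < n, R k ≠ 0 → k₀ < n → R k₀ ≠ 0 := fun k hk h0 hk₀ => by
      have := hne k hk
      have h0' : ∑ j ∈ Finset.range n, τ.cell 0 i j * τ.cell 13 j k ≠ 0 := h0
      simp only [Store.fillCol_cell, hk, hk₀, and_true, if_true] at this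
      exact this h0'
    have hstep : ∃ ρ', IsTableau I.A {j : Fin n | σ.cell 12 j 0 ≠ 0} (i + 1) ρ' fun j k : Fin n =>
        τ.cell 13 j k - τ.cell 13 j k₀ * (R k / R k₀) := by
      rcases hk₀ with hk₀ | hn
      · exact hT.step (i := ⟨i, hi⟩) rfl hRF (k₀ := ⟨k₀, hk₀⟩) fun k hk => hne' k k.2 hk hk₀
      · have := hT.skip_row hn
        subst hn
        exact ⟨ρ, this.congr fun j => j.elim0⟩
    obtain ⟨ρ', hT'⟩ := hstep
    have hk₀n : ∀ j < n, k₀ < n := fun j hj => by omega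
    refine Runs.seq (runs_copyColumn P (by simpa using hτ.ctr1) (by simpa using hτ.ctr5) ?_
      (runs_eliminate P (by simpa using hτ.ctr1) (by simpa using hτ.ctr5)
        (by simpa using hτ.ctr6) ?_ ?_))
    · intro j hj
      simpa using hfit j hj k₀ (hk₀n j hj)
    · intro j hj k hk
      have := hT'.fitsBits P.sizeX ⟨j, hj⟩ ⟨k, hk⟩
      simpa [hj, hk, hk₀n j hj] using this
    · intro υ hAυ hVυ
      refine ⟨by rw [hAυ.2 4 (by decide)]; simp, ⟨fun v hv a b => ?_, fun c hc => ?_⟩, ρ', ?_⟩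
      · simp at hv
        rw [Store.setCtr_cell, hAυ.1 v (by simp [hv])]
        simp [hv, hA.1]
      · simp at hc
        by_cases h4 : c = 4
        · simp [h4, hσ.ctr4]
        · simp only [Store.setCtr_ctr, if_neg h4]
          rw [hAυ.2 c (by simp)]
          simp [hc, h4, hA.2]
      · refine hT'.congr fun j k => ?_
        rw [hVυ j j.2 k k.2]
        simp [hk₀n j j.2, hR]
  · rintro τ hτ4 ⟨hA, ρ, hT⟩
    have hτ : I.Loaded τ := hσ.of_agree hA
    have hfit : ∀ j < n, ∀ k < n, FitsBits X (τ.cell 13 j k) := fun j hj k hk =>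
      hT.fitsBits P.sizeX ⟨j, hj⟩ ⟨k, hk⟩
    refine Runs.seq (runs_selectColumn P hτ hfit fun υ hAυ hυ => ?_)
    have h13 : ∀ j k, υ.cell 13 j k = τ.cell 13 j k := hAυ.1 13 (by decide)
    have h7 : ∀ j < n, υ.ctr 7 < n := fun j hj => by
      rcases hυ with h | h
      · omega
      · exact h.2.1
    refine runs_copyColumn P ((hAυ.2 1 (by decide)).trans hτ.ctr1)
      ((hAυ.2 5 (by decide)).trans hτ.ctr5) ?_ (hQ _ ⟨fun v hv a b => ?_, fun c hc => ?_⟩ ?_)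
    · intro j hj
      rw [h13]
      exact hfit j hj _ (h7 j hj)
    · simp at hv
      simp [hv, hAυ.1, hA.1]
    · simp at hc
      simp [hc, hAυ.2, hA.2]
    · simp only [Store.fillCol_ctr]
      refine hυ.imp (fun h => ⟨h.1, fun z hz hS => hT.eq_zero (fun k => h.2.2 k k.2) hz hS⟩)
        fun h => ⟨h.1, ?_⟩
      have := hT.isDirection (k := ⟨υ.ctr 7, h.2.1⟩) h.2.2.1 fun h0 k' => h.2.2.2 h0 k' k'.2
      convert this using 1
      funext j
      simp [h13]

end Direction

/-! ### Maximal steps -/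

/-- The quotient `(tⱼ - zⱼ) / dⱼ` for arrays 10, 11, 15 holding `z`, `t`, `d`. -/
abbrev stepRatio : QExpr := .div (.sub (vecAt 11 5) (vecAt 10 5)) (vecAt 15 5)

/-- Array 16 becomes the length of the step to the first target; counter 9 tells whether there is
one. -/
def findStep : Prog :=
  .seq (.setCtr 9 (.const 0)) (.seq (.setCell 16 (.const 0) (.const 0) (.const 0))
    (forLoop 5 (.ctr 1)
      (.ite (.ltQ (.const 0) (.mul (.sub (vecAt 11 5) (vecAt 10 5)) (vecAt 15 5)))
        (.ite (.not (.and (.not (.ltI (.ctr 9) (.const 1))) (.not (.ltQ stepRatio (scalar 16)))))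
          (.seq (.setCell 16 (.const 0) (.const 0) stepRatio) (.setCtr 9 (.const 1))) .skip)
        .skip)))

/-- Array 10 is moved along the direction. -/
def applyStep : Prog :=
  forLoop 5 (.ctr 1) (.setCell 10 (.ctr 5) (.const 0)
    (.add (vecAt 10 5) (.mul (scalar 16) (vecAt 15 5))))

/-- The current point of the walk, at the index given by counter 5. -/
abbrev currentAt : QExpr := .cell 6 (.ctr 2) (.ctr 5)

/-- A maximal step from the current point in the direction of array 15. -/
def takeStep : Prog :=
  .seq (forLoop 5 (.ctr 1) (.setCell 10 (.ctr 5) (.const 0) currentAt)) (.seq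
    (forLoop 5 (.ctr 1) (.ite (.ltQ (.const 0) (vecAt 15 5))
      (.setCell 11 (.ctr 5) (.const 0) (vecAt 4 5))
      (.setCell 11 (.ctr 5) (.const 0) (vecAt 3 5)))) (.seq
    findStep (.seq applyStep (.seq
    (forLoop 5 (.ctr 1) (.setCell 6 (.add (.ctr 2) (.const 1)) (.ctr 5) (vecAt 10 5)))
    (.setCtr 2 (.add (.ctr 2) (.const 1)))))))

/-- Array 15 is negated. -/
def negate : Prog :=
  forLoop 5 (.ctr 1) (.setCell 15 (.ctr 5) (.const 0) (.sub (.const 0) (vecAt 15 5)))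

/-- Array `v` becomes the sum of the values of `e` over the range of counter 5. -/
def sumInto (v : ℕ) (e : QExpr) : Prog :=
  .seq (.setCell v (.const 0) (.const 0) (.const 0))
    (forLoop 5 (.ctr 1) (.setCell v (.const 0) (.const 0) (.add (.cell v (.const 0) (.const 0)) e)))

/-! ### Correctness of the step programs -/

section Moves

variable {m n : ℕ} {I : LP m n} {ans : Fin n → ℚ} {X M K : ℕ} {σ : Store} {Q : Store → Prop}

theorem runs_sumInto {v : ℕ} {e : QExpr} (P : I.Params X M K) (hσ : I.Loaded σ) (f : ℕ → ℚ)
    (he : ∀ i < n, ∀ s, e.eval ((σ.setCell v 0 0 s).setCtr 5 i) = f i)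
    (hf : ∀ i < n, FitsBits (8 * X + 7) (f i))
    (hQ : ∀ τ, σ.Agree [v] [] τ → τ.cell v 0 0 = ∑ j ∈ Finset.range n, f j → Q τ) :
    Runs ans M K (sumInto v e) σ Q := by
  refine Runs.seq (Runs.setCell (by simpa using P.ratSize_le (fitsBits_zero 0) (by omega)) ?_)
  refine Runs.addUp (r := 0) f (by decide) (by simpa using hσ.ctr1) P.nM P.nK
    (by simpa using hσ.ctr5) (by simp) (by simp) ?_ ?_ ?_
  · intro i hi s
    simp only [IExpr.eval, Store.setCell_setCell]
    exact he i hi s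
  · intro i hi
    exact P.ratSize_sum_le (fun j hj => hf j (by omega)) (by omega) le_rfl
  · refine hQ _ ⟨fun v' hv a b => ?_, by simp⟩ (by simp)
    simp at hv
    simp [hv]

theorem runs_negate (P : I.Params X M K) (hσ : I.Loaded σ)
    (hd : ∀ j < n, FitsBits X (σ.cell 15 j 0)) (hQ : Q (σ.fillCol 15 n fun j => -σ.cell 15 j 0)) :
    Runs ans M K negate σ Q :=
  Runs.fillCol _ (by decide) hσ.ctr1 P.nM P.nK hσ.ctr5 (by simp)
    (fun i hi => P.ratSize_le (hd i hi).neg (by omega)) hQ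

/-- A quotient has (X + X + 1) + X bits. Array 16 starts at 0, so its bit bound holds also when no
coordinate limits the step. -/
theorem runs_findStep (P : I.Params X M K) (hσ : I.Loaded σ)
    (hz : ∀ j < n, FitsBits X (σ.cell 10 j 0)) (ht : ∀ j < n, FitsBits X (σ.cell 11 j 0))
    (hd : ∀ j < n, FitsBits X (σ.cell 15 j 0))
    (hQ : ∀ τ, σ.Agree [16] [9] τ → FitsBits (3 * X + 1) (τ.cell 16 0 0) →
      (τ.ctr 9 = 0 ∧ ∀ j : Fin n, ¬ 0 < (σ.cell 11 j 0 - σ.cell 10 j 0) * σ.cell 15 j 0) ∨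
      (τ.ctr 9 = 1 ∧ IsFirstHit (fun j : Fin n => σ.cell 10 j 0) (fun j => σ.cell 11 j 0)
        (fun j => σ.cell 15 j 0) (τ.cell 16 0 0)) → Q τ) :
    Runs ans M K findStep σ Q := by
  refine Runs.seq (Runs.setCtr (by simp) (Runs.seq (Runs.setCell
    (by simpa using P.ratSize_le (fitsBits_zero 0) (by omega)) ?_)))
  refine Runs.for (fun i τ => σ.Agree [16] [9] τ ∧ FitsBits (3 * X + 1) (τ.cell 16 0 0) ∧
    ((τ.ctr 9 = 0 ∧ ∀ j < i, ¬ 0 < (σ.cell 11 j 0 - σ.cell 10 j 0) * σ.cell 15 j 0) ∨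
      (τ.ctr 9 = 1 ∧ (∃ j < n, 0 < (σ.cell 11 j 0 - σ.cell 10 j 0) * σ.cell 15 j 0 ∧
        τ.cell 16 0 0 = (σ.cell 11 j 0 - σ.cell 10 j 0) / σ.cell 15 j 0) ∧
        ∀ j < i, 0 < (σ.cell 11 j 0 - σ.cell 10 j 0) * σ.cell 15 j 0 →
          τ.cell 16 0 0 ≤ (σ.cell 11 j 0 - σ.cell 10 j 0) / σ.cell 15 j 0))) (by decide)
    (fun i τ h => (h.1.2 1 (by decide)).trans hσ.ctr1) P.nM P.nK (by simpa using hσ.ctr5)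
    ⟨⟨fun v hv a b => by simp at hv; simp [hv], fun c hc => by simp at hc; simp [hc]⟩,
      by simpa using fitsBits_zero _, by simp⟩ ?_ ?_
  · rintro i hi τ hτ5 ⟨hA, hfit, hI⟩
    have h10 : ∀ a b, τ.cell 10 a b = σ.cell 10 a b := hA.1 10 (by decide)
    have h11 : ∀ a b, τ.cell 11 a b = σ.cell 11 a b := hA.1 11 (by decide)
    have h15 : ∀ a b, τ.cell 15 a b = σ.cell 15 a b := hA.1 15 (by decide)
    have hratio : stepRatio.eval (τ.setCtr 5 i) =
        (σ.cell 11 i 0 - σ.cell 10 i 0) / σ.cell 15 i 0 := by simp [h10, h11, h15]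
    have hrfit : FitsBits (3 * X + 1) ((σ.cell 11 i 0 - σ.cell 10 i 0) / σ.cell 15 i 0) :=
      (((ht i hi).sub (hz i hi)).div (hd i hi)).mono (by omega)
    have hback : (τ.setCtr 5 i).setCtr 5 0 = τ := by
      rw [Store.setCtr_setCtr, Store.setCtr_of_eq hτ5]
    refine Runs.ite (fun hp => Runs.ite (fun hq => ?_) (fun hq => Runs.skip ?_))
      (fun hp => Runs.skip ?_)
    · simp [h10, h11, h15] at hp hq
      refine Runs.seq (Runs.setCell (by rw [hratio]; exact P.ratSize_le hrfit (by omega)) ?_)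
      rw [hratio]
      refine Runs.setCtr (by simp; have := P.MK; omega) ⟨by simp, ⟨fun v hv a b => ?_,
        fun c hc => ?_⟩, by simpa using hrfit, Or.inr ⟨by simp, ⟨i, hi, hp, by simp⟩, ?_⟩⟩
      · simp at hv
        simp [hv, hA.1]
      · simp at hc
        by_cases h5 : c = 5
        · simp [h5, hσ.ctr5]
        · simp [h5, hc, hA.2]
      · intro j hj hpos
        simp only [Store.setCtr_cell, Store.setCell_cell, IExpr.eval, and_self, if_true]
        rcases Nat.lt_succ_iff_lt_or_eq.1 hj with hlt | rfl
        · rcases hI with hI | hI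
          · exact absurd hpos (hI.2 j hlt)
          · exact ((hq.resolve_left (by omega)).le).trans (hI.2.2 j hlt hpos)
        · exact le_rfl
    · simp [h10, h11, h15] at hp hq
      rw [hback]
      refine ⟨by simp, hA, hfit, Or.inr ?_⟩
      rcases hI with hI | hI
      · omega
      · refine ⟨hI.1, hI.2.1, fun j hj hpos => ?_⟩
        rcases Nat.lt_succ_iff_lt_or_eq.1 hj with hlt | rfl
        · exact hI.2.2 j hlt hpos
        · exact hq.2
    · simp [h10, h11, h15] at hp
      rw [hback]
      refine ⟨by simp, hA, hfit, hI.imp (fun h => ⟨h.1, fun j hj => ?_⟩)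
        (fun h => ⟨h.1, h.2.1, fun j hj hpos => ?_⟩)⟩
      · rcases Nat.lt_succ_iff_lt_or_eq.1 hj with hlt | rfl
        · exact h.2 j hlt
        · exact hp.not_gt
      · rcases Nat.lt_succ_iff_lt_or_eq.1 hj with hlt | rfl
        · exact h.2.2 j hlt hpos
        · exact absurd hpos hp.not_gt
  · rintro τ _ ⟨hA, hfit, hI⟩
    refine hQ τ hA hfit (hI.imp (fun h => ⟨h.1, fun j => h.2 j j.2⟩) fun h => ⟨h.1, ?_, ?_⟩)
    · obtain ⟨j, hj, hpos, hval⟩ := h.2.1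
      exact ⟨⟨j, hj⟩, hpos, hval⟩
    · exact fun j hpos => h.2.2 j j.2 hpos

theorem runs_applyStep (P : I.Params X M K) (hσ : I.Loaded σ)
    (hz : ∀ j < n, FitsBits X (σ.cell 10 j 0)) (ha : FitsBits (3 * X + 1) (σ.cell 16 0 0))
    (hd : ∀ j < n, FitsBits X (σ.cell 15 j 0))
    (hQ : Q (σ.fillCol 10 n fun j => σ.cell 10 j 0 + σ.cell 16 0 0 * σ.cell 15 j 0)) :
    Runs ans M K applyStep σ Q :=
  Runs.fillCol _ (by decide) hσ.ctr1 P.nM P.nK hσ.ctr5 (by simp)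
    (fun i hi => P.ratSize_le ((hz i hi).add (ha.mul (hd i hi))) (by omega)) hQ

theorem LP.fitsBits_l (I : LP m n) (hX : I.size ≤ X) (j : Fin n) : FitsBits X (I.l j : ℚ) :=
  fitsBits_of_ratSize_le ((I.ratSize_l_le j).trans hX)

theorem LP.fitsBits_u (I : LP m n) (hX : I.size ≤ X) (j : Fin n) : FitsBits X (I.u j : ℚ) :=
  fitsBits_of_ratSize_le ((I.ratSize_u_le j).trans hX)

theorem LP.fitsBits_w (I : LP m n) (hX : I.size ≤ X) (j : Fin n) : FitsBits X (I.w j : ℚ) :=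
  fitsBits_of_ratSize_le ((I.ratSize_w_le j).trans hX)

/-- The step taken by `takeStep`, if the direction is admissible. -/
theorem runs_takeStep (P : I.Params X M K) (hσ : I.Loaded σ) {x d : Fin n → ℚ}
    (hx : ∀ j : Fin n, σ.cell 6 (σ.ctr 2) j = x j) (hdσ : ∀ j : Fin n, σ.cell 15 j 0 = d j)
    (hxX : ∀ j, FitsBits X (x j)) (hdX : ∀ j, FitsBits X (d j)) (hs : σ.ctr 2 < M)
    (hin : ∀ j, d j ≠ 0 → 0 < (I.target d j - x j) * d j) (hne : ∃ j, d j ≠ 0)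
    (hQ : ∀ τ a, σ.Agree [6, 10, 11, 16] [2, 9] τ → IsFirstHit x (I.target d) d a →
      τ.ctr 2 = σ.ctr 2 + 1 → (∀ j : Fin n, τ.cell 6 (σ.ctr 2 + 1) j = x j + a * d j) →
      (∀ k ≤ σ.ctr 2, ∀ j, τ.cell 6 k j = σ.cell 6 k j) → Q τ) :
    Runs ans M K takeStep σ Q := by
  have hxn : ∀ j < n, FitsBits X (σ.cell 6 (σ.ctr 2) j) := fun j hj => by
    rw [hx ⟨j, hj⟩]; exact hxX _
  have hdn : ∀ j < n, FitsBits X (σ.cell 15 j 0) := fun j hj => by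
    rw [hdσ ⟨j, hj⟩]; exact hdX _
  have hln : ∀ j < n, FitsBits X (σ.cell 3 j 0) := fun j hj => by
    rw [hσ.l ⟨j, hj⟩]; exact I.fitsBits_l P.sizeX _
  have hun : ∀ j < n, FitsBits X (σ.cell 4 j 0) := fun j hj => by
    rw [hσ.u ⟨j, hj⟩]; exact I.fitsBits_u P.sizeX _
  refine Runs.seq (Runs.fillCol (fun j => σ.cell 6 (σ.ctr 2) j) (by decide) hσ.ctr1 P.nM P.nK
    hσ.ctr5 (by simp) (fun j hj => P.ratSize_le (hxn j hj) (by omega)) (Runs.seq ?_))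
  set f : ℕ → ℚ := fun j => if 0 < σ.cell 15 j 0 then σ.cell 4 j 0 else σ.cell 3 j 0 with hf
  have hfn : ∀ j < n, FitsBits X (f j) := fun j hj => by
    rw [hf]; dsimp only; split_ifs
    exacts [hun j hj, hln j hj]
  refine Runs.fillCol' (v := 11) f (by decide) (by simpa using hσ.ctr1) P.nM P.nK
    (by simpa using hσ.ctr5) (fun i hi => ?_) (Runs.seq ?_)
  · refine Runs.ite (fun hp => Runs.setCell ?_ ?_) (fun hp => Runs.setCell ?_ ?_)
    · simpa using P.ratSize_le (hun i hi) (by omega)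
    · simp at hp
      simp [hf, hp]
    · simpa using P.ratSize_le (hln i hi) (by omega)
    · simp at hp
      simp [hf, hp.not_gt]
  set σ₁ := (σ.fillCol 10 n fun j => σ.cell 6 (σ.ctr 2) j).fillCol 11 n f with hσ₁
  have hA₁ : σ.Agree [6, 10, 11, 16] [2, 9] σ₁ :=
    ⟨fun v hv a b => by simp at hv; simp [hσ₁, hv], fun c hc => by simp [hσ₁]⟩
  have e10 : ∀ j < n, σ₁.cell 10 j 0 = σ.cell 6 (σ.ctr 2) j := fun j hj => by simp [hσ₁, hj]
  have e11 : ∀ j < n, σ₁.cell 11 j 0 = f j := fun j hj => by simp [hσ₁, hj]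
  have e15 : ∀ j, σ₁.cell 15 j 0 = σ.cell 15 j 0 := fun j => by simp [hσ₁]
  have e6 : ∀ k j, σ₁.cell 6 k j = σ.cell 6 k j := fun j => by simp [hσ₁]
  have ectr : σ₁.ctr = σ.ctr := rfl
  clear_value σ₁
  have hL₁ : I.Loaded σ₁ := hσ.of_agree hA₁
  refine runs_findStep P hL₁ (fun j hj => by rw [e10 j hj]; exact hxn j hj)
    (fun j hj => by rw [e11 j hj]; exact hfn j hj) (fun j hj => by rw [e15]; exact hdn j hj)
    fun σ₂ hA₂ hfit₂ hcase => Runs.seq ?_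
  have hz : (fun j : Fin n => σ₁.cell 10 j 0) = x := funext fun j => by rw [e10 j j.2, hx]
  have ht : (fun j : Fin n => σ₁.cell 11 j 0) = I.target d := funext fun j => by
    rw [e11 j j.2, hf]
    simp only [hdσ, hσ.u, hσ.l, LP.target]
  have hd : (fun j : Fin n => σ₁.cell 15 j 0) = d := funext fun j => by rw [e15, hdσ]
  -- The search cannot end without a hit: some coordinate moves, and by `hin` it has room.
  have hhit : IsFirstHit x (I.target d) d (σ₂.cell 16 0 0) := by
    rcases hcase with h | h
    · obtain ⟨j, hj⟩ := hne
      refine absurd ?_ (h.2 j)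
      have := hin j hj
      rwa [← congrFun ht j, ← congrFun hz j, ← congrFun hd j] at this
    · rw [hz, ht, hd] at h
      exact h.2
  have hL₂ : I.Loaded σ₂ := hL₁.of_agree hA₂
  refine runs_applyStep P hL₂ ?_ hfit₂ ?_ (Runs.seq ?_)
  · intro j hj
    rw [hA₂.1 10 (by decide), e10 j hj]; exact hxn j hj
  · intro j hj
    rw [hA₂.1 15 (by decide), e15]; exact hdn j hj
  have hval : ∀ j : Fin n, σ₂.cell 10 j 0 + σ₂.cell 16 0 0 * σ₂.cell 15 j 0 =
      x j + σ₂.cell 16 0 0 * d j := fun j => by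
    rw [hA₂.1 10 (by decide), hA₂.1 15 (by decide), e10 j j.2, e15, hx, hdσ]
  have hc2 : σ₂.ctr 2 = σ.ctr 2 := by rw [hA₂.2 2 (by decide), ectr]
  refine Runs.fillRow (r := σ.ctr 2 + 1)
    (fun j => σ₂.cell 10 j 0 + σ₂.cell 16 0 0 * σ₂.cell 15 j 0) (by decide)
    (by simpa using hL₂.ctr1) P.nM P.nK (by simpa using hL₂.ctr5) (by simp [hc2])
    (by simp +contextual) ?_ (Runs.setCtr ?_ (hQ _ (σ₂.cell 16 0 0) ⟨?_, ?_⟩ hhit ?_ ?_ ?_))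
  · intro j hj
    have h1 := hxX ⟨j, hj⟩
    have h2 := hdX ⟨j, hj⟩
    have := hval ⟨j, hj⟩
    simp only at this
    rw [this]
    exact P.ratSize_le (h1.add (hfit₂.mul h2)) (by omega)
  · simp [hc2]; have := P.MK; omega
  · intro v hv a b
    simp at hv
    simp only [Store.setCtr_cell, Store.fillRow_cell, Store.fillCol_cell, hv, false_and, if_false]
    rw [hA₂.1 v (by simp [hv]), hA₁.1 v (by simp [hv])]
  · intro c hc
    simp at hc
    simp only [Store.setCtr_ctr, if_neg hc.1, Store.fillRow_ctr, Store.fillCol_ctr]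
    rw [hA₂.2 c (by simp [hc]), ectr]
  · simp [hc2]
  · intro j
    simpa using hval j
  · intro k hk j
    have : k ≠ σ.ctr 2 + 1 := by omega
    simp [this, hA₂.1 6, e6]

end Moves

/-! ### Computing a conformal circuit -/

/-- The difference of the optimal solution and the current point. -/
abbrev gapAt : QExpr := .sub (vecAt 7 5) currentAt

/-- The determinant that decides in which of the two directions the relative objective value
increases. -/
abbrev ratioDet : QExpr :=
  .sub (.mul (scalar 21) (scalar 18)) (.mul (scalar 19) (scalar 20))

/-- The direction in array 15 is negated if the opposite one is the better one. -/
def orient : Prog :=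
  .ite (.ltQ ratioDet (.const 0)) negate
    (.ite (.and (.not (.ltQ (.const 0) ratioDet)) (.ltQ (scalar 20) (.const 0))) negate .skip)

/-- Reduces the support of the vector in array 10, or finds a conformal circuit. -/
def reduceSupport : Prog :=
  .seq (forLoop 5 (.ctr 1) (.setCell 12 (.ctr 5) (.const 0) (vecAt 10 5))) (.seq findDirection
    (.seq (sumInto 18 (.div (vecAt 10 5) gapAt)) (.seq (sumInto 19 (.mul (vecAt 2 5) (vecAt 10 5)))
    (.seq (sumInto 20 (.div (vecAt 15 5) gapAt)) (.seq (sumInto 21 (.mul (vecAt 2 5) (vecAt 15 5)))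
    (.seq orient (.seq findStep (.seq applyStep
    (.ite (.ltI (.ctr 9) (.const 1)) (.setCtr 3 (.const 0)) .skip)))))))))

/-- Array 15 becomes a circuit in the orthant of the optimal solution seen from the current
point. -/
def conformalCircuit : Prog :=
  .seq (forLoop 5 (.ctr 1) (.setCell 10 (.ctr 5) (.const 0) gapAt)) (.seq
    (forLoop 5 (.ctr 1) (.setCell 11 (.ctr 5) (.const 0) (.const 0))) (.seq
    (.setCtr 3 (.const 1)) (.while (.ltI (.const 0) (.ctr 3)) reduceSupport)))

/-! ### Correctness of the search for a conformal circuit -/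

section ConformalCircuit

variable {m n : ℕ} {I : LP m n} {ans : Fin n → ℚ} {X M K : ℕ} {σ : Store} {Q : Store → Prop}

theorem LP.IsDirection.fitsBits {S : Set (Fin n)} {d : Fin n → ℚ} (h : I.IsDirection S d)
    (hX : I.size ≤ X) (j : Fin n) : FitsBits X (d j) :=
  ((h.den.mono (detBound_le I)).fitsBits j).mono hX

theorem ratioSum_neg (h d : Fin n → ℚ) : ratioSum h (fun j => -d j) = -ratioSum h d := by
  simp [ratioSum, neg_div]

/-- Passing to -d negates both the determinant and `ratioSum h d`, so d or -d satisfies `Improves`.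
-/
theorem runs_orient (P : I.Params X M K) (hσ : I.Loaded σ) {h y d : Fin n → ℚ}
    (hdσ : ∀ j : Fin n, σ.cell 15 j 0 = d j) {S : Set (Fin n)} (hd : I.IsDirection S d)
    (h18 : σ.cell 18 0 0 = ratioSum h y) (h19 : σ.cell 19 0 0 = I.objQ y)
    (h20 : σ.cell 20 0 0 = ratioSum h d) (h21 : σ.cell 21 0 0 = I.objQ d)
    (hQ : ∀ τ d', σ.Agree [15] [] τ → (∀ j : Fin n, τ.cell 15 j 0 = d' j) →
      I.IsDirection S d' → I.Improves h y d' → Q τ) : Runs ans M K orient σ Q := by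
  have hneg : ∀ Q : Store → Prop, Q (σ.fillCol 15 n fun j => -σ.cell 15 j 0) →
      Runs ans M K negate σ Q := fun Q hQ => runs_negate P hσ (fun j hj => by
    rw [hdσ ⟨j, hj⟩]; exact hd.fitsBits P.sizeX _) hQ
  have hA : σ.Agree [15] [] (σ.fillCol 15 n fun j => -σ.cell 15 j 0) :=
    ⟨fun v hv a b => by simp at hv; simp [hv], by simp⟩
  refine Runs.ite (fun hp => hneg _ (hQ _ (fun j => -d j) hA (by simp [hdσ]) hd.neg ?_))
    fun hp => Runs.ite (fun hq => hneg _ (hQ _ (fun j => -d j) hA (by simp [hdσ]) hd.neg ?_))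
      fun hq => Runs.skip (hQ _ d (.refl _ _ _) hdσ hd ?_)
  · simp [h18, h19, h20, h21] at hp
    left
    rw [I.objQ_neg, ratioSum_neg]
    linarith
  · simp [h18, h19, h20, h21] at hp hq
    right
    rw [I.objQ_neg, ratioSum_neg]
    constructor <;> linarith [hq.1, hq.2]
  · simp [h18, h19, h20, h21] at hp hq
    rcases hp.lt_or_eq with hlt | heq
    · left; linarith
    · right; exact ⟨by linarith, hq heq.ge⟩

/-- Each round either moves y to its next zero coordinate (`advance`) or meets a direction that
opposes no coordinate of y and stops (`isGoodDirection`). -/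
theorem runs_conformalCircuit (P : I.Params X M K) (hσ : I.Loaded σ) {x xhat : Fin n → ℚ}
    (hx : ∀ j : Fin n, σ.cell 6 (σ.ctr 2) j = x j) (hhat : ∀ j : Fin n, σ.cell 7 j 0 = xhat j)
    (hxX : ∀ j, FitsBits X (x j)) (hhatX : ∀ j, FitsBits X (xhat j)) {κ : ℕ}
    (hκ : HasDenominator (2 ^ κ) fun j => xhat j - x j)
    (hκX : κ + n * (2 * I.size + 2) ≤ X)
    (hker : InKer I.A fun j => xhat j - x j) (hgap : 0 < I.objQ fun j => xhat j - x j)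
    (hQ : ∀ τ d g, σ.Agree [10, 11, 12, 13, 14, 15, 16, 17, 18, 19, 20, 21] [3, 7, 8, 9] τ →
      (∀ j : Fin n, τ.cell 15 j 0 = d j) → I.IsGoodDirection (fun j => xhat j - x j) d g →
      IsCircuitMultiple I.A (toReal d) → HasDenominator (detBound I.A) d → Q τ) :
    Runs ans M K conformalCircuit σ Q := by
  set h : Fin n → ℚ := fun j => xhat j - x j with hh
  have hxn : ∀ j < n, FitsBits X (σ.cell 6 (σ.ctr 2) j) := fun j hj => by
    rw [hx ⟨j, hj⟩]; exact hxX _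
  have hhatn : ∀ j < n, FitsBits X (σ.cell 7 j 0) := fun j hj => by
    rw [hhat ⟨j, hj⟩]; exact hhatX _
  have hwn : ∀ j < n, FitsBits X (σ.cell 2 j 0) := fun j hj => by
    rw [hσ.w ⟨j, hj⟩]; exact I.fitsBits_w P.sizeX _
  have hhn : ∀ j : Fin n, σ.cell 7 j 0 - σ.cell 6 (σ.ctr 2) j = h j := fun j => by
    rw [hx, hhat]
  have hhfit : ∀ j < n, FitsBits (2 * X + 1) (σ.cell 7 j 0 - σ.cell 6 (σ.ctr 2) j) := fun j hj =>
    ((hhatn j hj).sub (hxn j hj)).mono (by omega)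
  have hne : ∃ j, h j ≠ 0 := by
    by_contra hcon
    push Not at hcon
    simp [LP.objQ, hcon] at hgap
  refine Runs.seq (Runs.fillCol (fun j => σ.cell 7 j 0 - σ.cell 6 (σ.ctr 2) j) (by decide) hσ.ctr1
    P.nM P.nK hσ.ctr5 (by simp) (fun j hj => P.ratSize_le (hhfit j hj) (by omega)) (Runs.seq ?_))
  refine Runs.fillCol (fun _ => 0) (by decide) (by simpa using hσ.ctr1) P.nM P.nK
    (by simpa using hσ.ctr5) (by simp) (fun j hj => P.ratSize_le (fitsBits_zero 0) (by omega))
    (Runs.seq (Runs.setCtr (by simp; have := P.MK; omega) ?_))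
  -- The support of y bounds the rounds to go. The number e of moves made satisfies e + |supp y| ≤
  -- n, which caps the bits of y at κ + n (2 size + 2).
  refine Runs.while (fun k τ =>
    σ.Agree [10, 11, 12, 13, 14, 15, 16, 17, 18, 19, 20, 21] [3, 7, 8, 9] τ ∧
    (∀ j : Fin n, τ.cell 11 j 0 = 0) ∧
    ((τ.ctr 3 = 1 ∧ ∃ y : Fin n → ℚ, (∀ j : Fin n, τ.cell 10 j 0 = y j) ∧ I.IsConformalPart h y ∧
      {j | y j ≠ 0}.ncard ≤ k ∧ ∃ e, e + {j | y j ≠ 0}.ncard ≤ n ∧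
        HasDenominator (2 ^ (κ + e * (2 * I.size + 2))) y) ∨
    (τ.ctr 3 = 0 ∧ ∃ d g, (∀ j : Fin n, τ.cell 15 j 0 = d j) ∧ I.IsGoodDirection h d g ∧
      IsCircuitMultiple I.A (toReal d) ∧ HasDenominator (detBound I.A) d))) ?_ ?_ P.nM
    ⟨⟨fun v hv a b => ?_, fun c hc => ?_⟩, by simp, Or.inl ⟨by simp, h, by simp [hx, hhat, hh],
      .self hker hne, ?_, 0, ?_, by simpa using hκ⟩⟩
  · rintro k τ ⟨hA, h11, hcase⟩ hp
    replace hp : ¬ 0 < τ.ctr 3 := of_decide_eq_false hp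
    obtain ⟨d, g, h15, hg, hc, hden⟩ := (hcase.resolve_left fun h => by have := h.1; omega).2
    exact hQ τ d g hA h15 hg hc hden
  · rintro k τ ⟨hA, h11, hcase⟩ hp
    replace hp : 0 < τ.ctr 3 := of_decide_eq_true hp
    obtain ⟨h3, y, hy, hpart, hcard, e, he, hden⟩ := hcase.resolve_right fun h => by have := h.1; omega
    have hτ : I.Loaded τ := hσ.of_agree hA
    have hcpos : 0 < {j | y j ≠ 0}.ncard := by
      rw [Set.ncard_pos]; exact hpart.ne
    have heX : κ + e * (2 * I.size + 2) ≤ X :=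
      le_trans (by gcongr; omega) hκX
    have hyX : ∀ j, FitsBits X (y j) := fun j => (hden.fitsBits j).mono heX
    have hyn : ∀ j < n, FitsBits X (τ.cell 10 j 0) := fun j hj => by
      rw [hy ⟨j, hj⟩]; exact hyX _
    have hyobj : ∃ j, toReal y j ≠ 0 := by
      obtain ⟨j, hj⟩ := hpart.ne
      exact ⟨j, by simpa [toReal] using hj⟩
    refine ⟨by omega, ?_⟩
    refine Runs.seq (Runs.fillCol (fun j => τ.cell 10 j 0) (by decide) hτ.ctr1 P.nM P.nK hτ.ctr5
      (by simp) (fun j hj => P.ratSize_le (hyn j hj) (by omega)) (Runs.seq ?_))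
    have hA₁ : τ.Agree [12] [] (τ.fillCol 12 n fun j => τ.cell 10 j 0) :=
      ⟨fun v hv a b => by simp at hv; simp [hv], by simp⟩
    have hS : {j : Fin n | (τ.fillCol 12 n fun j => τ.cell 10 j 0).cell 12 j 0 ≠ 0} =
        {j | y j ≠ 0} := by
      ext j; simp [hy]
    generalize (τ.fillCol 12 n fun j => τ.cell 10 j 0) = τ₁ at hA₁ hS ⊢
    have hτ₁ := hτ.of_agree hA₁
    refine runs_findDirection P hτ₁ fun τ₂ hA₂ hcase₂ => ?_
    rw [hS] at hcase₂
    rcases hcase₂ with ⟨-, hzero⟩ | ⟨-, hdir⟩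
    -- A direction exists, since y itself is a nonzero kernel vector with this support.
    · have := hzero (toReal y) (inKer_iff.1 hpart.inKer) fun j hj => by
        simpa [toReal] using hj
      obtain ⟨j, hj⟩ := hyobj
      exact absurd (congrFun this j) hj
    replace hA₂ : τ.Agree [12, 13, 14, 15, 16, 17, 18, 19, 20, 21] [7, 8, 9] τ₂ :=
      (hA₁.mono (by decide) (by decide)).trans (hA₂.mono (by decide) (by decide))
    set d := fun j : Fin n => τ₂.cell 15 j 0 with hd
    have hd₂ : ∀ j : Fin n, τ₂.cell 15 j 0 = d j := fun j => rfl
    clear_value d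
    have hdn : ∀ j < n, FitsBits X (τ₂.cell 15 j 0) := fun j hj => by
      rw [hd₂ ⟨j, hj⟩]; exact hdir.fitsBits P.sizeX _
    have hτ₂ := hτ.of_agree hA₂
    refine Runs.seq (runs_sumInto P hτ₂
      (fun j => τ.cell 10 j 0 / (σ.cell 7 j 0 - σ.cell 6 (σ.ctr 2) j))
      ?_ (fun j hj => ((hyn j hj).div (hhfit j hj)).mono (by omega)) fun τ₃ hA₃ h18 => ?_)
    · intro i hi s
      simp [hA₂.1, hA₂.2, hA.1, hA.2]
    have hτ₃ := hτ₂.of_agree hA₃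
    replace h18 : τ₃.cell 18 0 0 = ratioSum h y := by
      rw [h18, Finset.sum_range]
      exact Finset.sum_congr rfl fun j _ => by rw [hhn, hy]
    refine Runs.seq (runs_sumInto P hτ₃ (fun j => σ.cell 2 j 0 * τ.cell 10 j 0)
      ?_ (fun j hj => ((hwn j hj).mul (hyn j hj)).mono (by omega)) fun τ₄ hA₄ h19 => ?_)
    · intro i hi s
      simp [hA₃.1, hA₂.1, hA.1]
    have hτ₄ := hτ₃.of_agree hA₄
    replace h19 : τ₄.cell 19 0 0 = I.objQ y := by
      rw [h19, Finset.sum_range]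
      exact Finset.sum_congr rfl fun j _ => by rw [hσ.w, hy]
    refine Runs.seq (runs_sumInto P hτ₄
      (fun j => τ₂.cell 15 j 0 / (σ.cell 7 j 0 - σ.cell 6 (σ.ctr 2) j))
      ?_ (fun j hj => ((hdn j hj).div (hhfit j hj)).mono (by omega)) fun τ₅ hA₅ h20 => ?_)
    · intro i hi s
      simp [hA₄.1, hA₄.2, hA₃.1, hA₃.2, hA₂.1, hA₂.2, hA.1, hA.2]
    have hτ₅ := hτ₄.of_agree hA₅
    replace h20 : τ₅.cell 20 0 0 = ratioSum h d := by
      rw [h20, Finset.sum_range]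
      exact Finset.sum_congr rfl fun j _ => by rw [hhn, hd₂]
    refine Runs.seq (runs_sumInto P hτ₅ (fun j => σ.cell 2 j 0 * τ₂.cell 15 j 0)
      ?_ (fun j hj => ((hwn j hj).mul (hdn j hj)).mono (by omega)) fun τ₆ hA₆ h21 => ?_)
    · intro i hi s
      simp [hA₅.1, hA₄.1, hA₃.1, hA₂.1, hA.1]
    have hτ₆ := hτ₅.of_agree hA₆
    replace h21 : τ₆.cell 21 0 0 = I.objQ d := by
      rw [h21, Finset.sum_range]
      exact Finset.sum_congr rfl fun j _ => by rw [hσ.w, hd₂]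
    have hA₂₆ : τ₂.Agree [18, 19, 20, 21] [] τ₆ :=
      (((hA₃.mono (by decide) (by decide)).trans (hA₄.mono (by decide) (by decide))).trans
        (hA₅.mono (by decide) (by decide))).trans (hA₆.mono (by decide) (by decide))
    refine Runs.seq (runs_orient P hτ₆ (h := h) (y := y) (d := d)
      (fun j => by rw [hA₂₆.1 15 (by decide), hd₂]) hdir
      (by rw [hA₆.1 18 (by decide), hA₅.1 18 (by decide), hA₄.1 18 (by decide), h18])
      (by rw [hA₆.1 19 (by decide), hA₅.1 19 (by decide), h19])
      (by rw [hA₆.1 20 (by decide), h20]) h21 fun τ₇ d' hA₇ hd' hdir' himp => ?_)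
    have hA₀₇ : τ.Agree [12, 13, 14, 15, 16, 17, 18, 19, 20, 21] [7, 8, 9] τ₇ :=
      (hA₂.trans (hA₂₆.mono (by decide) (by decide))).trans (hA₇.mono (by decide) (by decide))
    have hτ₇ := hτ.of_agree hA₀₇
    have hd'n : ∀ j < n, FitsBits X (τ₇.cell 15 j 0) := fun j hj => by
      rw [hd' ⟨j, hj⟩]; exact hdir'.fitsBits P.sizeX _
    have e10 : ∀ a b, τ₇.cell 10 a b = τ.cell 10 a b := hA₀₇.1 10 (by decide)
    have e11 : ∀ j : Fin n, τ₇.cell 11 j 0 = 0 := fun j => by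
      rw [hA₀₇.1 11 (by decide), h11]
    refine Runs.seq (runs_findStep P hτ₇ (fun j hj => by rw [e10]; exact hyn j hj)
      (fun j hj => by rw [e11 ⟨j, hj⟩]; exact fitsBits_zero _) hd'n fun τ₈ hA₈ hfit₈ hcase₈ => ?_)
    have hz : (fun j : Fin n => τ₇.cell 10 j 0) = y := funext fun j => by rw [e10, hy]
    have ht : (fun j : Fin n => τ₇.cell 11 j 0) = 0 := funext fun j => e11 j
    have hdd : (fun j : Fin n => τ₇.cell 15 j 0) = d' := funext hd'
    have hτ₈ := hτ₇.of_agree hA₈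
    have f10 : ∀ a b, τ₈.cell 10 a b = τ.cell 10 a b := fun a b => by
      rw [hA₈.1 10 (by decide), e10]
    have f15 : ∀ a b, τ₈.cell 15 a b = τ₇.cell 15 a b := hA₈.1 15 (by decide)
    -- The move is executed also without a hit. It changes array 10 only, which the invariant no
    -- longer mentions once counter 3 is zero.
    refine Runs.seq (runs_applyStep P hτ₈ (fun j hj => by rw [f10]; exact hyn j hj) hfit₈
      (fun j hj => by rw [f15]; exact hd'n j hj) ?_)
    have hA₀₈ : τ.Agree [12, 13, 14, 15, 16, 17, 18, 19, 20, 21] [7, 8, 9] τ₈ :=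
      hA₀₇.trans (hA₈.mono (by decide) (by decide))
    have hA₉ : σ.Agree [10, 11, 12, 13, 14, 15, 16, 17, 18, 19, 20, 21] [3, 7, 8, 9]
        (τ₈.fillCol 10 n fun j => τ₈.cell 10 j 0 + τ₈.cell 16 0 0 * τ₈.cell 15 j 0) := by
      refine hA.trans ((hA₀₈.mono (by decide) (by decide)).trans ⟨fun v hv a b => ?_, by simp⟩)
      simp at hv
      simp [hv]
    refine Runs.ite (fun hp => Runs.setCtr (by simp) ⟨?_, ?_, Or.inr ⟨by simp, ?_⟩⟩)
      (fun hp => Runs.skip ⟨hA₉, ?_, Or.inl ⟨?_, ?_⟩⟩)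
    · refine hA₉.trans ⟨by simp, fun c hc => ?_⟩
      simp at hc
      simp [hc]
    · intro j
      simp [hA₈.1 11, e11]
    · simp at hp
      obtain ⟨-, hun⟩ := hcase₈.resolve_right (by omega)
      refine ⟨d', _, by simp [f15, hd'], hpart.isGoodDirection hdir' himp (fun j => ?_) hgap,
        hdir'.circuit, hdir'.den⟩
      have := hun j
      rwa [e11, e10, hy, hd'] at this
    · intro j
      simp [hA₈.1 11, e11]
    · simp only [Store.fillCol_ctr]
      rw [hA₀₈.2 3 (by decide), h3]
    · simp at hp
      obtain ⟨-, hhit⟩ := hcase₈.resolve_left (by omega)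
      rw [hz, ht, hdd] at hhit
      obtain ⟨hpart', hss⟩ := hpart.advance hdir' himp hhit
      have hlt := Set.ncard_lt_ncard hss (Set.toFinite _)
      refine ⟨fun j => y j + τ₈.cell 16 0 0 * d' j, ?_, hpart', by dsimp only; omega, e + 1,
        by dsimp only; omega, ?_⟩
      · intro j
        simp [f10, f15, hy, hd']
      · have := hden.move (hdir'.den.mono (detBound_le I)) (t := 0)
          (fun j => ⟨0, by simp, by simp⟩) hhit
        convert this using 2
        ring
  · simp at hv
    simp [hv]
  · simp at hc
    simp [hc]
  · exact (Set.ncard_le_card _).trans (by simp)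
  · simpa using (Set.ncard_le_card {j | h j ≠ 0}).trans (by simp)

end ConformalCircuit

section Walks

variable {m n : ℕ}

/-! ### Sequences of steps -/

/-- The steps `k < r` are maximal circuit steps that improve the objective value, along circuits
that are conformal to the optimal solution as seen from the current point. -/
def LP.PhaseOne (I : LP m n) (xhat : Fin n → ℚ) (p : ℕ → Fin n → ℚ) (r : ℕ) : Prop :=
  ∀ k < r, (I.obj (toReal (p k)) < I.obj (toReal (p (k + 1))) ∧
      I.IsCircuitStep (toReal (p k)) (toReal (p (k + 1)))) ∧
    (∃ c : Fin n → ℝ, IsCircuitMultiple I.A c ∧ Conformal c (toReal xhat - toReal (p k)) ∧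
      ∃ β : ℝ, 1 ≤ β ∧ toReal (p (k + 1)) - toReal (p k) = β • c) ∧
    (1 / (n : ℝ)) * (I.obj (toReal xhat) - I.obj (toReal (p k))) ≤
      I.obj (toReal (p (k + 1))) - I.obj (toReal (p k))

/-- The steps `r ≤ k < s` are maximal circuit steps to proper faces, and improve the objective
value unless it is constant on the current face. -/
def LP.PhaseTwo (I : LP m n) (p : ℕ → Fin n → ℚ) (r s : ℕ) : Prop :=
  ∀ k, r ≤ k → k < s → I.IsCircuitStep (toReal (p k)) (toReal (p (k + 1))) ∧
    I.minFace (toReal (p (k + 1))) ⊂ I.minFace (toReal (p k)) ∧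
    (I.obj (toReal (p k)) < I.obj (toReal (p (k + 1))) ∨
      I.ObjVanishes (toReal (p k)) ∧ I.obj (toReal (p k)) ≤ I.obj (toReal (p (k + 1))))

theorem LP.PhaseOne.congr {I : LP m n} {xhat : Fin n → ℚ} {p p' : ℕ → Fin n → ℚ} {r : ℕ}
    (h : I.PhaseOne xhat p r) (hp : ∀ k ≤ r, p' k = p k) : I.PhaseOne xhat p' r := by
  intro k hk
  rw [hp k hk.le, hp (k + 1) hk]
  exact h k hk

theorem LP.PhaseTwo.congr {I : LP m n} {p p' : ℕ → Fin n → ℚ} {r s : ℕ}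
    (h : I.PhaseTwo p r s) (hp : ∀ k ≤ s, p' k = p k) : I.PhaseTwo p' r s := by
  intro k hrk hk
  rw [hp k hk.le, hp (k + 1) hk]
  exact h k hrk hk

/-- From r on the objective never decreases and the gap stays below the threshold. At a point that
is not optimal the objective cannot be constant on the smallest face, by `LP.isOptimal_of_gap_lt`,
so the next step improves strictly. The index q is the first optimal one from r on. -/
theorem LP.exists_isTwoPhaseWalk {I : LP m n} {x₀ xhat : Fin n → ℚ} {p : ℕ → Fin n → ℚ} {r s : ℕ}
    (hhat : I.IsOptimal (toReal xhat)) (h0 : p 0 = x₀)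
    (hfeas : ∀ k ≤ s, toReal (p k) ∈ I.feasible) (hrs : r ≤ s) (h1 : I.PhaseOne xhat p r)
    (hgap : (I.obj (toReal xhat) - I.obj (toReal (p r))) * (detBound I.A : ℝ) ^ 2 < 1)
    (h2 : I.PhaseTwo p r s)
    (hker : ∀ z : Fin n → ℝ, mulR I.A z = 0 → (∀ j, z j ≠ 0 → j ∈ I.free (toReal (p s))) → z = 0) :
    ∃ q, I.IsTwoPhaseWalk (toReal x₀) (toReal xhat) (fun k => toReal (p k)) r q s := by
  classical
  have hmono : ∀ k l, r ≤ k → k ≤ l → l ≤ s → I.obj (toReal (p k)) ≤ I.obj (toReal (p l)) := by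
    intro k l hrk hkl
    induction l, hkl using Nat.le_induction with
    | base => exact fun _ => le_rfl
    | succ l hkl ih =>
      intro hl
      refine (ih (by omega)).trans ?_
      rcases (h2 l (by omega) (by omega)).2.2 with h | h
      · exact h.le
      · exact h.2
  have hopt : ∀ k, r ≤ k → k ≤ s → I.ObjVanishes (toReal (p k)) → I.IsOptimal (toReal (p k)) := by
    intro k hrk hks hv
    refine LP.isOptimal_of_gap_lt (hfeas k hks) hv hhat (lt_of_le_of_lt ?_ hgap)
    have := hmono r k le_rfl hrk hks
    gcongr
  have hlast : I.IsOptimal (toReal (p s)) := hopt s hrs le_rfl fun z hz hS => by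
    rw [hker z hz hS]; simp [LP.obj]
  have hex : ∃ q, r ≤ q ∧ I.IsOptimal (toReal (p q)) := ⟨s, hrs, hlast⟩
  set q := Nat.find hex with hq
  obtain ⟨hrq, hqopt⟩ := Nat.find_spec hex
  have hqs : q ≤ s := Nat.find_min' hex ⟨hrs, hlast⟩
  have hafter : ∀ k, q ≤ k → k ≤ s → I.IsOptimal (toReal (p k)) := fun k hqk hks =>
    ⟨hfeas k hks, fun y hy => (hqopt.2 y hy).trans (hmono q k hrq hqk hks)⟩
  refine ⟨q, hrq, hqs, congrArg toReal h0, ⟨fun k hk => hfeas k (hk.trans hqs), hqopt, ?_⟩, ?_, hlast,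
    LP.isVertex_of_ker (hfeas s le_rfl) hker, fun k hk => (h1 k hk).2, ?_,
    fun k hrk hks => (h2 k hrk hks).2.1⟩
  · intro k hk
    rcases lt_or_ge k r with hkr | hrk
    · exact (h1 k hkr).1
    · have hstep := h2 k hrk (by omega)
      refine ⟨hstep.2.2.resolve_right fun h => ?_, hstep.1⟩
      exact Nat.find_min hex hk ⟨hrk, hopt k hrk (by omega) h.1⟩
  · intro k hqk hks
    exact ⟨(h2 k (hrq.trans hqk) hks).1, hafter (k + 1) (by omega) (by omega)⟩
  -- The gap is below the threshold for `detBound`, which is at least Δ; the claim is weaker.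
  · have hB : max 1 (maxSubdet I.A : ℝ) ≤ (detBound I.A : ℝ) :=
      max_le (by exact_mod_cast detBound_pos I.A) (by exact_mod_cast maxSubdet_le_detBound I.A)
    have hone : (1 : ℝ) ≤ max 1 (maxSubdet I.A : ℝ) := le_max_left _ _
    have hnonneg : 0 ≤ I.obj (toReal xhat) - I.obj (toReal (p r)) :=
      sub_nonneg.2 (hhat.2 _ (hfeas r hrs))
    rw [lt_div_iff₀ (by positivity)]
    refine lt_of_le_of_lt ?_ hgap
    gcongr

/-! ### The number of steps -/

/-- The difference is at most ∑ |wⱼ| (|uⱼ| + |lⱼ|), and one plus a summand is at most (1 + |wⱼ|) (1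
+ |uⱼ|) (1 + |lⱼ|). The bound does not involve the starting point, hence neither does the number of
steps. -/
theorem LP.objQ_sub_le {I : LP m n} {x y : Fin n → ℚ} (hx : toReal x ∈ I.feasible)
    (hy : toReal y ∈ I.feasible) : I.objQ y - I.objQ x ≤ 2 ^ I.size := by
  have hxb := (LP.toReal_mem_feasible.1 hx).2
  have hyb := (LP.toReal_mem_feasible.1 hy).2
  have h1 : I.objQ y - I.objQ x ≤
      ((∑ j, (I.w j).natAbs * ((I.u j).natAbs + (I.l j).natAbs) : ℕ) : ℚ) := by
    rw [← I.objQ_sub]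
    simp only [Nat.cast_sum, Nat.cast_mul, Nat.cast_add, Nat.cast_natAbs, Int.cast_abs]
    refine Finset.sum_le_sum fun j _ => ?_
    refine (le_abs_self _).trans ?_
    rw [abs_mul]
    refine mul_le_mul_of_nonneg_left ?_ (abs_nonneg _)
    have := hxb j
    have := hyb j
    have := le_abs_self (I.u j : ℚ)
    have := neg_abs_le (I.l j : ℚ)
    rw [abs_le]
    constructor <;> linarith
  have h2 : ∑ j, (I.w j).natAbs * ((I.u j).natAbs + (I.l j).natAbs) ≤ 2 ^ I.size := by
    refine le_trans (Nat.le_add_left _ 1) ((sum_le_prod_one_add _ _).trans ?_)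
    have h3 : ∀ j, 1 + (I.w j).natAbs * ((I.u j).natAbs + (I.l j).natAbs) ≤
        2 ^ (ratSize (I.w j) + ratSize (I.u j) + ratSize (I.l j)) := by
      intro j
      have e1 := one_add_natAbs_le (I.w j)
      have e2 := one_add_natAbs_le (I.u j)
      have e3 := one_add_natAbs_le (I.l j)
      rw [pow_add, pow_add]
      refine le_trans ?_ (Nat.mul_le_mul (Nat.mul_le_mul e1 e2) e3)
      have e4 : (1 + (I.w j).natAbs) * (1 + (I.u j).natAbs) * (1 + (I.l j).natAbs) =
        1 + (I.w j).natAbs * ((I.u j).natAbs + (I.l j).natAbs) +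
        ((I.w j).natAbs + (I.u j).natAbs + (I.l j).natAbs + (I.u j).natAbs * (I.l j).natAbs +
          (I.w j).natAbs * (I.u j).natAbs * (I.l j).natAbs) := by ring
      rw [e4]; exact Nat.le_add_right _ _
    refine (Finset.prod_le_prod' fun j _ => h3 j).trans ?_
    rw [Finset.prod_pow_eq_pow_sum]
    refine Nat.pow_le_pow_right (by norm_num) ?_
    rw [Finset.sum_add_distrib, Finset.sum_add_distrib]
    unfold LP.size; omega
  exact h1.trans (by exact_mod_cast h2)

/-- The power is at most 1 / e < 1 / 2. -/
theorem two_mul_one_sub_inv_pow_le {n : ℕ} (hn : 0 < n) : 2 * (1 - 1 / (n : ℚ)) ^ n ≤ 1 := by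
  have h1 := Real.one_sub_div_pow_le_exp_neg (n := n) (t := 1) (by exact_mod_cast hn)
  have h2 : Real.exp (-1) * 2 ≤ 1 := by
    have h3 := Real.exp_one_gt_d9
    have h4 : Real.exp (-1) * Real.exp 1 = 1 := by rw [← Real.exp_add]; simp
    nlinarith [Real.exp_pos (-1)]
  have h5 : 2 * (1 - 1 / (n : ℝ)) ^ n ≤ 1 := by linarith
  have h6 : ((2 * (1 - 1 / (n : ℚ)) ^ n : ℚ) : ℝ) ≤ ((1 : ℚ) : ℝ) := by
    push_cast; exact h5
  exact Rat.cast_le.1 h6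

/-- Every n steps at least halve the bound on the gap. It starts at 2 ^ size and the threshold is at
least 2 ^ (-2 size), which takes 3 size halvings; one more makes the inequality strict. -/
theorem LP.step_lt_of_gap {I : LP m n} {k : ℕ} {g : ℚ} (hn : 0 < n)
    (hg : g ≤ (1 - 1 / (n : ℚ)) ^ k * 2 ^ I.size)
    (hgap : 1 ≤ g * ((detBound I.A : ℚ) * detBound I.A)) : k < n * (3 * I.size + 1) := by
  by_contra hcon
  push Not at hcon
  have hn' : (1 : ℚ) ≤ n := by exact_mod_cast hn
  have ht0 : 0 ≤ 1 - 1 / (n : ℚ) := by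
    rw [sub_nonneg, div_le_one (by linarith)]; exact hn'
  have ht1 : 1 - 1 / (n : ℚ) ≤ 1 := by
    have : 0 ≤ 1 / (n : ℚ) := by positivity
    linarith
  have hpow : (1 - 1 / (n : ℚ)) ^ k ≤ (1 / 2) ^ (3 * I.size + 1) := by
    refine (pow_le_pow_of_le_one ht0 ht1 hcon).trans ?_
    rw [pow_mul]
    refine pow_le_pow_left₀ (pow_nonneg ht0 _) ?_ _
    have := two_mul_one_sub_inv_pow_le hn
    linarith
  have hB : (detBound I.A : ℚ) ≤ 2 ^ I.size := by exact_mod_cast detBound_le I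
  have hB0 : (0 : ℚ) ≤ detBound I.A := by positivity
  have h1 : g ≤ (1 / 2) ^ (3 * I.size + 1) * 2 ^ I.size :=
    hg.trans (mul_le_mul_of_nonneg_right hpow (by positivity))
  have h2 : g * ((detBound I.A : ℚ) * detBound I.A) ≤
      (1 / 2) ^ (3 * I.size + 1) * 2 ^ I.size * (2 ^ I.size * 2 ^ I.size) := by
    refine mul_le_mul h1 (mul_le_mul hB hB hB0 (by positivity)) (by positivity) (by positivity)
  have h3 : (1 / 2 : ℚ) ^ (3 * I.size + 1) * 2 ^ I.size * (2 ^ I.size * 2 ^ I.size) = 1 / 2 := by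
    have : (1 / 2 : ℚ) ^ (3 * I.size + 1) * 2 ^ I.size * (2 ^ I.size * 2 ^ I.size) =
        1 / 2 * ((1 / 2) ^ (3 * I.size) * 2 ^ (3 * I.size)) := by ring
    rw [this, ← mul_pow]; norm_num
  linarith

end Walks

/-! ### The main program -/

/-- Array 8 becomes `∏ (1 + |Aᵢⱼ|)`. -/
def computeBound : Prog :=
  .seq (.setCell 8 (.const 0) (.const 0) (.const 1))
    (forLoop 4 (.ctr 0) (forLoop 5 (.ctr 1)
      (.ite (.ltQ (.cell 0 (.ctr 4) (.ctr 5)) (.const 0))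
        (.setCell 8 (.const 0) (.const 0)
          (.mul (scalar 8) (.sub (.const 1) (.cell 0 (.ctr 4) (.ctr 5)))))
        (.setCell 8 (.const 0) (.const 0)
          (.mul (scalar 8) (.add (.const 1) (.cell 0 (.ctr 4) (.ctr 5))))))))

/-- Array 9 becomes the optimality gap of the current point. -/
def computeGap : Prog := sumInto 9 (.mul (vecAt 2 5) gapAt)

/-- The first phase: steps along conformal circuits. -/
def phaseOne : Prog :=
  .seq computeGap (.while (.not (.ltQ (.mul (scalar 9) (.mul (scalar 8) (scalar 8))) (.const 1)))
    (.seq conformalCircuit (.seq takeStep computeGap)))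

/-- The second phase: steps inside the smallest face, to a vertex. -/
def phaseTwo : Prog :=
  .seq (.setCtr 3 (.const 1)) (.while (.ltI (.const 0) (.ctr 3))
    (.seq (forLoop 5 (.ctr 1) (.setCell 12 (.ctr 5) (.const 0)
      (.mul (.sub currentAt (vecAt 3 5)) (.sub (vecAt 4 5) currentAt)))) (.seq findDirection
    (.ite (.ltI (.ctr 8) (.const 1)) (.setCtr 3 (.const 0))
      (.seq (sumInto 21 (.mul (vecAt 2 5) (vecAt 15 5)))
        (.seq (.ite (.ltQ (scalar 21) (.const 0)) negate .skip) takeStep))))))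

/-- Everything after the call of the solver. -/
def walkProg : Prog :=
  .seq (forLoop 5 (.ctr 1) (.setCell 6 (.const 0) (.ctr 5) (vecAt 5 5)))
    (.seq computeBound (.seq phaseOne phaseTwo))

/-! ### Correctness of the main program -/

section Main

variable {m n : ℕ} {I : LP m n} {ans : Fin n → ℚ} {X M K : ℕ} {σ : Store} {Q : Store → Prop}

/-- The partial products consist of at most m n factors of size + 1 bits each. -/
theorem runs_computeBound (P : I.Params X M K) (hσ : I.Loaded σ)
    (hX : m * n * (I.size + 1) ≤ X)
    (hQ : ∀ τ, σ.Agree [8] [] τ → τ.cell 8 0 0 = (detBound I.A : ℚ) → Q τ) :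
    Runs ans M K computeBound σ Q := by
  set f : ℕ → ℕ → ℚ := fun i j => 1 + |σ.cell 0 i j| with hf
  have hfit : ∀ i < m, ∀ j < n, FitsBits (I.size + 1) (f i j) := fun i hi j hj => by
    have h1 : f i j = ((1 + (I.A ⟨i, hi⟩ ⟨j, hj⟩).natAbs : ℕ) : ℤ) := by
      simp only [hf, hσ.A ⟨i, hi⟩ ⟨j, hj⟩]
      push_cast
      rfl
    rw [h1]
    refine fitsBits_int ?_
    have h2 := (I.fitsBits_A (X := I.size) le_rfl ⟨i, hi⟩ ⟨j, hj⟩).1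
    simp only [Rat.num_intCast] at h2
    rw [Int.natAbs_natCast, pow_succ]
    have := Nat.one_le_two_pow (n := I.size)
    omega
  have hval : ∏ i ∈ Finset.range m, ∏ j ∈ Finset.range n, f i j = (detBound I.A : ℚ) := by
    rw [Finset.prod_range, detBound, Nat.cast_prod]
    refine Finset.prod_congr rfl fun i _ => ?_
    rw [Finset.prod_range, Nat.cast_prod]
    refine Finset.prod_congr rfl fun j _ => ?_
    simp only [hf, hσ.A, Nat.cast_add, Nat.cast_one, Nat.cast_natAbs, Int.cast_abs]
  have hbits : ∀ i < m, ∀ j < n, (i * n + j + 1) * (I.size + 1) ≤ X := fun i hi j hj => by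
    refine le_trans (Nat.mul_le_mul_right _ ?_) hX
    nlinarith
  refine Runs.seq (Runs.setCell (by simpa using P.ratSize_le (fitsBits_one 0) (by omega)) ?_)
  refine Runs.for (fun i τ => FitsBits (i * n * (I.size + 1)) (τ.cell 8 0 0) ∧
    τ = σ.setCell 8 0 0 (∏ i ∈ Finset.range i, ∏ j ∈ Finset.range n, f i j)) (by decide) ?_
    P.mM P.mK (by simpa using hσ.ctr4) ⟨by simpa using fitsBits_one _, by simp⟩ ?_ ?_
  · rintro i _ ⟨-, rfl⟩
    simpa using hσ.ctr0
  · rintro i hi τ hτ4 ⟨hB, hτ⟩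
    refine Runs.for (fun j υ => FitsBits ((i * n + j) * (I.size + 1)) (υ.cell 8 0 0) ∧
      υ = (σ.setCell 8 0 0 ((∏ i ∈ Finset.range i, ∏ j ∈ Finset.range n, f i j) *
        ∏ j ∈ Finset.range j, f i j)).setCtr 4 i) (by decide) ?_ P.nM P.nK ?_ ?_ ?_ ?_
    · rintro j _ ⟨-, rfl⟩
      simpa using hσ.ctr1
    · simpa [hτ] using hσ.ctr5
    · exact ⟨by simpa using hB, by simp [hτ]⟩
    · rintro j hj υ hυ5 ⟨hC, hυ⟩
      have hcell : υ.cell 0 i j = σ.cell 0 i j := by simp [hυ]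
      have hc4 : υ.ctr 4 = i := by simp [hυ]
      have h1 : FitsBits ((i * n + (j + 1)) * (I.size + 1)) (υ.cell 8 0 0 * f i j) :=
        (hC.mul (hfit i hi j hj)).mono (le_of_eq (by ring))
      have h2 : ratSize (υ.cell 8 0 0 * f i j) ≤ K :=
        P.ratSize_le h1 (by have := hbits i hi j hj; rw [← add_assoc]; omega)
      have key : ∀ e : QExpr, e.eval (υ.setCtr 5 j) = υ.cell 8 0 0 * f i j →
          Runs ans M K (.setCell 8 (.const 0) (.const 0) e) (υ.setCtr 5 j) fun υ' =>
            υ'.ctr 5 = j ∧ FitsBits ((i * n + (j + 1)) * (I.size + 1))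
              ((υ'.setCtr 5 0).cell 8 0 0) ∧ υ'.setCtr 5 0 =
              (σ.setCell 8 0 0 ((∏ i ∈ Finset.range i, ∏ j ∈ Finset.range n, f i j) *
                ∏ j ∈ Finset.range (j + 1), f i j)).setCtr 4 i := by
        intro e he
        refine Runs.setCell (by rw [he]; exact h2) ⟨by simp, ?_, ?_⟩
        · simpa [he] using h1
        · rw [he]
          refine Store.ext' (fun c => ?_) fun v a b => ?_
          · by_cases h5 : c = 5
            · simp [h5, hσ.ctr5]
            · simp [h5, hυ]
          · simp only [hυ, Store.setCell_cell, Store.setCtr_cell, IExpr.eval,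
              Finset.prod_range_succ, and_self, if_true]
            split_ifs
            · ring
            · rfl
      refine Runs.ite (fun hp => key _ ?_) (fun hp => key _ ?_)
      · simp [hc4, hcell] at hp
        simp [hc4, hcell, hf, abs_of_neg hp, sub_eq_add_neg]
      · simp [hc4, hcell] at hp
        simp [hc4, hcell, hf, abs_of_nonneg hp]
    · rintro υ - ⟨hC, hυ⟩
      refine ⟨by simp [hυ], by simpa [add_mul] using hC, ?_⟩
      refine Store.ext' (fun c => ?_) fun v a b => ?_
      · by_cases h4 : c = 4
        · simp [h4, hσ.ctr4]
        · simp [h4, hυ]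
      · simp [hυ, Finset.prod_range_succ]
  · rintro τ - ⟨-, hτ⟩
    refine hQ τ ⟨fun v hv a b => ?_, fun c hc => by simp [hτ]⟩ ?_
    · simp at hv
      simp [hτ, hv]
    · simp [hτ, hval]

/-- The memory in the course of the computation; `b` bounds the bits of the input. -/
structure LP.WalkState (I : LP m n) (x₀ xhat : Fin n → ℚ) (b : ℕ) (τ : Store) : Prop where
  loaded : I.Loaded τ
  hat : ∀ j : Fin n, τ.cell 7 j 0 = xhat j
  bound : τ.cell 8 0 0 = (detBound I.A : ℚ)
  start : τ.outPoint n 0 = x₀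
  feas : ∀ k ≤ τ.ctr 2, toReal (τ.outPoint n k) ∈ I.feasible
  den : HasDenominator (2 ^ (2 * b + τ.ctr 2 * (2 * I.size + 2))) (τ.outPoint n (τ.ctr 2))

theorem LP.WalkState.of_agree {x₀ xhat : Fin n → ℚ} {b : ℕ} {τ υ : Store} {V C : List ℕ}
    (h : I.WalkState x₀ xhat b τ) (ha : τ.Agree V C υ)
    (hV : ∀ v ∈ [0, 2, 3, 4, 6, 7, 8], v ∉ V := by decide)
    (hC : ∀ c ∈ [0, 1, 2, 4, 5, 6], c ∉ C := by decide) : I.WalkState x₀ xhat b υ := by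
  have h6 : ∀ k, υ.outPoint n k = τ.outPoint n k := fun k =>
    funext fun j => ha.1 6 (hV 6 (by simp)) k j
  have h2 : υ.ctr 2 = τ.ctr 2 := ha.2 2 (hC 2 (by simp))
  refine ⟨h.loaded.of_agree ha (fun v hv => hV v ?_) (fun c hc => hC c ?_),
    fun j => (ha.1 7 (hV 7 (by simp)) _ _).trans (h.hat j),
    (ha.1 8 (hV 8 (by simp)) _ _).trans h.bound, by rw [h6]; exact h.start, ?_, ?_⟩
  · simp at hv ⊢; tauto
  · simp at hc ⊢; tauto
  · simpa [h6, h2] using h.feas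
  · simpa [h6, h2] using h.den

theorem LP.exists_int_target (I : LP m n) (d : Fin n → ℚ) (j : Fin n) :
    ∃ v : ℤ, I.target d j = v ∧ v.natAbs ≤ 2 ^ I.size := by
  have hu := (I.fitsBits_u (X := I.size) le_rfl j).1
  have hl := (I.fitsBits_l (X := I.size) le_rfl j).1
  simp only [Rat.num_intCast] at hu hl
  unfold LP.target
  split_ifs
  · exact ⟨_, rfl, hu⟩
  · exact ⟨_, rfl, hl⟩

/-- Taking a step along an admissible direction. -/
theorem LP.WalkState.runs_takeStep (P : I.Params X M K) {x₀ xhat d : Fin n → ℚ} {b : ℕ} {τ : Store}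
    (h : I.WalkState x₀ xhat b τ) (hd : ∀ j : Fin n, τ.cell 15 j 0 = d j)
    (hX : 2 * b + M * (2 * I.size + 2) ≤ X) (hs : τ.ctr 2 < M)
    (hc : IsCircuitMultiple I.A (toReal d)) (hden : HasDenominator (detBound I.A) d)
    (hin : ∀ j, d j ≠ 0 → 0 < (I.target d j - τ.outPoint n (τ.ctr 2) j) * d j)
    (hQ : ∀ υ a, I.WalkState x₀ xhat b υ → τ.Agree [6, 10, 11, 16] [2, 9] υ →
      IsFirstHit (τ.outPoint n (τ.ctr 2)) (I.target d) d a → υ.ctr 2 = τ.ctr 2 + 1 →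
      (υ.outPoint n (τ.ctr 2 + 1) = fun j => τ.outPoint n (τ.ctr 2) j + a * d j) →
      (∀ k ≤ τ.ctr 2, υ.outPoint n k = τ.outPoint n k) →
      I.IsCircuitStep (toReal (υ.outPoint n (τ.ctr 2))) (toReal (υ.outPoint n (τ.ctr 2 + 1))) →
      Q υ) : Runs ans M K takeStep τ Q := by
  have hden' := hden.mono (detBound_le I)
  have hne : ∃ j, d j ≠ 0 := by
    obtain ⟨j, hj⟩ := hc.ne_zero
    exact ⟨j, by simpa [toReal] using hj⟩
  have hbits : 2 * b + τ.ctr 2 * (2 * I.size + 2) ≤ X :=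
    le_trans (by gcongr) hX
  refine CircuitWalk.runs_takeStep P h.loaded (x := τ.outPoint n (τ.ctr 2)) (d := d)
    (fun j => rfl) hd (fun j => (h.den.fitsBits j).mono hbits)
    (fun j => (hden'.fitsBits j).mono P.sizeX) hs hin hne ?_
  intro υ a hA hhit hc2 hnew hold
  have hnew' : υ.outPoint n (τ.ctr 2 + 1) = fun j => τ.outPoint n (τ.ctr 2) j + a * d j :=
    funext hnew
  have hold' : ∀ k ≤ τ.ctr 2, υ.outPoint n k = τ.outPoint n k := fun k hk =>
    funext fun j => hold k hk j
  have hstep : I.IsCircuitStep (toReal (υ.outPoint n (τ.ctr 2)))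
      (toReal (υ.outPoint n (τ.ctr 2 + 1))) := by
    rw [hnew', hold' _ le_rfl]
    exact LP.isCircuitStep_of_isFirstHit (h.feas _ le_rfl) hc hin hhit
  refine hQ υ a ⟨h.loaded.of_agree hA, fun j => (hA.1 7 (by decide) _ _).trans (h.hat j),
    (hA.1 8 (by decide) _ _).trans h.bound, by rw [hold' 0 (Nat.zero_le _)]; exact h.start,
    ?_, ?_⟩ hA hhit hc2 hnew' hold' hstep
  · intro k hk
    rcases Nat.le_or_eq_of_le_succ (hc2 ▸ hk) with hk | rfl
    · rw [hold' k hk]; exact h.feas k hk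
    · exact hstep.2.1
  -- `HasDenominator.move` with L = size: a step adds 2 size + 2 bits.
  · rw [hc2, hnew']
    have := h.den.move hden' (I.exists_int_target d) hhit
    convert this using 2
    ring

theorem runs_computeGap (P : I.Params X M K) {x₀ xhat : Fin n → ℚ} {b : ℕ}
    (h : I.WalkState x₀ xhat b σ) (hX : 2 * b + M * (2 * I.size + 2) ≤ X) (hs : σ.ctr 2 ≤ M)
    (hhat : ∀ j, FitsBits X (xhat j))
    (hQ : ∀ τ, σ.Agree [9] [] τ →
      τ.cell 9 0 0 = I.objQ xhat - I.objQ (σ.outPoint n (σ.ctr 2)) → Q τ) :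
    Runs ans M K computeGap σ Q := by
  have hbits : 2 * b + σ.ctr 2 * (2 * I.size + 2) ≤ X := le_trans (by gcongr) hX
  refine runs_sumInto P h.loaded
    (fun j => σ.cell 2 j 0 * (σ.cell 7 j 0 - σ.cell 6 (σ.ctr 2) j)) ?_ ?_ ?_
  · intro i hi s
    simp
  · intro i hi
    rw [h.hat ⟨i, hi⟩, h.loaded.w ⟨i, hi⟩]
    have h6 : FitsBits X (σ.cell 6 (σ.ctr 2) i) := (h.den.fitsBits ⟨i, hi⟩).mono hbits
    exact ((I.fitsBits_w P.sizeX _).mul ((hhat _).sub h6)).mono (by omega)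
  · intro τ hA h9
    refine hQ τ hA ?_
    rw [h9, ← I.objQ_sub, Finset.sum_range]
    exact Finset.sum_congr rfl fun j _ => by rw [h.loaded.w, h.hat]; rfl

theorem inKer_sub {x y : Fin n → ℚ} (hx : toReal x ∈ I.feasible) (hy : toReal y ∈ I.feasible) :
    InKer I.A fun j => y j - x j := by
  intro i
  simp only [mul_sub, Finset.sum_sub_distrib]
  rw [(LP.toReal_mem_feasible.1 hx).1 i, (LP.toReal_mem_feasible.1 hy).1 i, sub_self]

/-- After k steps the gap is at most (1 - 1/n) ^ k · 2 ^ size, and as long as the test succeeds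
`LP.step_lt_of_gap` bounds k. -/
theorem runs_phaseOne (P : I.Params X M K) {x₀ xhat : Fin n → ℚ} {b : ℕ}
    (h : I.WalkState x₀ xhat b σ) (hhat : toReal xhat ∈ I.feasible)
    (hhatden : HasDenominator (2 ^ (2 * b)) xhat) (hs : σ.ctr 2 = 0)
    (hX : 4 * b + M * (2 * I.size + 2) + n * (2 * I.size + 2) + 1 ≤ X)
    (hM : n * (3 * I.size + 1) ≤ M)
    (hQ : ∀ τ, I.WalkState x₀ xhat b τ → I.PhaseOne xhat (τ.outPoint n) (τ.ctr 2) →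
      (I.objQ xhat - I.objQ (τ.outPoint n (τ.ctr 2))) *
        ((detBound I.A : ℚ) * detBound I.A) < 1 →
      τ.ctr 2 ≤ n * (3 * I.size + 1) → Q τ) :
    Runs ans M K phaseOne σ Q := by
  have hX' : 2 * b + M * (2 * I.size + 2) ≤ X := by omega
  have hhatX : ∀ j, FitsBits X (xhat j) := fun j => (hhatden.fitsBits j).mono (by omega)
  refine Runs.seq (runs_computeGap P h hX' (by omega) hhatX fun σ₁ hA₁ h9 => ?_)
  have h₁ := h.of_agree hA₁
  have hs₁ : σ₁.ctr 2 = σ.ctr 2 := hA₁.2 2 (by decide)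
  have hp₁ : ∀ k, σ₁.outPoint n k = σ.outPoint n k := fun k =>
    funext fun j => hA₁.1 6 (by decide) k j
  refine Runs.while (fun k τ => I.WalkState x₀ xhat b τ ∧
    τ.cell 9 0 0 = I.objQ xhat - I.objQ (τ.outPoint n (τ.ctr 2)) ∧
    I.PhaseOne xhat (τ.outPoint n) (τ.ctr 2) ∧
    τ.cell 9 0 0 ≤ (1 - 1 / (n : ℚ)) ^ τ.ctr 2 * 2 ^ I.size ∧
    τ.ctr 2 + k = n * (3 * I.size + 1)) ?_ ?_ hM ⟨h₁, ?_, ?_, ?_, ?_⟩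
  · rintro k τ ⟨hW, h9, h1, -, hk⟩ hp
    simp at hp
    replace hp : τ.cell 9 0 0 * (τ.cell 8 0 0 * τ.cell 8 0 0) < 1 := of_decide_eq_true hp
    rw [h9, hW.bound] at hp
    exact hQ τ hW h1 hp (by omega)
  · rintro k τ ⟨hW, h9, h1, hdec, hk⟩ hp
    simp at hp
    replace hp : ¬τ.cell 9 0 0 * (τ.cell 8 0 0 * τ.cell 8 0 0) < 1 := of_decide_eq_false hp
    rw [not_lt, hW.bound] at hp
    have hBpos : (0 : ℚ) < (detBound I.A : ℚ) * detBound I.A := by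
      have := detBound_pos I.A
      positivity
    have hgap : 0 < τ.cell 9 0 0 := by
      by_contra hcon
      push Not at hcon
      nlinarith
    -- For n = 0 the gap is zero, and the test would have failed.
    have hn : 0 < n := by
      rcases Nat.eq_zero_or_pos n with rfl | hn
      · simp [h9, LP.objQ] at hgap
      · exact hn
    have hlt := LP.step_lt_of_gap hn hdec hp
    refine ⟨by omega, ?_⟩
    set x := τ.outPoint n (τ.ctr 2) with hx
    have hbits : 2 * b + τ.ctr 2 * (2 * I.size + 2) ≤ 2 * b + M * (2 * I.size + 2) := by
      gcongr; omega
    have hxX : ∀ j, FitsBits X (x j) := fun j => (hW.den.fitsBits j).mono (by omega)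
    have hfx : toReal x ∈ I.feasible := hW.feas _ le_rfl
    have hgap' : 0 < I.objQ fun j => xhat j - x j := by rw [I.objQ_sub, ← h9]; exact hgap
    -- The difference takes 2 b bits for x̂, at most 2 b + M (2 size + 2) for the current point and
    -- one for subtracting; the reductions of its support add n (2 size + 2).
    refine Runs.seq (runs_conformalCircuit P hW.loaded (x := x) (xhat := xhat) (fun j => rfl)
      hW.hat hxX hhatX (hhatden.sub hW.den) (by omega) (inKer_sub hfx hhat) hgap' ?_)
    intro τ₁ d g hA₁ hd hgood hc hden
    have hW₁ := hW.of_agree hA₁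
    have hs₁ : τ₁.ctr 2 = τ.ctr 2 := hA₁.2 2 (by decide)
    have hp₁ : ∀ k, τ₁.outPoint n k = τ.outPoint n k := fun k =>
      funext fun j => hA₁.1 6 (by decide) k j
    refine Runs.seq (hW₁.runs_takeStep P hd hX' (by omega) hc hden ?_ ?_)
    · intro j hj
      rw [hp₁, hs₁]
      exact hgood.target_sub_mul_pos hhat j hj
    intro τ₂ a hW₂ hA₂ hhit hs₂ hnew hold hstep
    rw [hs₁, hp₁, ← hx] at hhit
    rw [hs₁] at hs₂ hnew hold hstep
    rw [hp₁, ← hx] at hnew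
    replace hold : ∀ k ≤ τ.ctr 2, τ₂.outPoint n k = τ.outPoint n k := fun k hk =>
      (hold k hk).trans (hp₁ k)
    have hprog := hgood.progress hhat hn (by rw [← h9]; exact hgap) hhit
    have hobj : I.objQ (τ₂.outPoint n (τ.ctr 2 + 1)) = I.objQ x + a * I.objQ d := by
      rw [hnew, I.objQ_add_smul]
    refine runs_computeGap P hW₂ hX' (by omega) hhatX fun τ₃ hA₃ h9₃ => ?_
    have hs₃ : τ₃.ctr 2 = τ.ctr 2 + 1 := (hA₃.2 2 (by decide)).trans hs₂
    have hp₃ : ∀ k, τ₃.outPoint n k = τ₂.outPoint n k := fun k =>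
      funext fun j => hA₃.1 6 (by decide) k j
    have h9₃' : τ₃.cell 9 0 0 = τ.cell 9 0 0 - a * I.objQ d := by
      rw [h9₃, hs₂, hobj, h9]; ring
    refine ⟨hW₂.of_agree hA₃, by rw [h9₃, hs₃, hp₃, hs₂], ?_, ?_, by omega⟩
    · rw [hs₃]
      have hlow : I.PhaseOne xhat (τ₃.outPoint n) (τ.ctr 2) :=
        h1.congr fun k hk => (hp₃ k).trans (hold k hk)
      intro k hk
      rcases Nat.lt_succ_iff_lt_or_eq.1 hk with hk | rfl
      · exact hlow k hk
      · simp only [hp₃]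
        have hgapR : (0 : ℝ) < ((a * I.objQ d : ℚ) : ℝ) := by
          have : 0 < a * I.objQ d :=
            lt_of_lt_of_le (div_pos (h9 ▸ hgap) (by exact_mod_cast hn)) hprog
          exact_mod_cast this
        refine ⟨⟨?_, hstep⟩, ?_, ?_⟩
        · rw [I.obj_toReal, I.obj_toReal, hobj, hold _ le_rfl]
          push_cast at hgapR ⊢
          linarith
        · rw [hnew, hold _ le_rfl]
          exact hgood.exists_conformal hhat hc hhit
        · rw [I.obj_toReal, I.obj_toReal, I.obj_toReal, hobj, hold _ le_rfl]
          have : 1 / (n : ℚ) * (I.objQ xhat - I.objQ x) ≤ (I.objQ x + a * I.objQ d) - I.objQ x := by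
            rw [one_div_mul_eq_div]; linarith
          rw [← hx]
          have := (Rat.cast_le (K := ℝ)).2 this
          push_cast at this ⊢
          exact this
    · rw [hs₃, h9₃', pow_succ]
      have hn' : (1 : ℚ) ≤ n := by exact_mod_cast hn
      have ht0 : 0 ≤ 1 - 1 / (n : ℚ) := by
        rw [sub_nonneg, div_le_one (by linarith)]; exact hn'
      rw [← h9] at hprog
      have e1 : τ.cell 9 0 0 - a * I.objQ d ≤ (1 - 1 / (n : ℚ)) * τ.cell 9 0 0 := by
        have : τ.cell 9 0 0 / n = 1 / (n : ℚ) * τ.cell 9 0 0 := by ring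
        linarith
      have e2 := mul_le_mul_of_nonneg_left hdec ht0
      refine e1.trans (e2.trans (le_of_eq (by ring)))
  · rw [h9, hs₁, hp₁]
  · rw [hs₁, hs]
    intro k hk
    exact absurd hk (Nat.not_lt_zero _)
  · rw [h9, hs₁, hs]
    simpa using LP.objQ_sub_le (h.feas 0 (by omega)) hhat
  · rw [hs₁, hs, zero_add]

/-- The product on the right is what `phaseTwo` stores in array 12, so that `findDirection` works on
the free coordinates. -/
theorem mem_free_iff {x : Fin n → ℚ} {j : Fin n} :
    j ∈ I.free (toReal x) ↔ (x j - I.l j) * (I.u j - x j) ≠ 0 := by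
  simp only [LP.free, toReal, Set.mem_ofPred_eq, mul_ne_zero_iff, sub_ne_zero]
  refine and_congr ?_ ?_
  · exact_mod_cast Iff.rfl
  · rw [ne_comm]; exact_mod_cast Iff.rfl

/-- Each step removes a free coordinate, so there are at most n. The orientation makes the objective
nondecreasing, and a direction with objective value zero is used only if the objective vanishes on
the whole face. -/
theorem runs_phaseTwo (P : I.Params X M K) {x₀ xhat : Fin n → ℚ} {b : ℕ}
    (h : I.WalkState x₀ xhat b σ) (h1 : I.PhaseOne xhat (σ.outPoint n) (σ.ctr 2))
    (hX : 2 * b + M * (2 * I.size + 2) ≤ X) (hM : σ.ctr 2 + n + 1 ≤ M)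
    (hQ : ∀ τ, I.WalkState x₀ xhat b τ → σ.ctr 2 ≤ τ.ctr 2 → τ.ctr 2 ≤ σ.ctr 2 + n →
      τ.outPoint n (σ.ctr 2) = σ.outPoint n (σ.ctr 2) →
      I.PhaseOne xhat (τ.outPoint n) (σ.ctr 2) → I.PhaseTwo (τ.outPoint n) (σ.ctr 2) (τ.ctr 2) →
      (∀ z : Fin n → ℝ, mulR I.A z = 0 →
        (∀ j, z j ≠ 0 → j ∈ I.free (toReal (τ.outPoint n (τ.ctr 2)))) → z = 0) → Q τ) :
    Runs ans M K phaseTwo σ Q := by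
  refine Runs.seq (Runs.setCtr (by simp; have := P.MK; omega) ?_)
  have hA₀ : σ.Agree [] [3] (σ.setCtr 3 ((IExpr.const 1).eval σ)) :=
    ⟨by simp, fun c hc => by simp at hc; simp [hc]⟩
  -- One iteration more than there are free coordinates: the last one only finds that no direction
  -- is left.
  refine Runs.while (fun k τ => I.WalkState x₀ xhat b τ ∧ σ.ctr 2 ≤ τ.ctr 2 ∧
    τ.ctr 2 + (I.free (toReal (τ.outPoint n (τ.ctr 2)))).ncard ≤ σ.ctr 2 + n ∧
    (∀ k ≤ σ.ctr 2, τ.outPoint n k = σ.outPoint n k) ∧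
    I.PhaseTwo (τ.outPoint n) (σ.ctr 2) (τ.ctr 2) ∧
    ((τ.ctr 3 = 1 ∧ (I.free (toReal (τ.outPoint n (τ.ctr 2)))).ncard + 1 ≤ k) ∨
      (τ.ctr 3 = 0 ∧ ∀ z : Fin n → ℝ, mulR I.A z = 0 →
        (∀ j, z j ≠ 0 → j ∈ I.free (toReal (τ.outPoint n (τ.ctr 2)))) → z = 0)))
    ?_ ?_ (k := n + 1) (by omega) ⟨h.of_agree hA₀, by simp, ?_, fun k _ => rfl,
      fun k hk hk' => absurd hk' (by simpa using hk), Or.inl ⟨by simp, ?_⟩⟩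
  · rintro k τ ⟨hW, hle, hcard, hsame, h2, hcase⟩ hp
    replace hp : ¬ 0 < τ.ctr 3 := of_decide_eq_false hp
    exact hQ τ hW hle (by omega) (hsame _ le_rfl) (h1.congr hsame) h2
      (hcase.resolve_left fun h => by have := h.1; omega).2
  · rintro k τ ⟨hW, hle, hcard, hsame, h2, hcase⟩ hp
    replace hp : 0 < τ.ctr 3 := of_decide_eq_true hp
    obtain ⟨h3, hk⟩ := hcase.resolve_right fun h => by have := h.1; omega
    refine ⟨by omega, ?_⟩
    set x := τ.outPoint n (τ.ctr 2) with hx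
    have hxn : ∀ j : Fin n, τ.cell 6 (τ.ctr 2) j = x j := fun j => rfl
    have hfx : toReal x ∈ I.feasible := hW.feas _ le_rfl
    have hbits : 2 * b + τ.ctr 2 * (2 * I.size + 2) ≤ X := by
      refine le_trans ?_ hX
      gcongr; omega
    have hxX : ∀ j, FitsBits X (x j) := fun j => (hW.den.fitsBits j).mono hbits
    refine Runs.seq (Runs.fillCol (fun j => (τ.cell 6 (τ.ctr 2) j - τ.cell 3 j 0) *
      (τ.cell 4 j 0 - τ.cell 6 (τ.ctr 2) j)) (by decide) hW.loaded.ctr1 P.nM P.nK hW.loaded.ctr5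
      (by simp) (fun j hj => ?_) (Runs.seq ?_))
    · rw [hxn ⟨j, hj⟩, hW.loaded.l ⟨j, hj⟩, hW.loaded.u ⟨j, hj⟩]
      exact P.ratSize_le (((hxX _).sub (I.fitsBits_l P.sizeX _)).mul
        ((I.fitsBits_u P.sizeX _).sub (hxX _))) (by omega)
    set τ₁ := τ.fillCol 12 n fun j => (τ.cell 6 (τ.ctr 2) j - τ.cell 3 j 0) *
      (τ.cell 4 j 0 - τ.cell 6 (τ.ctr 2) j) with hτ₁
    have hA₁ : τ.Agree [12] [] τ₁ := ⟨fun v hv a b => by simp at hv; simp [hτ₁, hv], by simp [hτ₁]⟩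
    have hS : {j : Fin n | τ₁.cell 12 j 0 ≠ 0} = I.free (toReal x) := by
      ext j
      rw [mem_free_iff, Set.mem_ofPred_eq]
      simp [hτ₁, hxn, hW.loaded.l, hW.loaded.u]
    clear_value τ₁
    refine runs_findDirection P (hW.loaded.of_agree hA₁) fun τ₂ hA₂ hcase₂ => ?_
    rw [hS] at hcase₂
    replace hA₂ : τ.Agree [12, 13, 14, 15, 17] [7, 8] τ₂ :=
      (hA₁.mono (by decide) (by decide)).trans (hA₂.mono (by decide) (by decide))
    have hW₂ := hW.of_agree hA₂
    refine Runs.ite (fun hq => ?_) (fun hq => ?_)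
    · simp at hq
      obtain ⟨-, hker⟩ := hcase₂.resolve_right fun h => by have := h.1; omega
      refine Runs.setCtr (by simp) ?_
      have hA₃ : τ.Agree [12, 13, 14, 15, 17] [3, 7, 8] (τ₂.setCtr 3 ((IExpr.const 0).eval τ₂)) :=
        (hA₂.mono (by decide) (by decide)).trans
          ⟨by simp, fun c hc => by simp at hc; simp [hc]⟩
      have hp₃ : ∀ k, (τ₂.setCtr 3 ((IExpr.const 0).eval τ₂)).outPoint n k = τ.outPoint n k :=
        fun k => funext fun j => hA₃.1 6 (by decide) k j
      have hs₃ : (τ₂.setCtr 3 ((IExpr.const 0).eval τ₂)).ctr 2 = τ.ctr 2 := hA₃.2 2 (by decide)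
      refine ⟨hW.of_agree hA₃, by rw [hs₃]; exact hle, by rw [hs₃, hp₃]; exact hcard,
        fun k hk => (hp₃ k).trans (hsame k hk), ?_, Or.inr ⟨by simp, ?_⟩⟩
      · rw [hs₃]; exact h2.congr fun k _ => hp₃ k
      · rw [hs₃, hp₃]; exact hker
    simp at hq
    obtain ⟨-, hdir⟩ := hcase₂.resolve_left fun h => by have := h.1; omega
    set d₀ := fun j : Fin n => τ₂.cell 15 j 0 with hd₀
    have hd₂ : ∀ j : Fin n, τ₂.cell 15 j 0 = d₀ j := fun j => rfl
    clear_value d₀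
    have hdn : ∀ j < n, FitsBits X (τ₂.cell 15 j 0) := fun j hj => by
      rw [hd₂ ⟨j, hj⟩]; exact hdir.fitsBits P.sizeX _
    refine Runs.seq (runs_sumInto P hW₂.loaded (fun j => τ₂.cell 2 j 0 * τ₂.cell 15 j 0) (by simp)
      (fun j hj => ?_) fun τ₃ hA₃ h21 => Runs.seq ?_)
    · rw [hW₂.loaded.w ⟨j, hj⟩]
      exact ((I.fitsBits_w P.sizeX _).mul (hdn j hj)).mono (by omega)
    replace h21 : τ₃.cell 21 0 0 = I.objQ d₀ := by
      rw [h21, Finset.sum_range]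
      exact Finset.sum_congr rfl fun j _ => by rw [hW₂.loaded.w, hd₂]
    have hd₃ : ∀ j : Fin n, τ₃.cell 15 j 0 = d₀ j := fun j => by
      rw [hA₃.1 15 (by decide), hd₂]
    have hW₃ := hW₂.of_agree hA₃
    have hfinish : ∀ (τ₄ : Store) (d : Fin n → ℚ), τ₃.Agree [15] [] τ₄ →
        (∀ j : Fin n, τ₄.cell 15 j 0 = d j) → I.IsDirection (I.free (toReal x)) d →
        0 ≤ I.objQ d → Runs ans M K takeStep τ₄ fun υ => I.WalkState x₀ xhat b υ ∧
          σ.ctr 2 ≤ υ.ctr 2 ∧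
          υ.ctr 2 + (I.free (toReal (υ.outPoint n (υ.ctr 2)))).ncard ≤ σ.ctr 2 + n ∧
          (∀ k ≤ σ.ctr 2, υ.outPoint n k = σ.outPoint n k) ∧
          I.PhaseTwo (υ.outPoint n) (σ.ctr 2) (υ.ctr 2) ∧
          ((υ.ctr 3 = 1 ∧ (I.free (toReal (υ.outPoint n (υ.ctr 2)))).ncard + 1 ≤ k - 1) ∨
            (υ.ctr 3 = 0 ∧ ∀ z : Fin n → ℝ, mulR I.A z = 0 →
              (∀ j, z j ≠ 0 → j ∈ I.free (toReal (υ.outPoint n (υ.ctr 2)))) → z = 0)) := by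
      intro τ₄ d hA₄ hd₄ hdir₄ hpos
      have hW₄ := hW₃.of_agree hA₄
      have hA₀₄ : τ.Agree [12, 13, 14, 15, 17, 21] [7, 8] τ₄ :=
        ((hA₂.mono (by decide) (by decide)).trans (hA₃.mono (by decide) (by decide))).trans
          (hA₄.mono (by decide) (by decide))
      have hs₄ : τ₄.ctr 2 = τ.ctr 2 := hA₀₄.2 2 (by decide)
      have hp₄ : ∀ k, τ₄.outPoint n k = τ.outPoint n k := fun k =>
        funext fun j => hA₀₄.1 6 (by decide) k j
      refine hW₄.runs_takeStep P hd₄ hX (by omega) hdir₄.circuit hdir₄.den ?_ ?_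
      · rw [hs₄, hp₄]
        exact LP.target_sub_mul_pos_of_free hfx hdir₄.supp
      intro υ a hWυ hAυ hhit hsυ hnew hold hstep
      rw [hs₄, hp₄, ← hx] at hhit
      rw [hs₄] at hsυ hnew hold hstep
      rw [hp₄, ← hx] at hnew
      replace hold : ∀ k ≤ τ.ctr 2, υ.outPoint n k = τ.outPoint n k := fun k hk =>
        (hold k hk).trans (hp₄ k)
      have hlt := Set.ncard_lt_ncard (LP.free_ssubset hdir₄.supp hhit) (Set.toFinite _)
      rw [← hnew] at hlt
      refine ⟨hWυ, by omega, by rw [hsυ]; omega,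
        fun k hk => (hold k (by omega)).trans (hsame k hk), ?_, Or.inl ⟨?_, by rw [hsυ]; omega⟩⟩
      · rw [hsυ]
        have hlow : I.PhaseTwo (υ.outPoint n) (σ.ctr 2) (τ.ctr 2) := h2.congr hold
        intro k hk hk'
        rcases Nat.lt_succ_iff_lt_or_eq.1 hk' with hk' | rfl
        · exact hlow k hk hk'
        · refine ⟨hstep, ?_, ?_⟩
          · rw [hnew, hold _ le_rfl]
            exact LP.minFace_ssubset hfx hdir₄.supp hhit
          · rw [hnew, hold _ le_rfl, I.obj_toReal, I.obj_toReal, I.objQ_add_smul]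
            have hapos := hhit.pos
            rcases hpos.lt_or_eq with hpos | hzero
            · left
              have := mul_pos hapos hpos
              exact_mod_cast lt_add_of_pos_right _ this
            · right
              refine ⟨fun z hz hS => hdir₄.obj hzero.symm z hz hS, ?_⟩
              rw [← hzero]; simp [hx]
      · rw [hAυ.2 3 (by decide), hA₀₄.2 3 (by decide), h3]
    refine Runs.ite (fun hneg => ?_) (fun hneg => Runs.skip ?_)
    · simp [h21] at hneg
      refine runs_negate P hW₃.loaded (fun j hj => by
        rw [hd₃ ⟨j, hj⟩]; exact hdir.fitsBits P.sizeX _) ?_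
      refine hfinish _ (fun j => -d₀ j) ⟨fun v hv a b => by simp at hv; simp [hv], by simp⟩
        (by simp [hd₃]) hdir.neg ?_
      rw [I.objQ_neg]; linarith
    · simp [h21] at hneg
      exact hfinish _ d₀ (.refl _ _ _) hd₃ hdir hneg
  · have : (I.free (toReal ((σ.setCtr 3 ((IExpr.const 1).eval σ)).outPoint n
        ((σ.setCtr 3 ((IExpr.const 1).eval σ)).ctr 2)))).ncard ≤ n :=
      (Set.ncard_le_card _).trans (by simp)
    rw [hA₀.2 2 (by decide)] at this ⊢
    omega
  · have : (I.free (toReal ((σ.setCtr 3 ((IExpr.const 1).eval σ)).outPoint n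
        ((σ.setCtr 3 ((IExpr.const 1).eval σ)).ctr 2)))).ncard ≤ n :=
      (Set.ncard_le_card _).trans (by simp)
    omega

/-! ### Initial memory and the complete program -/

theorem ratSize_le_vecSize (x : Fin n → ℚ) (j : Fin n) : ratSize (x j) ≤ vecSize x :=
  Finset.single_le_sum (f := fun j => ratSize (x j)) (fun _ _ => Nat.zero_le _) (Finset.mem_univ j)

theorem ratSize_zero : ratSize 0 = 2 := by simp [ratSize]

theorem bounded_setVec {v : ℕ} (hσ : σ.Bounded K) {x : Fin n → ℚ} (hx : vecSize x ≤ K) :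
    (σ.setVec v x).Bounded K := by
  refine ⟨hσ.1, fun v' i j => ?_⟩
  simp only [Store.setVec]
  split_ifs
  · exact (ratSize_le_vecSize x _).trans hx
  · exact hσ.2 _ _ _
  · exact hσ.2 _ _ _

theorem bounded_initStore {x₀ : Fin n → ℚ} (hI : I.size ≤ K) (hx : vecSize x₀ ≤ K) (hK : 2 ≤ K) :
    (initStore I x₀).Bounded K := by
  refine ⟨fun v => ?_, fun v i j => ?_⟩
  · have : m + n ≤ I.size := by unfold LP.size; omega
    simp only [initStore]
    split_ifs <;> omega
  · have h0 : ratSize 0 ≤ K := ratSize_zero.trans_le hK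
    simp only [initStore]
    split_ifs
    exacts [(I.ratSize_A_le _ _).trans hI, h0, (I.ratSize_b_le _).trans hI, h0,
      (I.ratSize_w_le _).trans hI, h0, (I.ratSize_l_le _).trans hI, h0,
      (I.ratSize_u_le _).trans hI, h0, (ratSize_le_vecSize x₀ _).trans hx, h0, h0, h0]

theorem loaded_init (I : LP m n) (x₀ xhat : Fin n → ℚ) :
    I.Loaded ((initStore I x₀).setVec 7 xhat) := by
  constructor <;> simp [initStore, Store.setVec]

/-- `X` adds up the bits of x̂ - x, of the reductions of its support and of `detBound`. `M` exceeds
the number of steps of both phases by one, as `phaseTwo` needs a last iteration without a step. -/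
theorem runs_walkProg (P : I.Params X M K) {x₀ xhat : Fin n → ℚ} {b : ℕ}
    (hb : I.size + vecSize x₀ + vecSize xhat ≤ b)
    (hx₀ : toReal x₀ ∈ I.feasible) (hhat : I.IsOptimal (toReal xhat))
    (hX : 4 * b + M * (2 * I.size + 2) + n * (2 * I.size + 2) + m * n * (I.size + 1) + 1 ≤ X)
    (hM : n * (3 * I.size + 1) + n + 1 ≤ M) :
    Runs ans M K walkProg ((initStore I x₀).setVec 7 xhat) fun τ =>
      τ.ctr 2 ≤ n * (3 * I.size + 1) + n ∧
      ∃ r q, I.IsTwoPhaseWalk (toReal x₀) (toReal xhat)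
        (fun k => toReal (τ.outPoint n k)) r q (τ.ctr 2) := by
  have hL := loaded_init I x₀ xhat
  have h7 : ∀ j : Fin n, ((initStore I x₀).setVec 7 xhat).cell 7 j 0 = xhat j := fun j => by
    simp [Store.setVec]
  have h5 : ∀ j : Fin n, ((initStore I x₀).setVec 7 xhat).cell 5 j 0 = x₀ j := fun j => by
    simp [Store.setVec, initStore]
  have h2 : ((initStore I x₀).setVec 7 xhat).ctr 2 = 0 := by simp [Store.setVec, initStore]
  generalize (initStore I x₀).setVec 7 xhat = σ at hL h7 h5 h2
  have hden₀ : HasDenominator (2 ^ (2 * b)) x₀ :=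
    (hasDenominator_of_vecSize x₀).mono (Nat.pow_le_pow_right (by norm_num) (by omega))
  have hdenhat : HasDenominator (2 ^ (2 * b)) xhat :=
    (hasDenominator_of_vecSize xhat).mono (Nat.pow_le_pow_right (by norm_num) (by omega))
  have hX1 : 4 * b + M * (2 * I.size + 2) + n * (2 * I.size + 2) + 1 ≤ X := by omega
  have hX2 : 2 * b + M * (2 * I.size + 2) ≤ X := by omega
  refine Runs.seq (Runs.fillRow (r := 0) (fun j => σ.cell 5 j 0) (by decide) hL.ctr1 P.nM P.nK hL.ctr5
    (by simp) (by simp) (fun j hj => ?_) (Runs.seq ?_))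
  · rw [h5 ⟨j, hj⟩]
    exact P.ratSize_le (hden₀.fitsBits _) (by omega)
  have hA₁ : σ.Agree [6] [] (σ.fillRow 6 0 n fun j => σ.cell 5 j 0) :=
    ⟨fun v hv a b => by simp at hv; simp [hv], by simp⟩
  refine runs_computeBound P (hL.of_agree hA₁) (by omega) fun σ₂ hA₂ hbound => ?_
  have hA : σ.Agree [6, 8] [] σ₂ :=
    (hA₁.mono (by decide) (by decide)).trans (hA₂.mono (by decide) (by decide))
  have hs₂ : σ₂.ctr 2 = 0 := (hA.2 2 (by decide)).trans h2
  have hp₂ : σ₂.outPoint n 0 = x₀ := funext fun j => by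
    rw [Store.outPoint, hA₂.1 6 (by decide)]
    simp [h5]
  have hW : I.WalkState x₀ xhat b σ₂ :=
    { loaded := hL.of_agree hA
      hat := fun j => by rw [hA.1 7 (by decide), h7]
      bound := hbound
      start := hp₂
      feas := fun k hk => by
        obtain rfl : k = 0 := by omega
        rwa [hp₂]
      den := by simpa [hs₂, hp₂] using hden₀ }
  refine Runs.seq (runs_phaseOne P hW hhat.1 hdenhat hs₂ hX1 (by omega)
    fun σ₃ hW₃ h1 hgap hr => ?_)
  refine runs_phaseTwo P hW₃ h1 hX2 (by omega)
    fun τ hWτ hle hle' hsame h1τ h2τ hker => ⟨by omega, σ₃.ctr 2, ?_⟩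
  refine LP.exists_isTwoPhaseWalk hhat hWτ.start hWτ.feas hle h1τ ?_ h2τ hker
  rw [hsame, I.obj_toReal, I.obj_toReal, pow_two]
  exact_mod_cast hgap

end Main

/-! ### Explicit polynomials and the theorem -/

/-- A bound on the number of steps, as a polynomial in the size of the linear program. -/
noncomputable def stepPoly : Polynomial ℕ := 4 * (.X + 1) ^ 2

/-- A bound on the bits of the rational numbers that occur. -/
noncomputable def bitPoly : Polynomial ℕ :=
  4 * .X + stepPoly * (2 * .X + 2) + .X * (2 * .X + 2) + .X * .X * (.X + 1) + 1

/-- A bound on the memory contents. -/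
noncomputable def memoryPoly : Polynomial ℕ :=
  2 * ((.X + 1) * (8 * bitPoly + 8)) + 3 + stepPoly + 1

/-- A bound on the running time. -/
noncomputable def runningTimePoly : Polynomial ℕ :=
  2 * .X + 1 + walkProg.timePoly.comp stepPoly * memoryPoly

/-- The parameters are taken at the size `b` of input and solution together; only the length of the
walk is measured by the linear program alone. -/
theorem params_eval {m n : ℕ} (I : LP m n) {b : ℕ} (hb : I.size ≤ b) :
    I.Params (bitPoly.eval b) (stepPoly.eval b) (memoryPoly.eval b) := by
  have hmn : m + n ≤ b := le_trans (by unfold LP.size; omega) hb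
  have hM : b ≤ stepPoly.eval b := by simp [stepPoly]; nlinarith
  refine ⟨?_, by omega, by omega, ?_, ?_⟩
  · refine hb.trans ?_
    simp only [bitPoly, Polynomial.eval_add, Polynomial.eval_mul, Polynomial.eval_X,
      Polynomial.eval_ofNat]
    omega
  · simp [memoryPoly]
  · have : (n + 1) * (8 * bitPoly.eval b + 8) ≤ (b + 1) * (8 * bitPoly.eval b + 8) :=
      Nat.mul_le_mul_right _ (by omega)
    simp [memoryPoly]
    omega

end CircuitWalk

/-- One program computes, for every linear program, every feasible rational starting point and
every optimal solution delivered by the solver, the required walk, with at most one use of the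
solver and in time polynomial in the bit size of the input and of the delivered solution; the
number of steps is polynomial in the bit size of the linear program. -/
theorem theorem1 :
    ∃ (prog : CircuitWalk.Prog) (p : Polynomial ℕ),
      ∀ (m n : ℕ) (I : CircuitWalk.LP m n) (x₀ xhat : Fin n → ℚ),
        CircuitWalk.toReal x₀ ∈ I.feasible → I.IsOptimal (CircuitWalk.toReal xhat) →
        ∃ (σ : CircuitWalk.Store) (time calls : ℕ),
          CircuitWalk.Exec xhat prog (CircuitWalk.initStore I x₀) σ time calls ∧
          calls ≤ 1 ∧
          time ≤ p.eval (I.size + CircuitWalk.vecSize x₀ + CircuitWalk.vecSize xhat) ∧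
          σ.outLength ≤ p.eval I.size ∧
          ∃ r q : ℕ,
            I.IsTwoPhaseWalk (CircuitWalk.toReal x₀) (CircuitWalk.toReal xhat)
              (fun k => CircuitWalk.toReal (σ.outPoint n k)) r q σ.outLength := by
  open CircuitWalk in
  -- One polynomial has to bound both time and length, so the sum of the two is taken.
  refine ⟨.seq (.solveLP 7) walkProg, runningTimePoly + stepPoly,
    fun m n I x₀ xhat hx₀ hhat => ?_⟩
  obtain ⟨b, hb⟩ : ∃ b, b = I.size + vecSize x₀ + vecSize xhat := ⟨_, rfl⟩
  have hmn : m + n ≤ I.size := by unfold LP.size; omega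
  have hP := params_eval I (b := b) (by omega)
  -- As n ≤ size, the left-hand side is at most 3 size² + 2 size + 1.
  have hsteps : n * (3 * I.size + 1) + n + 1 ≤ stepPoly.eval I.size := by
    have : n * (3 * I.size + 1) ≤ I.size * (3 * I.size + 1) := Nat.mul_le_mul_right _ (by omega)
    simp [stepPoly]
    nlinarith
  have hM : stepPoly.eval I.size ≤ stepPoly.eval b := by
    simp [stepPoly]
    gcongr
    omega
  have hX : 4 * b + stepPoly.eval b * (2 * I.size + 2) + n * (2 * I.size + 2) +
      m * n * (I.size + 1) + 1 ≤ bitPoly.eval b := by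
    have hI : I.size ≤ b := by omega
    have hn : n ≤ b := by omega
    have hm : m ≤ b := by omega
    simp only [bitPoly, Polynomial.eval_add, Polynomial.eval_mul, Polynomial.eval_X,
      Polynomial.eval_ofNat, Polynomial.eval_one]
    gcongr
  have hK : 2 * b + 3 ≤ memoryPoly.eval b := by
    simp [memoryPoly]
    nlinarith
  obtain ⟨τ, t, hexec, ht, -, hlen, hwalk⟩ := runs_walkProg (ans := xhat) hP hb.ge hx₀ hhat hX
    (hsteps.trans hM) (bounded_setVec (bounded_initStore (by omega) (by omega) (by omega))
      (by omega))
  refine ⟨τ, _, _, .seq (.solveLP 7 _) hexec, le_rfl, ?_, ?_, hwalk⟩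
  · rw [← hb]
    simp only [runningTimePoly, Polynomial.eval_add, Polynomial.eval_mul, Polynomial.eval_comp,
      Polynomial.eval_X, Polynomial.eval_ofNat, Polynomial.eval_one]
    omega
  · rw [Polynomial.eval_add]
    exact le_trans (by rw [Store.outLength]; omega) (Nat.le_add_left _ _)
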